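/- For a convex polytope $P\subset\mathbb R^3$ and $x\in\mathbb R^3$ let $\omega_P(x)=\mathrm{vol}(B_\varepsilon(x)\cap P)/\mathrm{vol}(B_\varepsilon(x))$ for all sufficiently small $\varepsilon>0$, where $B_\varepsilon(x)$ is the ball of radius $\varepsilon$ centered at $x$. Define the discrete volume $\chi(P)=\sum_{x\in P\cap\mathbb Z^3}\omega_P(x)$ and the volume defect $\delta(P)=\chi(P)-\mathrm{vol}(P)$. A Kagan function is a function $f:\mathbb R\to\mathbb R$ with $f(a+b)=f(a)+f(b)$ for all $a,b\in\mathbb R$ and $f(\pi)=0$; for such $f$ let $D_f(P)=\sum_{e}\ell(e)\,f(\alpha_e)$, where $e$ runs over the edges of $P$, $\ell(e)$ is the length of $e$, and $\alpha_e$ is the dihedral angle of $P$ at $e$. Let $$\begin{aligned} T_1&=\mathrm{conv}\{(0,0,0),(1,1,0),(1,0,1),(0,1,1)\},\\ T_2&=\mathrm{conv}\{(0,0,0),(2,2,-1),(2,-1,2),(1,-2,-2)\},\\ T_3&=\mathrm{conv}\{(0,0,0),(2,2,-1),(3,0,-3),(5,-1,-1)\}, \end{aligned}$$ and let $P=5T_1+12T_2+19T_3$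 (Minkowski sum of dilates). Then $\delta(P)=0$. Moreover, $D_f(P)=-24\sqrt2\,f(\arccos\tfrac13)$ for every Kagan function $f$, and $D_f(P)\neq0$ for some Kagan function $f$. -/

import Mathlib

open MeasureTheory Filter Topology
open scoped Pointwise

noncomputable section

/-- The integer lattice `ℤ^d` as a subset of Euclidean space. -/
def integerLattice (d : ℕ) : Set (EuclideanSpace ℝ (Fin d)) :=
  {x | ∀ i, ∃ n : ℤ, x i = n}

/-- The solid angle of `P` at `x`: the proportion of a small ball centred at `x` that lies in `P`.
For a convex polytope `P` this proportion is constant for all sufficiently small radii, so that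
its limit as the radius tends to `0` is that common value. -/
def solidAngle {d : ℕ} (P : Set (EuclideanSpace ℝ (Fin d))) (x : EuclideanSpace ℝ (Fin d)) : ℝ :=
  limUnder (𝓝[>] (0 : ℝ)) fun ε =>
    volume.real (Metric.ball x ε ∩ P) / volume.real (Metric.ball x ε)

/-- The (regularised) discrete volume `χ(P)`: the sum of the solid angles of `P` over all
integer points of `P` (a finite sum, as polytopes are bounded). -/
def discreteVolume {d : ℕ} (P : Set (EuclideanSpace ℝ (Fin d))) : ℝ :=
  ∑ᶠ x ∈ P ∩ integerLattice d, solidAngle P x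

/-- The volume defect `δ(P) = χ(P) - vol(P)`. -/
def volumeDefect {d : ℕ} (P : Set (EuclideanSpace ℝ (Fin d))) : ℝ :=
  discreteVolume P - volume.real P

/-- The edges of a convex polytope: its one-dimensional (exposed) faces. -/
def polytopeEdges (P : Set (EuclideanSpace ℝ (Fin 3))) : Set (Set (EuclideanSpace ℝ (Fin 3))) :=
  {e | IsExposed ℝ P e ∧ Module.finrank ℝ (vectorSpan ℝ e) = 1}

/-- The dihedral angle of a convex polytope `P` at its edge `e`, measured in the planes
perpendicular to `e`: the section of `P` by such a plane through a point `p` in the relative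
interior of `e` is a convex polygon with a vertex at `p`, and its interior angle at `p` is the
largest angle `∠ y p z` between points `y`, `z` of the section. (The sections through the two
endpoints of `e` contribute no larger angle.) -/
def dihedralAngle (P e : Set (EuclideanSpace ℝ (Fin 3))) : ℝ :=
  sSup {θ | ∃ p ∈ e, ∃ y ∈ P, ∃ z ∈ P, y ≠ p ∧ z ≠ p ∧
    y - p ∈ (vectorSpan ℝ e)ᗮ ∧ z - p ∈ (vectorSpan ℝ e)ᗮ ∧ θ = EuclideanGeometry.angle y p z}

/-- A Kagan function: an additive function `f : ℝ → ℝ` with `f(π) = 0`. -/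
def IsKagan (f : ℝ → ℝ) : Prop :=
  (∀ a b : ℝ, f (a + b) = f a + f b) ∧ f Real.pi = 0

/-- The Dehn invariant `D_f(P)`: the sum over all edges `e` of `P` of the length of `e` times
`f` of the dihedral angle at `e` (a finite sum for a polytope `P`). -/
def dehnInvariant (f : ℝ → ℝ) (P : Set (EuclideanSpace ℝ (Fin 3))) : ℝ :=
  ∑ᶠ e ∈ polytopeEdges P, Metric.diam e * f (dihedralAngle P e)

/-- The regular lattice tetrahedron with edge length `√2`. -/
def tetrahedronT₁ : Set (EuclideanSpace ℝ (Fin 3)) :=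
  convexHull ℝ {!₂[0, 0, 0], !₂[1, 1, 0], !₂[1, 0, 1], !₂[0, 1, 1]}

/-- The standard tetrahedron with three pairwise orthogonal edges of length `3` at the origin. -/
def tetrahedronT₂ : Set (EuclideanSpace ℝ (Fin 3)) :=
  convexHull ℝ {!₂[0, 0, 0], !₂[2, 2, -1], !₂[2, -1, 2], !₂[1, -2, -2]}

/-- The orthoscheme (path simplex) formed by three pairwise orthogonal edges of length `3`. -/
def tetrahedronT₃ : Set (EuclideanSpace ℝ (Fin 3)) :=
  convexHull ℝ {!₂[0, 0, 0], !₂[2, 2, -1], !₂[3, 0, -3], !₂[5, -1, -1]}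

/-- The Minkowski sum `P = 5 T₁ + 12 T₂ + 19 T₃`. -/
def polytopeP : Set (EuclideanSpace ℝ (Fin 3)) :=
  (5 : ℝ) • tetrahedronT₁ + (12 : ℝ) • tetrahedronT₂ + (19 : ℝ) • tetrahedronT₃

end

/-! ### Minkowski sums of polytopes in weight coordinates, and their faces -/

section Mink

/-! Both invariants of P turn out to be the combinations with coefficients 5, 12, 19 of the
invariants of T₁, T₂, T₃, but the defect weighs an edge by its lattice length and the Dehn invariant
by its Euclidean length. Only two irrational dihedral angles occur: α = arccos(1/3) at all edges of
T₁, and β = arccos(1/√3) at the three edges of T₂ not through the origin. They satisfy α + 2β = π.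
All angles of T₃ are rational multiples of π. The edges with angle α in T₁ and β in T₂ have total
lattice lengths 6 and 5, but total Euclidean lengths 6√2 and 9√2, so one choice of coefficients can
cancel the irrational part of the defect without cancelling the Dehn invariant.

Defect. It is additive under dissections (`IsDissection.volumeDefect_eq`) and invariant under
lattice translations and point reflection. It vanishes on lattice parallelepipeds, whose translates
tile space (`volumeDefect_parallelepiped`), hence on lattice prisms, which are halves of them. A
regular mixed subdivision (`isDissection_polytopeP`) cuts P into translates of 5T₁, 12T₂, 19T₃ and
into prisms and parallelepipeds; a similar subdivision of (n+1)T = nT + T shows that the defect of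
nT is n times that of T. Girard's formula (`coneRatio_three`) reduces vertex angles to wedge angles.
With a and b the solid angles of the wedges α and β, the three defects are 6a − 4/3, 5b − 7/4 and
2/3, so δ(P) = 30(a + 2b) − 15, which is zero because a + 2b = 1/2 (`wedgeRatio_relation`).

Dehn invariant. The outer normals of a tetrahedron at an edge form an arc between two facet normals.
In the normal fan of P these arcs are cut into pieces where they meet the arcs of the other
tetrahedra. Each piece belongs to one edge of P, whose length is the sum of the lengths of its
summands (`diam_edgeSelection`) and whose dihedral angle is π minus the length of the piece
(`dihedralAngle_arc`). As f is additive and kills π, the pieces of each arc recombine to the full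
arc (`Sorted.angle_sum`), and the sum over edges of P becomes a sum over the eighteen tetrahedron
edges. It equals 5·6√2·f(α) + 12·9√2·f(β), and f(β) = −f(α)/2 leaves (30 − 54)√2·f(α). By Niven's
theorem α/π is irrational, so some Kagan function does not vanish at α.

The combinatorics of the normal fan and of the subdivision is supplied as integer data and verified
by kernel computation. -/

/-- Nonnegative coefficients supported in `M` whose `i`-th row sums to `lam i`. -/
def IsWeight {ι α : Type*} [Fintype α] (lam : ι → ℝ) (M : ι → Finset α) (c : ι → α → ℝ) : Prop :=
  (∀ i a, 0 ≤ c i a) ∧ (∀ i a, a ∉ M i → c i a = 0) ∧ ∀ i, ∑ a, c i a = lam i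

/-- The point with coefficients `c` with respect to the points `t i a`. -/
def weightedPoint {ι α E : Type*} [Fintype ι] [Fintype α] [AddCommGroup E] [Module ℝ E]
    (t : ι → α → E) (c : ι → α → ℝ) : E := ∑ i, ∑ a, c i a • t i a

/-- The Minkowski sum of the polytopes `lam i • conv (t i '' M i)`. -/
def mink {ι α E : Type*} [Fintype ι] [Fintype α] [AddCommGroup E] [Module ℝ E]
    (t : ι → α → E) (lam : ι → ℝ) (M : ι → Finset α) : Set E :=
  {x | ∃ c, IsWeight lam M c ∧ weightedPoint t c = x}

variable {ι α E : Type*} [Fintype ι] [Fintype α] [AddCommGroup E] [Module ℝ E]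
  {t : ι → α → E} {lam : ι → ℝ} {M : ι → Finset α}

theorem map_weightedPoint {F : Type*} [AddCommGroup F] [Module ℝ F] (l : E →ₗ[ℝ] F)
    (t : ι → α → E) (c : ι → α → ℝ) :
    l (weightedPoint t c) = ∑ i, ∑ a, c i a • l (t i a) := by
  simp [weightedPoint]

theorem vertex_mem_mink [DecidableEq α] (hlam : ∀ i, 0 ≤ lam i) {g : ι → α}
    (hg : ∀ i, g i ∈ M i) : ∑ i, lam i • t i (g i) ∈ mink t lam M := by
  refine ⟨fun i a => if a = g i then lam i else 0, ⟨?_, ?_, ?_⟩, ?_⟩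
  · intro i a
    dsimp only
    split_ifs
    · exact hlam i
    · exact le_rfl
  · intro i a ha
    exact if_neg fun h : a = g i => ha (h ▸ hg i)
  · intro i
    simp
  · simp [weightedPoint, ite_smul]

theorem mink_mono {M' : ι → Finset α} (h : ∀ i, M i ⊆ M' i) : mink t lam M ⊆ mink t lam M' := by
  rintro x ⟨c, ⟨h0, h1, h2⟩, rfl⟩
  exact ⟨c, ⟨h0, fun i a ha => h1 i a fun h' => ha (h i h'), h2⟩, rfl⟩

theorem convex_mink : Convex ℝ (mink t lam M) := by
  rintro x ⟨c, ⟨h0, h1, h2⟩, rfl⟩ y ⟨c', ⟨h0', h1', h2'⟩, rfl⟩ p q hp hq hpq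
  refine ⟨fun i a => p * c i a + q * c' i a, ⟨?_, ?_, ?_⟩, ?_⟩
  · intro i a
    have := h0 i a
    have := h0' i a
    positivity
  · intro i a ha
    simp [h1 i a ha, h1' i a ha]
  · intro i
    rw [Finset.sum_add_distrib, ← Finset.mul_sum, ← Finset.mul_sum, h2, h2', ← add_mul, hpq,
      one_mul]
  · simp only [weightedPoint, Finset.smul_sum, ← Finset.sum_add_distrib, add_smul, mul_smul]

theorem sum_weight_le {c : ι → α → ℝ} (hc : IsWeight lam M c) {φ : ι → α → ℝ} {h : ι → ℝ}
    (hφ : ∀ i, ∀ a ∈ M i, φ i a ≤ h i) : ∑ i, ∑ a, c i a * φ i a ≤ ∑ i, lam i * h i := by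
  refine Finset.sum_le_sum fun i _ => ?_
  rw [← hc.2.2 i, Finset.sum_mul]
  refine Finset.sum_le_sum fun a _ => ?_
  by_cases ha : a ∈ M i
  · exact mul_le_mul_of_nonneg_left (hφ i a ha) (hc.1 i a)
  · simp [hc.2.1 i a ha]

theorem sum_weight_eq {c : ι → α → ℝ} (hc : IsWeight lam M c) {φ : ι → α → ℝ} {h : ι → ℝ}
    (hφ : ∀ i, ∀ a ∈ M i, φ i a = h i) : ∑ i, ∑ a, c i a * φ i a = ∑ i, lam i * h i := by
  refine Finset.sum_congr rfl fun i _ => ?_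
  rw [← hc.2.2 i, Finset.sum_mul]
  refine Finset.sum_congr rfl fun a _ => ?_
  by_cases ha : a ∈ M i
  · rw [hφ i a ha]
  · simp [hc.2.1 i a ha]

/-- Complementary slackness: the total slack, the sum of `c i a * (h i - φ i a)`, vanishes and has
nonnegative terms, so weight can sit only where the bound is attained. -/
theorem weight_support_of_sum_eq {c : ι → α → ℝ} (hc : IsWeight lam M c) {φ : ι → α → ℝ}
    {h : ι → ℝ} (hφ : ∀ i, ∀ a ∈ M i, φ i a ≤ h i)
    (heq : ∑ i, ∑ a, c i a * φ i a = ∑ i, lam i * h i) {i : ι} {a : α} (ha : φ i a ≠ h i) :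
    c i a = 0 := by
  have hnn : ∀ i a, 0 ≤ c i a * (h i - φ i a) := by
    intro i a
    by_cases ha : a ∈ M i
    · exact mul_nonneg (hc.1 i a) (sub_nonneg.2 (hφ i a ha))
    · simp [hc.2.1 i a ha]
  have hsum : ∑ i, ∑ a, c i a * (h i - φ i a) = 0 := by
    simp only [mul_sub, Finset.sum_sub_distrib, ← Finset.sum_mul, hc.2.2]
    linarith
  have h1 := (Finset.sum_eq_zero_iff_of_nonneg
    (fun i _ => Finset.sum_nonneg fun a _ => hnn i a)).1 hsum i (Finset.mem_univ _)
  have h2 := (Finset.sum_eq_zero_iff_of_nonneg (fun a _ => hnn i a)).1 h1 a (Finset.mem_univ _)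
  rcases mul_eq_zero.1 h2 with h3 | h3
  · exact h3
  · exact absurd (by linarith) ha

/-- The face of a Minkowski sum is the Minkowski sum of the faces. -/
theorem mem_mink_face_iff {M' : ι → Finset α} (l : E →ₗ[ℝ] ℝ)
    {h : ι → ℝ} (hM : ∀ i, M' i ⊆ M i) (hle : ∀ i, ∀ a ∈ M i, l (t i a) ≤ h i)
    (heq : ∀ i, ∀ a ∈ M i, a ∈ M' i ↔ l (t i a) = h i) {x : E} :
    x ∈ mink t lam M' ↔ x ∈ mink t lam M ∧ l x = ∑ i, lam i * h i := by
  constructor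
  · intro hx
    refine ⟨mink_mono hM hx, ?_⟩
    obtain ⟨c, hc, rfl⟩ := hx
    rw [map_weightedPoint]
    exact sum_weight_eq hc fun i a ha => (heq i a (hM i ha)).1 ha
  · rintro ⟨⟨c, hc, rfl⟩, hl⟩
    rw [map_weightedPoint] at hl
    refine ⟨c, ⟨hc.1, fun i a ha => ?_, hc.2.2⟩, rfl⟩
    by_cases haM : a ∈ M i
    · exact weight_support_of_sum_eq hc hle hl fun h' => ha ((heq i a haM).2 h')
    · exact hc.2.1 i a haM

theorem le_of_mem_mink (l : E →ₗ[ℝ] ℝ) {h : ι → ℝ}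
    (hle : ∀ i, ∀ a ∈ M i, l (t i a) ≤ h i) {x : E} (hx : x ∈ mink t lam M) :
    l x ≤ ∑ i, lam i * h i := by
  obtain ⟨c, hc, rfl⟩ := hx
  rw [map_weightedPoint]
  exact sum_weight_le hc hle

theorem mem_smul_convexHull_range_iff {s : α → E} {r : ℝ} (hr : 0 < r) {x : E} :
    x ∈ r • convexHull ℝ (Set.range s) ↔
      ∃ c : α → ℝ, (∀ a, 0 ≤ c a) ∧ ∑ a, c a = r ∧ ∑ a, c a • s a = x := by
  classical
  rw [Set.mem_smul_set]
  constructor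
  · rintro ⟨y, hy, rfl⟩
    rw [mem_convexHull_iff_exists_fintype] at hy
    obtain ⟨κ, _, w, z, hw0, hw1, hz, rfl⟩ := hy
    choose g hg using hz
    refine ⟨fun a => r * ∑ k, if g k = a then w k else 0, fun a => ?_, ?_, ?_⟩
    · refine mul_nonneg hr.le (Finset.sum_nonneg fun k _ => ?_)
      split_ifs
      · exact hw0 k
      · exact le_rfl
    · rw [← Finset.mul_sum, Finset.sum_comm]
      simp [hw1]
    · simp only [mul_smul, ← Finset.smul_sum, Finset.sum_smul]
      rw [Finset.sum_comm]
      simp [ite_smul, hg]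
  · rintro ⟨c, hc0, hc1, rfl⟩
    refine ⟨∑ a, (r⁻¹ * c a) • s a, ?_, ?_⟩
    · refine mem_convexHull_of_exists_fintype (fun a => r⁻¹ * c a) s (fun a => ?_) ?_
        (fun a => ⟨a, rfl⟩) rfl
      · have := hc0 a
        positivity
      · rw [← Finset.mul_sum, hc1, inv_mul_cancel₀ hr.ne']
    · simp only [mul_smul, ← Finset.smul_sum]
      rw [smul_inv_smul₀ hr.ne']

theorem mink_univ_eq_sum (hlam : ∀ i, 0 < lam i) :
    mink t lam (fun _ => Finset.univ) = ∑ i, lam i • convexHull ℝ (Set.range (t i)) := by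
  ext x
  rw [Set.mem_fintype_sum]
  constructor
  · rintro ⟨c, ⟨h0, -, h2⟩, rfl⟩
    exact ⟨fun i => ∑ a, c i a • t i a,
      fun i => (mem_smul_convexHull_range_iff (hlam i)).2 ⟨c i, h0 i, h2 i, rfl⟩, rfl⟩
  · rintro ⟨g, hg, rfl⟩
    choose c hc0 hc1 hc2 using fun i => (mem_smul_convexHull_range_iff (hlam i)).1 (hg i)
    exact ⟨c, ⟨hc0, by simp, hc1⟩, by simp [weightedPoint, hc2]⟩

end Mink

/-! ### Integer vectors and the tetrahedra as integer data -/

/-- The point of Euclidean space with the given integer coordinates. -/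
noncomputable def intPoint (z : Fin 3 → ℤ) : EuclideanSpace ℝ (Fin 3) :=
  WithLp.toLp 2 fun j => (z j : ℝ)

@[simp] theorem intPoint_apply (z : Fin 3 → ℤ) (j : Fin 3) : intPoint z j = z j := rfl

theorem intPoint_add (z w : Fin 3 → ℤ) : intPoint (z + w) = intPoint z + intPoint w := by
  ext j; simp

theorem intPoint_sub (z w : Fin 3 → ℤ) : intPoint (z - w) = intPoint z - intPoint w := by
  ext j; simp

theorem intPoint_smul (n : ℤ) (z : Fin 3 → ℤ) : intPoint (n • z) = (n : ℝ) • intPoint z := by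
  ext j; simp

/-- The dot product of integer vectors. -/
def idot (z w : Fin 3 → ℤ) : ℤ := z 0 * w 0 + z 1 * w 1 + z 2 * w 2

theorem inner_intPoint_left (z : Fin 3 → ℤ) (x : EuclideanSpace ℝ (Fin 3)) :
    inner ℝ (intPoint z) x = z 0 * x 0 + z 1 * x 1 + z 2 * x 2 := by
  simp [PiLp.inner_apply, Fin.sum_univ_three, mul_comm]

theorem inner_intPoint (z w : Fin 3 → ℤ) :
    inner ℝ (intPoint z) (intPoint w) = (idot z w : ℝ) := by
  rw [inner_intPoint_left]; simp [idot]

/-- The vertices of the three tetrahedra. -/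
def tetVertex : Fin 3 → Fin 4 → Fin 3 → ℤ :=
  ![![![0, 0, 0], ![1, 1, 0], ![1, 0, 1], ![0, 1, 1]],
    ![![0, 0, 0], ![2, 2, -1], ![2, -1, 2], ![1, -2, -2]],
    ![![0, 0, 0], ![2, 2, -1], ![3, 0, -3], ![5, -1, -1]]]

/-- The dilation factors. -/
def tetScale : Fin 3 → ℤ := ![5, 12, 19]

theorem range_intPoint_four (v : Fin 4 → Fin 3 → ℤ) :
    Set.range (fun a => intPoint (v a)) =
      {intPoint (v 0), intPoint (v 1), intPoint (v 2), intPoint (v 3)} := by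
  ext x
  simp [Fin.exists_fin_succ, eq_comm]

theorem tetrahedronT₁_eq :
    tetrahedronT₁ = convexHull ℝ (Set.range fun a => intPoint (tetVertex 0 a)) := by
  rw [range_intPoint_four, tetrahedronT₁]
  congr 3 <;> (try congr 1) <;> (try congr 1) <;> (try congr 1) <;> ext j <;> fin_cases j <;> simp [tetVertex]

theorem tetrahedronT₂_eq :
    tetrahedronT₂ = convexHull ℝ (Set.range fun a => intPoint (tetVertex 1 a)) := by
  rw [range_intPoint_four, tetrahedronT₂]
  congr 3 <;> (try congr 1) <;> (try congr 1) <;> (try congr 1) <;> ext j <;> fin_cases j <;> simp [tetVertex]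

theorem tetrahedronT₃_eq :
    tetrahedronT₃ = convexHull ℝ (Set.range fun a => intPoint (tetVertex 2 a)) := by
  rw [range_intPoint_four, tetrahedronT₃]
  congr 3 <;> (try congr 1) <;> (try congr 1) <;> (try congr 1) <;> ext j <;> fin_cases j <;> simp [tetVertex]

theorem polytopeP_eq :
    polytopeP = mink (fun i a => intPoint (tetVertex i a)) (fun i => (tetScale i : ℝ))
      (fun _ => Finset.univ) := by
  rw [mink_univ_eq_sum (by intro i; fin_cases i <;> simp [tetScale]), Fin.sum_univ_three,
    ← tetrahedronT₁_eq, ← tetrahedronT₂_eq, ← tetrahedronT₃_eq, polytopeP]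
  simp [tetScale]

/-! ### Angles in planar cones -/

section Wedge

open InnerProductGeometry

variable {V : Type*} [NormedAddCommGroup V] [InnerProductSpace ℝ V]

theorem mem_span_nnreal_pair {x z : V} {a b : ℝ} (ha : 0 ≤ a) (hb : 0 ≤ b) :
    a • x + b • z ∈ Submodule.span NNReal {x, z} := by
  rw [Submodule.mem_span_pair]
  exact ⟨⟨a, ha⟩, ⟨b, hb⟩, rfl⟩

theorem angle_add_of_conic {x z : V} {a b : ℝ} (ha : 0 ≤ a) (hb : 0 ≤ b)
    (h0 : a • x + b • z ≠ 0) :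
    angle x z = angle x (a • x + b • z) + angle (a • x + b • z) z :=
  angle_eq_angle_add_add_angle_add_of_mem_span h0 (mem_span_nnreal_pair ha hb)

/-- Two vectors in the cone spanned by `x` and `z` enclose an angle of at most `angle x z`. -/
theorem angle_conic_le {x z : V} {a b a' b' : ℝ} (ha : 0 ≤ a) (hb : 0 ≤ b)
    (ha' : 0 ≤ a') (hb' : 0 ≤ b') (h0 : a • x + b • z ≠ 0) (h0' : a' • x + b' • z ≠ 0) :
    angle (a • x + b • z) (a' • x + b' • z) ≤ angle x z := by
  wlog h : a' * b ≤ a * b' generalizing a b a' b'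
  · rw [angle_comm]
    exact this ha' hb' ha hb h0' h0 (by linarith)
  -- the second vector lies between the first one and `z`
  have h1 := angle_add_of_conic ha hb h0
  have h2 : angle (a • x + b • z) z =
      angle (a • x + b • z) (a' • x + b' • z) + angle (a' • x + b' • z) z := by
    refine angle_eq_angle_add_add_angle_add_of_mem_span h0' ?_
    -- If `a = 0`, the first vector is already on the ray of `z`, and the assumed order forces `a' =
    -- 0`; otherwise `x` can be eliminated in favour of the first vector.
    rcases ha.eq_or_lt with rfl | hapos
    · have hb0 : 0 < b := by
        rcases hb.eq_or_lt with rfl | hb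
        · simp at h0
        · exact hb
      have ha0 : a' = 0 := by nlinarith
      have : a' • x + b' • z = (0 : ℝ) • ((0 : ℝ) • x + b • z) + b' • z := by simp [ha0]
      rw [this]
      exact mem_span_nnreal_pair le_rfl hb'
    · have : a' • x + b' • z = (a' / a) • (a • x + b • z) + ((a * b' - a' * b) / a) • z := by
        rw [smul_add, smul_smul, smul_smul, add_assoc, ← add_smul]
        congr 2 <;> field_simp
        ring
      rw [this]
      exact mem_span_nnreal_pair (by positivity) (div_nonneg (by linarith) ha)
  have h3 := angle_nonneg x (a • x + b • z)
  have h4 := angle_nonneg (a' • x + b' • z) z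
  linarith

/-- The directions of the two sides of a planar wedge with outer normals `u` and `v`. -/
theorem angle_wedge_sides {u v : V} (h : inner ℝ u v ^ 2 < inner ℝ u u * inner ℝ v v) :
    angle ((inner ℝ u v : ℝ) • u - (inner ℝ u u : ℝ) • v)
      ((inner ℝ u v : ℝ) • v - (inner ℝ v v : ℝ) • u) = Real.pi - angle u v := by
  have hu : inner ℝ u u = ‖u‖ ^ 2 := real_inner_self_eq_norm_sq u
  have hv : inner ℝ v v = ‖v‖ ^ 2 := real_inner_self_eq_norm_sq v
  set W : ℝ := inner ℝ u v with hW
  set U := ‖u‖ with hU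
  set Vv := ‖v‖ with hV
  rw [hu, hv] at h ⊢
  have hvu : inner ℝ v u = W := by rw [real_inner_comm]
  have hUpos : 0 < U := by
    rcases (norm_nonneg u).eq_or_lt with h0 | h0
    · rw [← hU] at h0
      rw [← h0] at h
      nlinarith [sq_nonneg W]
    · exact h0
  have hVpos : 0 < Vv := by
    rcases (norm_nonneg v).eq_or_lt with h0 | h0
    · rw [← hV] at h0
      rw [← h0] at h
      nlinarith [sq_nonneg W]
    · exact h0
  have hD : 0 < U ^ 2 * Vv ^ 2 - W ^ 2 := by linarith
  have n1 : ‖W • u - U ^ 2 • v‖ = U * √(U ^ 2 * Vv ^ 2 - W ^ 2) := by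
    have : ‖W • u - U ^ 2 • v‖ ^ 2 = U ^ 2 * (U ^ 2 * Vv ^ 2 - W ^ 2) := by
      rw [← real_inner_self_eq_norm_sq]
      simp only [inner_sub_left, inner_sub_right, real_inner_smul_left, real_inner_smul_right,
        hu, hv, hvu, ← hW]
      ring
    rw [← Real.sqrt_sq (norm_nonneg _), this, Real.sqrt_mul (by positivity),
      Real.sqrt_sq hUpos.le]
  have n2 : ‖W • v - Vv ^ 2 • u‖ = Vv * √(U ^ 2 * Vv ^ 2 - W ^ 2) := by
    have : ‖W • v - Vv ^ 2 • u‖ ^ 2 = Vv ^ 2 * (U ^ 2 * Vv ^ 2 - W ^ 2) := by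
      rw [← real_inner_self_eq_norm_sq]
      simp only [inner_sub_left, inner_sub_right, real_inner_smul_left, real_inner_smul_right,
        hu, hv, hvu, ← hW]
      ring
    rw [← Real.sqrt_sq (norm_nonneg _), this, Real.sqrt_mul (by positivity),
      Real.sqrt_sq hVpos.le]
  rw [angle, angle, ← Real.arccos_neg, n1, n2]
  congr 1
  simp only [inner_sub_left, inner_sub_right, real_inner_smul_left, real_inner_smul_right,
      hu, hv, hvu, ← hW, ← hU, ← hV]
  have hs : √(U ^ 2 * Vv ^ 2 - W ^ 2) * √(U ^ 2 * Vv ^ 2 - W ^ 2) = U ^ 2 * Vv ^ 2 - W ^ 2 :=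
    Real.mul_self_sqrt hD.le
  have : U * √(U ^ 2 * Vv ^ 2 - W ^ 2) * (Vv * √(U ^ 2 * Vv ^ 2 - W ^ 2)) =
      U * Vv * (U ^ 2 * Vv ^ 2 - W ^ 2) := by linear_combination (U * Vv) * hs
  rw [this]
  rw [div_eq_iff (mul_pos (mul_pos hUpos hVpos) hD).ne', neg_mul, div_mul_eq_mul_div,
    mul_div_assoc, mul_div_cancel_left₀ _ (mul_pos hUpos hVpos).ne']
  ring

end Wedge

/-! ### The dihedral angle in terms of outer normals -/

section DihedralAngle

open InnerProductGeometry

/-- The dihedral angle at an edge is determined by the outer normals of the two facets. -/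
theorem dihedralAngle_eq {P e : Set (EuclideanSpace ℝ (Fin 3))}
    {u v pa pb d pF pG : EuclideanSpace ℝ (Fin 3)} {hu hv : ℝ}
    (hP : Convex ℝ P) (heP : e ⊆ P) (he : Convex ℝ e)
    (hPu : ∀ x ∈ P, inner ℝ u x ≤ hu) (hPv : ∀ x ∈ P, inner ℝ v x ≤ hv)
    (heu : ∀ x ∈ e, inner ℝ u x = hu) (hev : ∀ x ∈ e, inner ℝ v x = hv)
    (hpa : pa ∈ e) (hpb : pb ∈ e) (hd : pb - pa = d) (hd0 : d ≠ 0)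
    (hspan : vectorSpan ℝ e = Submodule.span ℝ {d})
    (hgen : ∀ w : EuclideanSpace ℝ (Fin 3),
      inner ℝ u w = 0 → inner ℝ v w = 0 → inner ℝ d w = 0 → w = 0)
    (hpF : pF ∈ P) (hFu : inner ℝ u pF = hu) (hFv : inner ℝ v pF < hv)
    (hpG : pG ∈ P) (hGv : inner ℝ v pG = hv) (hGu : inner ℝ u pG < hu) :
    dihedralAngle P e = Real.pi - angle u v := by
  have hud : inner ℝ u d = 0 := by rw [← hd, inner_sub_right, heu _ hpa, heu _ hpb, sub_self]
  have hvd : inner ℝ v d = 0 := by rw [← hd, inner_sub_right, hev _ hpa, hev _ hpb, sub_self]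
  have hdu : inner ℝ d u = 0 := by rw [real_inner_comm]; exact hud
  have hdv : inner ℝ d v = 0 := by rw [real_inner_comm]; exact hvd
  have hvu : inner ℝ v u = inner ℝ u v := real_inner_comm _ _
  have hdd : inner ℝ d d ≠ 0 := by simpa using hd0
  have hCS : inner ℝ u v ^ 2 < inner ℝ u u * inner ℝ v v := by
    have h1 := real_inner_mul_inner_self_le u v
    refine lt_of_le_of_ne (by rw [sq]; exact h1) fun heq => ?_
    have h2 : (inner ℝ u v : ℝ) • u - (inner ℝ u u : ℝ) • v = 0 := by
      apply hgen
      · simp only [inner_sub_right, real_inner_smul_right]; ring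
      · simp only [inner_sub_right, real_inner_smul_right, hvu]; linarith
      · simp only [inner_sub_right, real_inner_smul_right, hdu, hdv]; ring
    have h3 : inner ℝ ((inner ℝ u v : ℝ) • u - (inner ℝ u u : ℝ) • v) (pF - pa) = 0 := by
      rw [h2, inner_zero_left]
    simp only [inner_sub_left, inner_sub_right, real_inner_smul_left, hFu, heu _ hpa,
      hev _ hpa] at h3
    have h4 : inner ℝ u u = (0 : ℝ) := by
      rcases mul_eq_zero.1 (show inner ℝ u u * (inner ℝ v pF - hv) = (0 : ℝ) by linarith)
        with h | h
      · exact h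
      · linarith
    rw [inner_self_eq_zero] at h4
    rw [h4, inner_zero_left] at hGu
    have := heu _ hpa
    rw [h4, inner_zero_left] at this
    linarith
  set D : ℝ := inner ℝ u u * inner ℝ v v - inner ℝ u v ^ 2 with hD
  have hDpos : 0 < D := by linarith
  set Y := (inner ℝ u v : ℝ) • u - (inner ℝ u u : ℝ) • v with hY
  set Z := (inner ℝ u v : ℝ) • v - (inner ℝ v v : ℝ) • u with hZ
  -- `Y` and `Z` span the plane orthogonal to `d`, with `Y` orthogonal to `u` and `Z` to `v`. The
  -- coordinates are minus the values of `v` and `u` over the Gram determinant, so they are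
  -- nonnegative for directions pointing into `P`: the section of `P` lies in the cone of `Y` and
  -- `Z`.
  have hdec : ∀ w : EuclideanSpace ℝ (Fin 3), inner ℝ d w = 0 →
      w = (-inner ℝ v w / D) • Y + (-inner ℝ u w / D) • Z := by
    intro w hw
    rw [← sub_eq_zero]
    apply hgen
    · simp only [hY, hZ, inner_sub_right, inner_add_right, real_inner_smul_right]
      field_simp
      rw [hD]
      ring
    · simp only [hY, hZ, inner_sub_right, inner_add_right, real_inner_smul_right, hvu]
      field_simp
      rw [hD]
      ring
    · simp only [hY, hZ, inner_sub_right, inner_add_right, real_inner_smul_right, hdu, hdv, hw]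
      ring
  rw [← angle_wedge_sides hCS, ← hY, ← hZ, dihedralAngle, hspan]
  simp only [Submodule.mem_orthogonal_singleton_iff_inner_right]
  refine IsGreatest.csSup_eq ⟨?_, ?_⟩
  -- The angle is attained at the midpoint of `pa` and `pb`, which leaves room to move along the
  -- edge in both directions.
  · set p0 := (1 / 2 : ℝ) • pa + (1 / 2 : ℝ) • pb with hp0
    have hp0e : p0 ∈ e := he hpa hpb (by norm_num) (by norm_num) (by norm_num)
    -- The component of `q - p0` orthogonal to `d` is realised in `P` up to a positive factor: `q`
    -- is averaged with a point of the edge displaced so as to cancel the component along `d`. The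
    -- denominators with `|k|` keep that point between `pa` and `pb`.
    have key : ∀ q ∈ P, ∃ s : ℝ, 0 < s ∧ ∃ y ∈ P,
        y - p0 = s • (q - p0 - (inner ℝ d (q - p0) / inner ℝ d d) • d) := by
      intro q hq
      set k := inner ℝ d (q - p0) / inner ℝ d d with hk
      have hk1 : k ≤ |k| := le_abs_self k
      have hk2 : -k ≤ |k| := neg_le_abs k
      have hk3 : 0 ≤ |k| := abs_nonneg k
      have hp1 : (1 / 2 + k / (2 + 2 * |k|)) • pa + (1 / 2 - k / (2 + 2 * |k|)) • pb ∈ e := by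
        refine he hpa hpb ?_ ?_ (by ring)
        · have : -(1 / 2) ≤ k / (2 + 2 * |k|) := by
            rw [le_div_iff₀ (by positivity)]; linarith
          linarith
        · have : k / (2 + 2 * |k|) ≤ 1 / 2 := by
            rw [div_le_iff₀ (by positivity)]; linarith
          linarith
      refine ⟨1 / (3 + 2 * |k|), by positivity,
        ((2 + 2 * |k|) / (3 + 2 * |k|)) •
          ((1 / 2 + k / (2 + 2 * |k|)) • pa + (1 / 2 - k / (2 + 2 * |k|)) • pb) +
          (1 / (3 + 2 * |k|)) • q,
        hP (heP hp1) hq (by positivity) (by positivity) (by field_simp; ring), ?_⟩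
      rw [hp0, ← hd]
      have h1 : (3 + 2 * |k|) ≠ 0 := by positivity
      have h2 : (2 + 2 * |k|) ≠ 0 := by positivity
      match_scalars <;> field_simp <;> ring
    have horth : ∀ q : EuclideanSpace ℝ (Fin 3),
        inner ℝ d (q - p0 - (inner ℝ d (q - p0) / inner ℝ d d) • d) = 0 := by
      intro q
      rw [inner_sub_right, real_inner_smul_right, div_mul_cancel₀ _ hdd, sub_self]
    obtain ⟨s, hs, y, hyP, hy⟩ := key pF hpF
    obtain ⟨s', hs', z, hzP, hz⟩ := key pG hpG
    have hyY : y - p0 = (s * ((hv - inner ℝ v pF) / D)) • Y := by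
      rw [hy, hdec _ (horth pF)]
      simp only [inner_sub_right, real_inner_smul_right, hud, hvd, hFu, heu _ hp0e, hev _ hp0e]
      rw [mul_smul]
      congr 1
      simp
    have hzZ : z - p0 = (s' * ((hu - inner ℝ u pG) / D)) • Z := by
      rw [hz, hdec _ (horth pG)]
      simp only [inner_sub_right, real_inner_smul_right, hud, hvd, hGv, heu _ hp0e, hev _ hp0e]
      rw [mul_smul]
      congr 1
      simp
    have hs1 : 0 < s * ((hv - inner ℝ v pF) / D) :=
      mul_pos hs (div_pos (by linarith) hDpos)
    have hs2 : 0 < s' * ((hu - inner ℝ u pG) / D) :=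
      mul_pos hs' (div_pos (by linarith) hDpos)
    have hvY : inner ℝ v Y = -D := by
      simp only [hY, inner_sub_right, real_inner_smul_right, hvu, hD]; ring
    have huZ : inner ℝ u Z = -D := by
      simp only [hZ, inner_sub_right, real_inner_smul_right, hD]; ring
    have hY0 : Y ≠ 0 := by
      intro h0
      rw [h0, inner_zero_right] at hvY
      linarith
    have hZ0 : Z ≠ 0 := by
      intro h0
      rw [h0, inner_zero_right] at huZ
      linarith
    refine ⟨p0, hp0e, y, hyP, z, hzP, ?_, ?_, ?_, ?_, ?_⟩
    · rw [← sub_ne_zero, hyY]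
      exact smul_ne_zero hs1.ne' hY0
    · rw [← sub_ne_zero, hzZ]
      exact smul_ne_zero hs2.ne' hZ0
    · rw [hy, real_inner_smul_right, horth, mul_zero]
    · rw [hz, real_inner_smul_right, horth, mul_zero]
    · rw [EuclideanGeometry.angle, vsub_eq_sub, vsub_eq_sub, hyY, hzZ,
        angle_smul_left_of_pos _ _ hs1, angle_smul_right_of_pos _ _ hs2]
  · rintro θ ⟨p, hp, y, hy, z, hz, hyp, hzp, hyo, hzo, rfl⟩
    rw [EuclideanGeometry.angle, vsub_eq_sub, vsub_eq_sub]
    rw [← sub_ne_zero] at hyp hzp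
    have hnn : ∀ q ∈ P, 0 ≤ -inner ℝ v (q - p) / D ∧ 0 ≤ -inner ℝ u (q - p) / D := by
      intro q hq
      rw [inner_sub_right, inner_sub_right, heu _ hp, hev _ hp]
      have := hPu q hq
      have := hPv q hq
      exact ⟨div_nonneg (by linarith) hDpos.le, div_nonneg (by linarith) hDpos.le⟩
    have h1 := hdec _ hyo
    have h2 := hdec _ hzo
    rw [h1] at hyp
    rw [h2] at hzp
    rw [h1, h2]
    exact angle_conic_le (hnn y hy).1 (hnn y hy).2 (hnn z hz).1 (hnn z hz).2 hyp hzp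

end DihedralAngle

/-! ### Integer linear algebra and chains of normals -/

/-- The determinant of three integer vectors. -/
def det3 (x y z : Fin 3 → ℤ) : ℤ :=
  x 0 * (y 1 * z 2 - y 2 * z 1) + x 1 * (y 2 * z 0 - y 0 * z 2) + x 2 * (y 0 * z 1 - y 1 * z 0)

/-- The cross product of integer vectors. -/
def icross (x y : Fin 3 → ℤ) : Fin 3 → ℤ :=
  ![x 1 * y 2 - x 2 * y 1, x 2 * y 0 - x 0 * y 2, x 0 * y 1 - x 1 * y 0]

/-- Cramer's rule; the coefficients in the proof are the cofactors. -/
theorem eq_zero_of_inner_eq_zero {u v w : Fin 3 → ℤ} (h : det3 u v w ≠ 0)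
    {x : EuclideanSpace ℝ (Fin 3)} (hu : inner ℝ (intPoint u) x = 0)
    (hv : inner ℝ (intPoint v) x = 0) (hw : inner ℝ (intPoint w) x = 0) : x = 0 := by
  rw [inner_intPoint_left] at hu hv hw
  have h' : (det3 u v w : ℝ) ≠ 0 := by exact_mod_cast h
  have key : ∀ j, (det3 u v w : ℝ) * x j = 0 := by
    intro j
    simp only [det3]
    push_cast
    fin_cases j <;> simp only [Fin.zero_eta, Fin.mk_one, Fin.reduceFinMk]
    · linear_combination ((v 1 : ℝ) * w 2 - v 2 * w 1) * hu + ((w 1 : ℝ) * u 2 - w 2 * u 1) * hv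
        + ((u 1 : ℝ) * v 2 - u 2 * v 1) * hw
    · linear_combination ((v 2 : ℝ) * w 0 - v 0 * w 2) * hu + ((w 2 : ℝ) * u 0 - w 0 * u 2) * hv
        + ((u 2 : ℝ) * v 0 - u 0 * v 2) * hw
    · linear_combination ((v 0 : ℝ) * w 1 - v 1 * w 0) * hu + ((w 0 : ℝ) * u 1 - w 1 * u 0) * hv
        + ((u 0 : ℝ) * v 1 - u 1 * v 0) * hw
  ext j
  exact (mul_eq_zero.1 (key j)).resolve_left h'

/-- The consecutive pairs of the list `x :: ys ++ [z]`. -/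
def arcs {A : Type*} : A → List A → A → List (A × A)
  | x, [], z => [(x, z)]
  | x, y :: ys, z => (x, y) :: arcs y ys z

/-- The vectors `x :: ys ++ [z]` are perpendicular to a common direction and sorted by angle
around it. -/
def Sorted (d : Fin 3 → ℤ) : (Fin 3 → ℤ) → List (Fin 3 → ℤ) → (Fin 3 → ℤ) → Prop
  | _, [], _ => True
  | x, y :: ys, z => 0 < det3 d y z ∧ 0 < det3 d x y ∧ 0 < det3 d x z ∧
      -- This identity with positive coefficients is what puts `y` inside the cone of `x` and `z`;
      -- the subdivision of the angle uses nothing else.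
      det3 d x z • y = det3 d y z • x + det3 d x y • z ∧ Sorted d y ys z

instance decidableSorted (d : Fin 3 → ℤ) :
    ∀ (x : Fin 3 → ℤ) (ys : List (Fin 3 → ℤ)) (z : Fin 3 → ℤ), Decidable (Sorted d x ys z)
  | _, [], _ => isTrue trivial
  | _, y :: ys, z =>
    have := decidableSorted d y ys z
    inferInstanceAs (Decidable (_ ∧ _))

theorem Sorted.relation {d x y z : Fin 3 → ℤ} {ys : List (Fin 3 → ℤ)}
    (h : Sorted d x (y :: ys) z) : (det3 d x z : ℝ) • intPoint y =
      (det3 d y z : ℝ) • intPoint x + (det3 d x y : ℝ) • intPoint z := by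
  rw [← intPoint_smul, ← intPoint_smul, ← intPoint_smul, ← intPoint_add, h.2.2.2.1]

/-- A vector in the open cone between the ends of a sorted chain lies in one of the open cones
between neighbours, or on the ray of an interior member. -/
theorem Sorted.cases {d z : Fin 3 → ℤ} {ys : List (Fin 3 → ℤ)} {x : Fin 3 → ℤ}
    (h : Sorted d x ys z) {L : EuclideanSpace ℝ (Fin 3)} {p q : ℝ} (hp : 0 < p) (hq : 0 < q)
    (hL : L = p • intPoint x + q • intPoint z) :
    (∃ uv ∈ arcs x ys z, ∃ p' q' : ℝ, 0 < p' ∧ 0 < q' ∧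
      L = p' • intPoint uv.1 + q' • intPoint uv.2) ∨
    (∃ y ∈ ys, ∃ r : ℝ, 0 < r ∧ L = r • intPoint y) := by
  induction ys generalizing x p q with
  | nil => exact Or.inl ⟨(x, z), by simp [arcs], p, q, hp, hq, hL⟩
  | cons y ys ih =>
    have hrel := h.relation
    have ha : (0 : ℝ) < det3 d y z := by exact_mod_cast h.1
    have hb : (0 : ℝ) < det3 d x y := by exact_mod_cast h.2.1
    have hc : (0 : ℝ) < det3 d x z := by exact_mod_cast h.2.2.1
    set a : ℝ := (det3 d y z : ℝ)
    set b : ℝ := (det3 d x y : ℝ)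
    set c : ℝ := (det3 d x z : ℝ)
    have hz : intPoint z = (c / b) • intPoint y - (a / b) • intPoint x := by
      have : b • intPoint z = c • intPoint y - a • intPoint x := by rw [hrel]; abel
      rw [← inv_smul_smul₀ hb.ne' (intPoint z), this, smul_sub, smul_smul, smul_smul]
      congr 2 <;> ring
    have hx : intPoint x = (c / a) • intPoint y - (b / a) • intPoint z := by
      have : a • intPoint x = c • intPoint y - b • intPoint z := by rw [hrel]; abel
      rw [← inv_smul_smul₀ ha.ne' (intPoint x), this, smul_sub, smul_smul, smul_smul]
      congr 2 <;> ring
    -- `y` is proportional to `a • x + b • z`, so comparing `p * b` with `q * a` decides on which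
    -- side of `y` the vector `L` lies.
    rcases lt_trichotomy (p * b) (q * a) with hlt | heq | hgt
    · have hq' : 0 < q - p * b / a := by
        rw [sub_pos, div_lt_iff₀ ha]; exact hlt
      rcases ih h.2.2.2.2 (p := p * c / a) (by positivity) (q := q - p * b / a) hq'
        (by rw [hL, hx]; module) with ⟨uv, huv, h'⟩ | ⟨y', hy', h'⟩
      · exact Or.inl ⟨uv, by rw [arcs]; exact List.mem_cons_of_mem _ huv, h'⟩
      · exact Or.inr ⟨y', List.mem_cons_of_mem _ hy', h'⟩
    · refine Or.inr ⟨y, by simp, q * c / b, by positivity, ?_⟩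
      have hp' : p = q * a / b := by field_simp; exact heq
      rw [hL, hz, hp']
      module
    · refine Or.inl ⟨(x, y), by simp [arcs], p - q * a / b, q * c / b, ?_, by positivity, ?_⟩
      · rw [sub_pos, div_lt_iff₀ hb]; exact hgt
      · rw [hL, hz]; module

/-- Each interior member splits the remaining angle in two, and `f` respects the splitting. This
recombines the pieces of a normal arc and makes the Dehn invariant additive over the summands. -/
theorem Sorted.angle_sum {d z : Fin 3 → ℤ} {ys : List (Fin 3 → ℤ)} {x : Fin 3 → ℤ}
    (h : Sorted d x ys z) {f : ℝ → ℝ} (hf : ∀ a b, f (a + b) = f a + f b) :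
    f (InnerProductGeometry.angle (intPoint x) (intPoint z)) =
      ((arcs x ys z).map fun uv =>
        f (InnerProductGeometry.angle (intPoint uv.1) (intPoint uv.2))).sum := by
  induction ys generalizing x with
  | nil => simp [arcs]
  | cons y ys ih =>
    have hrel := h.relation
    have ha : (0 : ℝ) < det3 d y z := by exact_mod_cast h.1
    have hb : (0 : ℝ) < det3 d x y := by exact_mod_cast h.2.1
    have hc : (0 : ℝ) < det3 d x z := by exact_mod_cast h.2.2.1
    have hy : intPoint y = ((det3 d y z : ℝ) / det3 d x z) • intPoint x +
        ((det3 d x y : ℝ) / det3 d x z) • intPoint z := by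
      rw [← inv_smul_smul₀ hc.ne' (intPoint y), hrel, smul_add, smul_smul, smul_smul]
      congr 2 <;> ring
    have hy0 : intPoint y ≠ 0 := by
      intro h0
      have hy' : ∀ j, y j = 0 := fun j => by
        have : intPoint y j = 0 := by rw [h0]; rfl
        simpa using this
      have := h.2.1
      simp [det3, hy'] at this
    rw [arcs, List.map_cons, List.sum_cons, ← ih h.2.2.2.2, ← hf]
    rw [hy] at hy0 ⊢
    rw [angle_add_of_conic (by positivity) (by positivity) hy0]

/-! ### The normal fan as verified integer data -/

/-- The vertices of the `i`-th tetrahedron at which the integer functional `n` is largest. -/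
def argmaxVertex (n : Fin 3 → ℤ) (i : Fin 3) : Finset (Fin 4) :=
  Finset.univ.filter fun a => ∀ b, idot n (tetVertex i b) ≤ idot n (tetVertex i a)

/-- The vertices of the `i`-th tetrahedron at which both functionals are largest. -/
def commonArgmax (uv : (Fin 3 → ℤ) × (Fin 3 → ℤ)) (i : Fin 3) : Finset (Fin 4) :=
  argmaxVertex uv.1 i ∩ argmaxVertex uv.2 i

/-- The facet normals of `polytopeP` that lie on the normal arc of the edge `a b` of the `i`-th
tetrahedron; the vertex `c` spans with this edge the facet with normal `first`, and `c'` the one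
with normal `last`. -/
structure NormalChain where
  i : Fin 3
  a : Fin 4
  b : Fin 4
  c : Fin 4
  c' : Fin 4
  first : Fin 3 → ℤ
  mid : List (Fin 3 → ℤ)
  last : Fin 3 → ℤ

namespace NormalChain

variable (C : NormalChain)

/-- The direction of the edge. -/
def dir : Fin 3 → ℤ := tetVertex C.i C.b - tetVertex C.i C.a

/-- The arcs between neighbouring normals. -/
def arcList : List ((Fin 3 → ℤ) × (Fin 3 → ℤ)) := arcs C.first C.mid C.last

/-- `first` and `last` are the outer normals of the two facets at the edge. -/
def EndsOK : Prop :=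
  (∀ x, x = C.a ∨ x = C.b ∨ x = C.c ∨ x = C.c') ∧
  det3 C.dir (tetVertex C.i C.c - tetVertex C.i C.a) (tetVertex C.i C.c' - tetVertex C.i C.a) ≠ 0 ∧
  idot C.dir C.first = 0 ∧ idot C.dir C.last = 0 ∧
  idot (tetVertex C.i C.c - tetVertex C.i C.a) C.first = 0 ∧
  idot (tetVertex C.i C.c' - tetVertex C.i C.a) C.first < 0 ∧
  idot (tetVertex C.i C.c - tetVertex C.i C.a) C.last < 0 ∧
  idot (tetVertex C.i C.c' - tetVertex C.i C.a) C.last = 0 ∧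
  icross C.dir (tetVertex C.i C.c - tetVertex C.i C.a) ≠ 0 ∧
  icross C.dir (tetVertex C.i C.c' - tetVertex C.i C.a) ≠ 0

instance : Decidable C.EndsOK := inferInstanceAs (Decidable (_ ∧ _))

/-- The face in the direction of an interior normal is two-dimensional. -/
def MidOK (y : Fin 3 → ℤ) : Prop :=
  ∃ j, ∃ p ∈ argmaxVertex y j, ∃ q ∈ argmaxVertex y j,
    icross C.dir (tetVertex j q - tetVertex j p) ≠ 0

instance (y : Fin 3 → ℤ) : Decidable (C.MidOK y) := inferInstanceAs (Decidable (∃ _, _))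

/-- The face in the directions inside an arc is an edge parallel to the given one. -/
def ArcOK (uv : (Fin 3 → ℤ) × (Fin 3 → ℤ)) : Prop :=
  (∀ j, ∃ p q, commonArgmax uv j = {p, q} ∧ icross C.dir (tetVertex j q - tetVertex j p) = 0 ∧
    0 ≤ idot C.dir (tetVertex j q - tetVertex j p)) ∧
  commonArgmax uv C.i = {C.a, C.b} ∧
  det3 uv.1 uv.2 C.dir ≠ 0 ∧
  (∃ j, ∃ p ∈ argmaxVertex uv.1 j, p ∉ argmaxVertex uv.2 j) ∧
  ∃ j, ∃ p ∈ argmaxVertex uv.2 j, p ∉ argmaxVertex uv.1 j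

instance (uv : (Fin 3 → ℤ) × (Fin 3 → ℤ)) : Decidable (C.ArcOK uv) :=
  inferInstanceAs (Decidable (_ ∧ _))

end NormalChain

/-- The normal chains of the eighteen edges of the three tetrahedra. -/
def normalChains : List NormalChain :=
  [⟨0, 0, 1, 2, 3, ![1, -1, -1], [![2, -2, -3], ![-1, 1, -3], ![-2, 2, -3]], ![-1, 1, -1]⟩,
    ⟨0, 2, 0, 1, 3, ![1, -1, -1], [![-1, -6, 1], ![-1, -3, 1]], ![-1, -1, 1]⟩,
    ⟨0, 0, 3, 1, 2, ![-1, 1, -1], [![-3, 2, -2], ![-3, -2, 2]], ![-1, -1, 1]⟩,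
    ⟨0, 1, 2, 0, 3, ![1, -1, -1], [![5, -1, -1]], ![1, 1, 1]⟩,
    ⟨0, 3, 1, 0, 2, ![-1, 1, -1], [], ![1, 1, 1]⟩,
    ⟨0, 2, 3, 0, 1, ![-1, -1, 1], [![1, 1, 4]], ![1, 1, 1]⟩,
    ⟨1, 1, 0, 2, 3, ![-1, 2, 2], [![-3, 2, -2]], ![-2, 1, -2]⟩,
    ⟨1, 0, 2, 1, 3, ![-1, 2, 2], [![-3, -2, 2]], ![-2, -2, 1]⟩,
    ⟨1, 3, 0, 1, 2, ![-2, 1, -2], [], ![-2, -2, 1]⟩,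
    ⟨1, 2, 1, 0, 3, ![-1, 2, 2], [![1, 1, 1]], ![5, -1, -1]⟩,
    ⟨1, 1, 3, 0, 2, ![-2, 1, -2], [![-1, 1, -3], ![1, 0, -1]], ![5, -1, -1]⟩,
    ⟨1, 3, 2, 0, 1, ![-2, -2, 1], [![-1, -3, 1], ![-1, -7, 2]], ![5, -1, -1]⟩,
    ⟨2, 0, 1, 2, 3, ![-2, 1, -2], [![-3, 2, -2], ![-1, 2, 2]], ![1, 1, 4]⟩,
    ⟨2, 2, 0, 1, 3, ![-2, 1, -2], [], ![-1, -4, -1]⟩,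
    ⟨2, 0, 3, 1, 2, ![1, 1, 4], [![-1, -7, 2], ![-1, -6, 1]], ![-1, -4, -1]⟩,
    ⟨2, 1, 2, 0, 3, ![-2, 1, -2], [![-2, 2, -3]], ![2, 2, -1]⟩,
    ⟨2, 3, 1, 0, 2, ![1, 1, 4], [![1, 1, 1]], ![2, 2, -1]⟩,
    ⟨2, 2, 3, 0, 1, ![-1, -4, -1], [![2, -2, -3], ![1, 0, -1]], ![2, 2, -1]⟩]

/-- Together the following checks say that each normal arc of a tetrahedron is cut exactly as in the
normal fan of the sum: the listed normals run in order between the right end points, at each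
intermediate normal the face has an edge in a second direction, and strictly between neighbours all
maximal edges are parallel. Hence no edge of the sum is missed and no arc is split too little. -/
theorem normalChains_sorted : ∀ C ∈ normalChains, Sorted C.dir C.first C.mid C.last := by
  decide +kernel

theorem normalChains_endsOK : ∀ C ∈ normalChains, C.EndsOK := by
  decide +kernel

theorem normalChains_midOK : ∀ C ∈ normalChains, ∀ y ∈ C.mid, C.MidOK y := by
  decide +kernel

theorem normalChains_arcOK : ∀ C ∈ normalChains, ∀ uv ∈ C.arcList, C.ArcOK uv := by
  decide +kernel

theorem exists_normalChain : ∀ (i : Fin 3) (a b : Fin 4), a ≠ b → ∃ C ∈ normalChains,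
    C.i = i ∧ (C.a = a ∧ C.b = b ∨ C.a = b ∧ C.b = a) := by
  decide +kernel

/-! ### Faces and edges of the polytope -/

/-- The vertices of the three tetrahedra in Euclidean space. -/
noncomputable def tetPoint (i : Fin 3) (a : Fin 4) : EuclideanSpace ℝ (Fin 3) :=
  intPoint (tetVertex i a)

/-- The dilation factors as real numbers. -/
noncomputable def scaleReal (i : Fin 3) : ℝ := tetScale i

theorem scaleReal_pos (i : Fin 3) : 0 < scaleReal i := by
  fin_cases i <;> simp [scaleReal, tetScale]

theorem polytopeP_eq_mink : polytopeP = mink tetPoint scaleReal fun _ => Finset.univ :=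
  polytopeP_eq

theorem mem_argmaxVertex {n : Fin 3 → ℤ} {i : Fin 3} {a : Fin 4} :
    a ∈ argmaxVertex n i ↔
      ∀ b, inner ℝ (intPoint n) (tetPoint i b) ≤ inner ℝ (intPoint n) (tetPoint i a) := by
  simp only [argmaxVertex, Finset.mem_filter, Finset.mem_univ, true_and, tetPoint, inner_intPoint,
    Int.cast_le]

open Classical in
/-- The vertices of the `i`-th tetrahedron at which the functional `⟪L, ·⟫` is largest. -/
noncomputable def realArgmax (L : EuclideanSpace ℝ (Fin 3)) (i : Fin 3) : Finset (Fin 4) :=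
  Finset.univ.filter fun a => ∀ b, inner ℝ L (tetPoint i b) ≤ inner ℝ L (tetPoint i a)

theorem mem_realArgmax {L : EuclideanSpace ℝ (Fin 3)} {i : Fin 3} {a : Fin 4} :
    a ∈ realArgmax L i ↔ ∀ b, inner ℝ L (tetPoint i b) ≤ inner ℝ L (tetPoint i a) := by
  simp [realArgmax]

theorem realArgmax_nonempty (L : EuclideanSpace ℝ (Fin 3)) (i : Fin 3) :
    (realArgmax L i).Nonempty := by
  obtain ⟨a, -, ha⟩ := Finset.exists_max_image (Finset.univ : Finset (Fin 4))
    (fun a => inner ℝ L (tetPoint i a)) ⟨0, Finset.mem_univ _⟩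
  exact ⟨a, mem_realArgmax.2 fun b => ha b (Finset.mem_univ _)⟩

theorem realArgmax_smul {r : ℝ} (hr : 0 < r) (n : Fin 3 → ℤ) :
    realArgmax (r • intPoint n) = argmaxVertex n := by
  ext i a
  simp only [mem_realArgmax, mem_argmaxVertex, real_inner_smul_left]
  exact forall_congr' fun b => mul_le_mul_iff_right₀ hr

/-- If two functionals share a maximiser, maximising a positive combination forces both maxima.
Hence the selected vertices are constant over the open arc between two neighbouring normals. -/
theorem realArgmax_add {p q : ℝ} (hp : 0 < p) (hq : 0 < q)
    {uv : (Fin 3 → ℤ) × (Fin 3 → ℤ)} (h : ∀ i, (commonArgmax uv i).Nonempty) :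
    realArgmax (p • intPoint uv.1 + q • intPoint uv.2) = commonArgmax uv := by
  ext i a
  simp only [mem_realArgmax, commonArgmax, Finset.mem_inter, mem_argmaxVertex, inner_add_left,
    real_inner_smul_left]
  constructor
  · intro ha
    obtain ⟨c, hc⟩ := h i
    rw [commonArgmax, Finset.mem_inter, mem_argmaxVertex, mem_argmaxVertex] at hc
    have h1 := hc.1 a
    have h2 := hc.2 a
    have h3 := ha c
    have h4 : inner ℝ (intPoint uv.1) (tetPoint i c) ≤
        inner ℝ (intPoint uv.1) (tetPoint i a) := by
      by_contra hlt
      nlinarith [mul_lt_mul_of_pos_left (not_le.1 hlt) hp, mul_le_mul_of_nonneg_left h2 hq.le]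
    have h5 : inner ℝ (intPoint uv.2) (tetPoint i c) ≤
        inner ℝ (intPoint uv.2) (tetPoint i a) := by
      by_contra hlt
      nlinarith [mul_lt_mul_of_pos_left (not_le.1 hlt) hq, mul_le_mul_of_nonneg_left h1 hp.le]
    exact ⟨fun b => (hc.1 b).trans h4, fun b => (hc.2 b).trans h5⟩
  · rintro ⟨h1, h2⟩ b
    exact add_le_add (mul_le_mul_of_nonneg_left (h1 b) hp.le)
      (mul_le_mul_of_nonneg_left (h2 b) hq.le)

/-- A functional is maximal on a Minkowski sum exactly where it is maximal on every summand. Faces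
of the polytope are therefore encoded by finite vertex selections. -/
theorem toExposed_polytopeP (l : StrongDual ℝ (EuclideanSpace ℝ (Fin 3)))
    {L : EuclideanSpace ℝ (Fin 3)} (hL : ∀ x, l x = inner ℝ L x) :
    {x ∈ polytopeP | ∀ y ∈ polytopeP, l y ≤ l x} = mink tetPoint scaleReal (realArgmax L) := by
  choose g hg using realArgmax_nonempty L
  have hface := fun x => mem_mink_face_iff (t := tetPoint) (lam := scaleReal)
    (M := fun _ => Finset.univ) (M' := realArgmax L) l.toLinearMap
    (h := fun i => l (tetPoint i (g i))) (by simp)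
    (fun i a _ => by simpa [hL] using mem_realArgmax.1 (hg i) a)
    (fun i a _ => by
      simp only [ContinuousLinearMap.coe_coe, hL]
      constructor
      · intro ha
        exact le_antisymm (mem_realArgmax.1 (hg i) a) (mem_realArgmax.1 ha _)
      · intro ha
        rw [mem_realArgmax, ha]
        exact mem_realArgmax.1 (hg i)) (x := x)
  rw [polytopeP_eq_mink]
  ext x
  rw [hface]
  refine and_congr_right fun hx => ?_
  have hmem : ∑ i, scaleReal i • tetPoint i (g i) ∈
      mink tetPoint scaleReal (realArgmax L) :=
    vertex_mem_mink (fun i => (scaleReal_pos i).le) hg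
  rw [hface] at hmem
  constructor
  · intro h
    refine le_antisymm ?_ ?_
    · refine le_of_mem_mink l.toLinearMap (fun i a _ => ?_) hx
      simpa [hL] using mem_realArgmax.1 (hg i) a
    · rw [← hmem.2]
      exact h _ hmem.1
  · intro h y hy
    have h2 : l x = _ := h
    rw [h2]
    refine le_of_mem_mink l.toLinearMap (fun i a _ => ?_) hy
    simpa [hL] using mem_realArgmax.1 (hg i) a

theorem convex_polytopeP : Convex ℝ polytopeP := by
  rw [polytopeP_eq_mink]
  exact convex_mink

theorem exists_realArgmax_of_isExposed {e : Set (EuclideanSpace ℝ (Fin 3))}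
    (he : IsExposed ℝ polytopeP e) (hne : e.Nonempty) :
    ∃ L, e = mink tetPoint scaleReal (realArgmax L) := by
  obtain ⟨l, hl⟩ := he hne
  refine ⟨(InnerProductSpace.toDual ℝ _).symm l, ?_⟩
  rw [hl]
  exact toExposed_polytopeP l fun x => by simp

theorem isExposed_mink_realArgmax (L : EuclideanSpace ℝ (Fin 3)) :
    IsExposed ℝ polytopeP (mink tetPoint scaleReal (realArgmax L)) :=
  fun _ => ⟨InnerProductSpace.toDual ℝ _ L, (toExposed_polytopeP _ fun x => by simp).symm⟩

/-- Exchanging the vertex in a single summand moves the sum by a positive multiple of that edge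
vector. -/
theorem sub_mem_vectorSpan_mink {M : Fin 3 → Finset (Fin 4)} (hM : ∀ i, (M i).Nonempty)
    {i : Fin 3} {a b : Fin 4} (ha : a ∈ M i) (hb : b ∈ M i) :
    tetPoint i b - tetPoint i a ∈ vectorSpan ℝ (mink tetPoint scaleReal M) := by
  choose g hg using hM
  have hmem : ∀ c ∈ M i, ∑ j, scaleReal j • tetPoint j (Function.update g i c j) ∈
      mink tetPoint scaleReal M := by
    intro c hc
    refine vertex_mem_mink (fun i => (scaleReal_pos i).le) fun j => ?_
    by_cases hj : j = i
    · subst hj; simpa using hc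
    · simpa [Function.update_of_ne hj] using hg j
  have h := vsub_mem_vectorSpan ℝ (hmem b hb) (hmem a ha)
  rw [vsub_eq_sub, ← Finset.sum_sub_distrib, Finset.sum_eq_single i, ← smul_sub] at h
  · simpa using (Submodule.smul_mem_iff _ (scaleReal_pos i).ne').1 h
  · intro j _ hj
    simp [Function.update_of_ne hj]
  · simp

theorem icross_eq_zero_of_smul {u v : Fin 3 → ℤ} {c : ℝ} (h : c • intPoint u = intPoint v) :
    icross u v = 0 := by
  have h' : ∀ j, (v j : ℝ) = c * u j := fun j => by
    rw [← intPoint_apply v, ← h]; simp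
  ext j
  have : ((icross u v j : ℤ) : ℝ) = 0 := by
    fin_cases j <;> simp [icross] <;> rw [h', h'] <;> ring
  exact_mod_cast this

/-- If a Minkowski sum of faces has dimension one, all its edges are parallel. -/
theorem icross_eq_zero_of_finrank {M : Fin 3 → Finset (Fin 4)} (hM : ∀ i, (M i).Nonempty)
    (hfin : Module.finrank ℝ (vectorSpan ℝ (mink tetPoint scaleReal M)) = 1)
    {i j : Fin 3} {a b p q : Fin 4} (ha : a ∈ M i) (hb : b ∈ M i)
    (hab : tetVertex i b - tetVertex i a ≠ 0) (hp : p ∈ M j) (hq : q ∈ M j) :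
    icross (tetVertex i b - tetVertex i a) (tetVertex j q - tetVertex j p) = 0 := by
  have h1 := sub_mem_vectorSpan_mink hM ha hb
  have h2 := sub_mem_vectorSpan_mink hM hp hq
  rw [tetPoint, tetPoint, ← intPoint_sub] at h1 h2
  have hne : (⟨_, h1⟩ : vectorSpan ℝ (mink tetPoint scaleReal M)) ≠ 0 := by
    intro h0
    apply hab
    ext k
    have : intPoint (tetVertex i b - tetVertex i a) k = 0 := by
      rw [(Submodule.mk_eq_zero _ _).1 h0]; rfl
    exact Int.cast_eq_zero.1 this
  obtain ⟨c, hc⟩ := (finrank_eq_one_iff_of_nonzero' _ hne).1 hfin ⟨_, h2⟩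
  exact icross_eq_zero_of_smul (congrArg Subtype.val hc)

theorem tetVertex_sub_ne_zero : ∀ (i : Fin 3) (a b : Fin 4), a ≠ b →
    tetVertex i b - tetVertex i a ≠ 0 := by
  decide +kernel

/-- A functional that is largest exactly on the edge of a chain is a positive combination of the
end normals. -/
theorem NormalChain.EndsOK.exists_combination {C : NormalChain} (h : C.EndsOK)
    {L : EuclideanSpace ℝ (Fin 3)} (hb : inner ℝ L (tetPoint C.i C.b - tetPoint C.i C.a) = 0)
    (hc : inner ℝ L (tetPoint C.i C.c - tetPoint C.i C.a) < 0)
    (hc' : inner ℝ L (tetPoint C.i C.c' - tetPoint C.i C.a) < 0) :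
    ∃ p q : ℝ, 0 < p ∧ 0 < q ∧ L = p • intPoint C.first + q • intPoint C.last := by
  obtain ⟨-, hdet, h1, h2, h3, h4, h5, h6, -, -⟩ := h
  have h4' : (idot (tetVertex C.i C.c' - tetVertex C.i C.a) C.first : ℝ) < 0 := by
    exact_mod_cast h4
  have h5' : (idot (tetVertex C.i C.c - tetVertex C.i C.a) C.last : ℝ) < 0 := by
    exact_mod_cast h5
  -- `first` vanishes on the edges from `a` to `b` and `c`, `last` on those to `b` and `c'`. So
  -- pairing `L` with the edge to `c'` determines the coefficient of `first`, and pairing with the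
  -- edge to `c` that of `last`; agreement on the three independent edges gives equality.
  refine ⟨_, _, div_pos_of_neg_of_neg hc' h4', div_pos_of_neg_of_neg hc h5', ?_⟩
  rw [← sub_eq_zero]
  refine eq_zero_of_inner_eq_zero hdet ?_ ?_ ?_
  · rw [inner_sub_right, inner_add_right, real_inner_smul_right, real_inner_smul_right,
      inner_intPoint, inner_intPoint, h1, h2, NormalChain.dir, intPoint_sub, real_inner_comm]
    simpa [tetPoint] using hb
  · rw [inner_sub_right, inner_add_right, real_inner_smul_right, real_inner_smul_right,
      inner_intPoint, inner_intPoint, h3, div_mul_cancel₀ _ h5'.ne, intPoint_sub, real_inner_comm]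
    simp [tetPoint]
  · rw [inner_sub_right, inner_add_right, real_inner_smul_right, real_inner_smul_right,
      inner_intPoint, inner_intPoint, h6, div_mul_cancel₀ _ h4'.ne, intPoint_sub, real_inner_comm]
    simp [tetPoint]

theorem commonArgmax_nonempty {C : NormalChain} (hC : C ∈ normalChains)
    {uv : (Fin 3 → ℤ) × (Fin 3 → ℤ)} (huv : uv ∈ C.arcList) (i : Fin 3) :
    (commonArgmax uv i).Nonempty := by
  obtain ⟨p, q, h, -⟩ := (normalChains_arcOK C hC uv huv).1 i
  exact ⟨p, by simp [h]⟩

/-- Every edge of `polytopeP` belongs to one of the listed arcs. -/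
theorem exists_arc_of_edge {e : Set (EuclideanSpace ℝ (Fin 3))} (he : e ∈ polytopeEdges polytopeP) :
    ∃ C ∈ normalChains, ∃ uv ∈ C.arcList, e = mink tetPoint scaleReal (commonArgmax uv) := by
  obtain ⟨hexp, hfin⟩ := he
  have hne : e.Nonempty := by
    rw [Set.nonempty_iff_ne_empty]
    rintro rfl
    rw [vectorSpan_empty, finrank_bot] at hfin
    omega
  obtain ⟨L, rfl⟩ := exists_realArgmax_of_isExposed hexp hne
  have hM := realArgmax_nonempty L
  -- some face is not a single vertex
  obtain ⟨i, a, ha, b, hb, hab⟩ : ∃ i, ∃ a ∈ realArgmax L i, ∃ b ∈ realArgmax L i, a ≠ b := by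
    by_contra hcon
    push Not at hcon
    have hsub : (mink tetPoint scaleReal (realArgmax L)).Subsingleton := by
      choose g hg using hM
      have hall : ∀ x ∈ mink tetPoint scaleReal (realArgmax L),
          x = ∑ i, scaleReal i • tetPoint i (g i) := by
        rintro x ⟨c, ⟨-, h1, h2⟩, rfl⟩
        refine Finset.sum_congr rfl fun i _ => ?_
        have hzero : ∀ a, a ≠ g i → c i a = 0 := fun a hag =>
          h1 i a fun ha => hag (hcon i a ha (g i) (hg i))
        rw [← h2 i, Finset.sum_eq_single (g i) (fun a _ h => by rw [hzero a h, zero_smul])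
          (by simp), Finset.sum_eq_single (g i) (fun a _ h => hzero a h) (by simp)]
      intro x hx y hy
      rw [hall x hx, hall y hy]
    rw [vectorSpan_of_subsingleton ℝ hsub] at hfin
    simp at hfin
  obtain ⟨C, hC, hCi, hCab⟩ := exists_normalChain i a b hab
  subst hCi
  have hmem : C.a ∈ realArgmax L C.i ∧ C.b ∈ realArgmax L C.i := by
    rcases hCab with ⟨rfl, rfl⟩ | ⟨rfl, rfl⟩
    · exact ⟨ha, hb⟩
    · exact ⟨hb, ha⟩
  have hne' : C.a ≠ C.b := by
    rcases hCab with ⟨rfl, rfl⟩ | ⟨rfl, rfl⟩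
    · exact hab
    · exact hab.symm
  have hends := normalChains_endsOK C hC
  have hpar : ∀ {j : Fin 3} {p q : Fin 4}, p ∈ realArgmax L j → q ∈ realArgmax L j →
      icross C.dir (tetVertex j q - tetVertex j p) = 0 := fun hp hq =>
    icross_eq_zero_of_finrank hM hfin hmem.1 hmem.2 (tetVertex_sub_ne_zero _ _ _ hne') hp hq
  have hlt : ∀ x, x ∉ realArgmax L C.i →
      inner ℝ L (tetPoint C.i x - tetPoint C.i C.a) < 0 := by
    intro x hx
    rw [inner_sub_right, sub_neg]
    refine lt_of_le_of_ne (mem_realArgmax.1 hmem.1 x) fun heq => hx ?_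
    rw [mem_realArgmax, heq]
    exact mem_realArgmax.1 hmem.1
  have h0 : inner ℝ L (tetPoint C.i C.b - tetPoint C.i C.a) = 0 := by
    rw [inner_sub_right, sub_eq_zero]
    exact le_antisymm (mem_realArgmax.1 hmem.1 _) (mem_realArgmax.1 hmem.2 _)
  -- Neither `c` nor `c'` can be maximal: its edge from `a` is not parallel to `C.dir`, and the face
  -- would have dimension at least two.
  obtain ⟨p, q, hp, hq, hL⟩ := hends.exists_combination h0
    (hlt _ fun hx => hends.2.2.2.2.2.2.2.2.1 (hpar hmem.1 hx))
    (hlt _ fun hx => hends.2.2.2.2.2.2.2.2.2 (hpar hmem.1 hx))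
  rcases (normalChains_sorted C hC).cases hp hq hL with
    ⟨uv, huv, p', q', hp', hq', hL'⟩ | ⟨y, hy, r, hr, hL'⟩
  · refine ⟨C, hC, uv, huv, ?_⟩
    rw [hL', realArgmax_add hp' hq' (commonArgmax_nonempty hC huv)]
  -- On the ray of an intermediate normal the face contains an edge in another direction,
  -- contradicting dimension one.
  · obtain ⟨j, x, hx, x', hx', hcr⟩ := normalChains_midOK C hC y hy
    rw [← realArgmax_smul hr, ← hL'] at hx hx'
    exact absurd (hpar hx hx') hcr

/-! ### Lengths, dihedral angles and enumeration of the edges -/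

theorem eq_smul_of_icross_eq_zero {d w : Fin 3 → ℤ} (hd : idot d d ≠ 0) (h : icross d w = 0) :
    intPoint w = ((idot d w : ℝ) / idot d d) • intPoint d := by
  have h0 := congrFun h 0
  have h1 := congrFun h 1
  have h2 := congrFun h 2
  simp only [icross, Matrix.cons_val_zero, Matrix.cons_val_one, Matrix.cons_val_two,
    Matrix.head_cons, Matrix.tail_cons, Pi.zero_apply] at h0 h1 h2
  have hd' : (idot d d : ℝ) ≠ 0 := by exact_mod_cast hd
  have key : ∀ j, idot d d * w j = idot d w * d j := by
    intro j
    fin_cases j <;> simp only [idot, Fin.zero_eta, Fin.mk_one, Fin.reduceFinMk]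
    · linear_combination d 2 * h1 - d 1 * h2
    · linear_combination d 0 * h2 - d 2 * h0
    · linear_combination d 1 * h0 - d 0 * h1
  ext j
  simp only [PiLp.smul_apply, intPoint_apply, smul_eq_mul]
  rw [div_mul_eq_mul_div, eq_div_iff hd', mul_comm]
  exact_mod_cast key j

theorem norm_intPoint (z : Fin 3 → ℤ) : ‖intPoint z‖ = √(idot z z : ℝ) := by
  rw [← Real.sqrt_sq (norm_nonneg (intPoint z)), ← real_inner_self_eq_norm_sq, inner_intPoint]

theorem realArgmax_intPoint (n : Fin 3 → ℤ) : realArgmax (intPoint n) = argmaxVertex n := by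
  simpa using realArgmax_smul one_pos n

/-- The points of `polytopeP` at which `⟪L, ·⟫` is largest. -/
theorem exists_max_polytopeP (L : EuclideanSpace ℝ (Fin 3)) : ∃ h : ℝ,
    (∀ x ∈ polytopeP, inner ℝ L x ≤ h) ∧
    ∀ x, x ∈ mink tetPoint scaleReal (realArgmax L) ↔ x ∈ polytopeP ∧ inner ℝ L x = h := by
  obtain ⟨x₀, hx₀⟩ : (mink tetPoint scaleReal (realArgmax L)).Nonempty := by
    choose g hg using realArgmax_nonempty L
    exact ⟨_, vertex_mem_mink (fun i => (scaleReal_pos i).le) hg⟩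
  rw [← toExposed_polytopeP (InnerProductSpace.toDual ℝ _ L) (L := L) (fun x => by simp)] at hx₀ ⊢
  simp only [Set.mem_ofPred_eq, InnerProductSpace.toDual_apply_apply] at hx₀ ⊢
  refine ⟨inner ℝ L x₀, hx₀.2, fun x => ⟨fun h => ⟨h.1, ?_⟩, fun h => ⟨h.1, ?_⟩⟩⟩
  · exact le_antisymm (hx₀.2 _ h.1) (h.2 _ hx₀.1)
  · rw [h.2]
    exact hx₀.2

/-- A sum of `L`-maximal vertices is `L'`-maximal only if each summand is, since the summandwise
bounds add up to equality. So a face determines its vertex selection. -/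
theorem mink_realArgmax_subset {L L' : EuclideanSpace ℝ (Fin 3)}
    (h : mink tetPoint scaleReal (realArgmax L) ⊆ mink tetPoint scaleReal (realArgmax L'))
    (i : Fin 3) : realArgmax L i ⊆ realArgmax L' i := by
  intro a ha
  choose g hg using realArgmax_nonempty L
  choose g' hg' using realArgmax_nonempty L'
  have hg2 : ∀ j, Function.update g i a j ∈ realArgmax L j := by
    intro j
    by_cases hj : j = i
    · subst hj; simpa using ha
    · simpa [Function.update_of_ne hj] using hg j
  obtain ⟨m, hm1, hm2⟩ := exists_max_polytopeP L'
  have h1 := ((hm2 _).1 (h (vertex_mem_mink (fun i => (scaleReal_pos i).le) hg2))).2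
  have h2 := ((hm2 _).1 (vertex_mem_mink (fun i => (scaleReal_pos i).le) hg')).2
  rw [← h2, inner_sum, inner_sum] at h1
  have hle : ∀ j ∈ Finset.univ, inner ℝ L' (scaleReal j • tetPoint j (Function.update g i a j)) ≤
      inner ℝ L' (scaleReal j • tetPoint j (g' j)) := by
    intro j _
    rw [real_inner_smul_right, real_inner_smul_right]
    exact mul_le_mul_of_nonneg_left (mem_realArgmax.1 (hg' j) _) (scaleReal_pos j).le
  have h3 := (Finset.sum_eq_sum_iff_of_le hle).1 h1 i (Finset.mem_univ _)
  rw [real_inner_smul_right, real_inner_smul_right, Function.update_self] at h3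
  rw [mem_realArgmax, mul_left_cancel₀ (scaleReal_pos i).ne' h3]
  exact mem_realArgmax.1 (hg' i)

theorem dir_idot_pos : ∀ C ∈ normalChains, 0 < idot C.dir C.dir := by
  decide +kernel

section NormalArc

variable {C : NormalChain} {uv : (Fin 3 → ℤ) × (Fin 3 → ℤ)}

theorem commonArgmax_eq_realArgmax (hC : C ∈ normalChains) (huv : uv ∈ C.arcList) :
    commonArgmax uv = realArgmax (intPoint uv.1 + intPoint uv.2) := by
  simpa using (realArgmax_add one_pos one_pos (commonArgmax_nonempty hC huv)).symm

/-- The face belonging to an arc is a segment in the direction of the chain. -/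
theorem arc_segment (hC : C ∈ normalChains) (huv : uv ∈ C.arcList)
    {p q : Fin 3 → Fin 4}
    (hpq : ∀ j, commonArgmax uv j = {p j, q j} ∧
      icross C.dir (tetVertex j (q j) - tetVertex j (p j)) = 0 ∧
      0 ≤ idot C.dir (tetVertex j (q j) - tetVertex j (p j))) :
    ∃ R : ℝ, 0 < R ∧ R * ‖intPoint C.dir‖ =
        ∑ j, scaleReal j * ‖intPoint (tetVertex j (q j) - tetVertex j (p j))‖ ∧
      ∃ pa ∈ mink tetPoint scaleReal (commonArgmax uv),
        pa + R • intPoint C.dir ∈ mink tetPoint scaleReal (commonArgmax uv) ∧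
        ∀ x ∈ mink tetPoint scaleReal (commonArgmax uv), ∃ s, 0 ≤ s ∧ s ≤ R ∧
          x = pa + s • intPoint C.dir := by
  have hdd := dir_idot_pos C hC
  have hddR : (0 : ℝ) < idot C.dir C.dir := by exact_mod_cast hdd
  set ρ : Fin 3 → ℝ := fun j =>
    (idot C.dir (tetVertex j (q j) - tetVertex j (p j)) : ℝ) / idot C.dir C.dir with hρ
  have hρ0 : ∀ j, 0 ≤ ρ j := fun j =>
    div_nonneg (by exact_mod_cast (hpq j).2.2) hddR.le
  have hsub : ∀ j, intPoint (tetVertex j (q j) - tetVertex j (p j)) = ρ j • intPoint C.dir :=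
    fun j => eq_smul_of_icross_eq_zero hdd.ne' (hpq j).2.1
  have hq : ∀ j, tetPoint j (q j) = tetPoint j (p j) + ρ j • intPoint C.dir := by
    intro j
    rw [← hsub, intPoint_sub, tetPoint, tetPoint]
    abel
  have hmemp : ∀ j, p j ∈ commonArgmax uv j := fun j => by simp [(hpq j).1]
  have hmemq : ∀ j, q j ∈ commonArgmax uv j := fun j => by simp [(hpq j).1]
  refine ⟨∑ j, scaleReal j * ρ j, ?_, ?_, ∑ j, scaleReal j • tetPoint j (p j),
    vertex_mem_mink (fun i => (scaleReal_pos i).le) hmemp, ?_, ?_⟩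
  · refine Finset.sum_pos' (fun j _ => mul_nonneg (scaleReal_pos j).le (hρ0 j))
      -- The other summands may contribute single points; only the tetrahedron of the chain is
      -- certain to contribute a genuine edge.
      ⟨C.i, Finset.mem_univ _, mul_pos (scaleReal_pos _) ?_⟩
    refine lt_of_le_of_ne (hρ0 _) fun h0 => ?_
    have h1 := hsub C.i
    rw [← h0, zero_smul] at h1
    have h2 : p C.i = q C.i := by
      by_contra hne
      refine tetVertex_sub_ne_zero C.i _ _ hne ?_
      ext k
      have : intPoint (tetVertex C.i (q C.i) - tetVertex C.i (p C.i)) k = 0 := by rw [h1]; rfl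
      exact Int.cast_eq_zero.1 this
    have h3 := (normalChains_arcOK C hC uv huv).2.1
    rw [(hpq C.i).1, h2] at h3
    have h4 : C.a = C.b := by
      have ha : C.a ∈ ({q C.i, q C.i} : Finset (Fin 4)) := by rw [h3]; simp
      have hb : C.b ∈ ({q C.i, q C.i} : Finset (Fin 4)) := by rw [h3]; simp
      simp at ha hb
      rw [ha, hb]
    rw [NormalChain.dir, h4, sub_self] at hdd
    simp [idot] at hdd
  · rw [Finset.sum_mul]
    refine Finset.sum_congr rfl fun j _ => ?_
    rw [hsub, norm_smul, Real.norm_of_nonneg (hρ0 j), mul_assoc]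
  · have h := vertex_mem_mink (t := tetPoint) (lam := scaleReal) (M := commonArgmax uv)
      (fun i => (scaleReal_pos i).le) hmemq
    simp only [hq, smul_add, Finset.sum_add_distrib, smul_smul, ← Finset.sum_smul] at h
    exact h
  · rintro x ⟨c, hc, rfl⟩
    set σ : Fin 3 → Fin 4 → ℝ := fun j a => if a = p j then 0 else ρ j with hσ
    have hpt : ∀ j, ∀ a ∈ commonArgmax uv j,
        tetPoint j a = tetPoint j (p j) + σ j a • intPoint C.dir := by
      intro j a ha
      rw [(hpq j).1, Finset.mem_insert, Finset.mem_singleton] at ha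
      by_cases h : a = p j
      · simp [hσ, h]
      · rw [hσ]
        simp only [if_neg h]
        rw [← hq, ha.resolve_left h]
    refine ⟨∑ j, ∑ a, c j a * σ j a, ?_, ?_, ?_⟩
    · refine Finset.sum_nonneg fun j _ => Finset.sum_nonneg fun a _ => mul_nonneg (hc.1 j a) ?_
      simp only [hσ]
      split_ifs
      · exact le_rfl
      · exact hρ0 j
    · refine sum_weight_le hc fun j a _ => ?_
      simp only [hσ]
      split_ifs
      · exact hρ0 j
      · exact le_rfl
    · rw [weightedPoint, Finset.sum_smul, ← Finset.sum_add_distrib]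
      refine Finset.sum_congr rfl fun j _ => ?_
      rw [← hc.2.2 j, Finset.sum_smul, Finset.sum_smul, ← Finset.sum_add_distrib]
      refine Finset.sum_congr rfl fun a _ => ?_
      by_cases ha : a ∈ commonArgmax uv j
      · conv_lhs => rw [hpt j a ha]
        rw [smul_add, smul_smul]
      · simp [hc.2.1 j a ha]

theorem intPoint_ne_zero {z : Fin 3 → ℤ} (h : 0 < idot z z) : intPoint z ≠ 0 := by
  intro h0
  have := inner_intPoint z z
  rw [h0, inner_zero_left] at this
  have h' : (0 : ℝ) < idot z z := by exact_mod_cast h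
  linarith

theorem vectorSpan_arc (hC : C ∈ normalChains) (huv : uv ∈ C.arcList) :
    vectorSpan ℝ (mink tetPoint scaleReal (commonArgmax uv)) =
      Submodule.span ℝ {intPoint C.dir} := by
  choose p q hpq using (normalChains_arcOK C hC uv huv).1
  obtain ⟨R, hR, -, pa, hpa, hpb, hx⟩ := arc_segment hC huv hpq
  apply le_antisymm
  · rw [vectorSpan_def, Submodule.span_le]
    rintro _ ⟨x, hxm, y, hym, rfl⟩
    obtain ⟨s, -, -, rfl⟩ := hx x hxm
    obtain ⟨s', -, -, rfl⟩ := hx y hym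
    refine Submodule.mem_span_singleton.2 ⟨s - s', ?_⟩
    simp only [vsub_eq_sub]
    module
  · rw [Submodule.span_singleton_le_iff_mem]
    have h := vsub_mem_vectorSpan ℝ hpb hpa
    rw [vsub_eq_sub, add_sub_cancel_left] at h
    exact (Submodule.smul_mem_iff _ hR.ne').1 h

theorem mem_polytopeEdges_arc (hC : C ∈ normalChains) (huv : uv ∈ C.arcList) :
    mink tetPoint scaleReal (commonArgmax uv) ∈ polytopeEdges polytopeP := by
  refine ⟨?_, ?_⟩
  · rw [commonArgmax_eq_realArgmax hC huv]
    exact isExposed_mink_realArgmax _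
  · rw [vectorSpan_arc hC huv]
    exact finrank_span_singleton (intPoint_ne_zero (dir_idot_pos C hC))

theorem diam_arc (hC : C ∈ normalChains) (huv : uv ∈ C.arcList)
    {p q : Fin 3 → Fin 4}
    (hpq : ∀ j, commonArgmax uv j = {p j, q j} ∧
      icross C.dir (tetVertex j (q j) - tetVertex j (p j)) = 0 ∧
      0 ≤ idot C.dir (tetVertex j (q j) - tetVertex j (p j))) :
    Metric.diam (mink tetPoint scaleReal (commonArgmax uv)) =
      ∑ j, scaleReal j * ‖intPoint (tetVertex j (q j) - tetVertex j (p j))‖ := by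
  obtain ⟨R, hR, hRd, pa, hpa, hpb, hx⟩ := arc_segment hC huv hpq
  rw [← hRd]
  have hdist : ∀ x ∈ mink tetPoint scaleReal (commonArgmax uv),
      ∀ y ∈ mink tetPoint scaleReal (commonArgmax uv), dist x y ≤ R * ‖intPoint C.dir‖ := by
    intro x hxm y hym
    obtain ⟨s, hs0, hs1, rfl⟩ := hx x hxm
    obtain ⟨s', hs0', hs1', rfl⟩ := hx y hym
    rw [dist_add_left, dist_eq_norm, ← sub_smul, norm_smul]
    refine mul_le_mul_of_nonneg_right ?_ (norm_nonneg _)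
    rw [Real.norm_eq_abs, abs_le]
    constructor <;> linarith
  apply le_antisymm
  · exact Metric.diam_le_of_forall_dist_le (by positivity) hdist
  · have h := Metric.dist_le_diam_of_mem (Metric.isBounded_iff.2 ⟨_, fun x hx y hy =>
      hdist x hx y hy⟩) hpb hpa
    rwa [dist_eq_norm, add_sub_cancel_left, norm_smul, Real.norm_of_nonneg hR.le] at h

/-- The two neighbours are outer normals of supporting planes meeting `polytopeP` along more than
the edge: the last two clauses of `ArcOK` yield a point on each of the two faces that is off the
other, as `dihedralAngle_eq` requires. -/
theorem dihedralAngle_arc (hC : C ∈ normalChains) (huv : uv ∈ C.arcList) :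
    dihedralAngle polytopeP (mink tetPoint scaleReal (commonArgmax uv)) =
      Real.pi - InnerProductGeometry.angle (intPoint uv.1) (intPoint uv.2) := by
  have hok := normalChains_arcOK C hC uv huv
  choose p q hpq using hok.1
  obtain ⟨R, hR, -, pa, hpa, hpb, -⟩ := arc_segment hC huv hpq
  obtain ⟨hu, hu1, hu2⟩ := exists_max_polytopeP (intPoint uv.1)
  obtain ⟨hv, hv1, hv2⟩ := exists_max_polytopeP (intPoint uv.2)
  rw [realArgmax_intPoint] at hu2 hv2
  have hsub : ∀ x ∈ mink tetPoint scaleReal (commonArgmax uv),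
      x ∈ mink tetPoint scaleReal (argmaxVertex uv.1) ∧
      x ∈ mink tetPoint scaleReal (argmaxVertex uv.2) := fun x hx =>
    ⟨mink_mono (fun i => Finset.inter_subset_left) hx,
      mink_mono (fun i => Finset.inter_subset_right) hx⟩
  -- a point of the first facet that is not on the second one
  have hpoint : ∀ m n : Fin 3 → ℤ, (∃ j, ∃ p ∈ argmaxVertex m j, p ∉ argmaxVertex n j) →
      ∃ x ∈ mink tetPoint scaleReal (argmaxVertex m),
        x ∉ mink tetPoint scaleReal (argmaxVertex n) := by
    rintro m n ⟨j, a, ha, ha'⟩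
    by_contra hcon
    push Not at hcon
    rw [← realArgmax_intPoint, ← realArgmax_intPoint] at hcon
    rw [← realArgmax_intPoint] at ha ha'
    exact ha' (mink_realArgmax_subset hcon j ha)
  obtain ⟨pF, hF1, hF2⟩ := hpoint _ _ hok.2.2.2.1
  obtain ⟨pG, hG1, hG2⟩ := hpoint _ _ hok.2.2.2.2
  rw [hu2] at hF1 hG2
  rw [hv2] at hF2 hG1
  have hspan : vectorSpan ℝ (mink tetPoint scaleReal (commonArgmax uv)) =
      Submodule.span ℝ {R • intPoint C.dir} := by
    rw [vectorSpan_arc hC huv, Submodule.span_singleton_smul_eq (IsUnit.mk0 _ hR.ne')]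
  refine dihedralAngle_eq (pa := pa) (pb := pa + R • intPoint C.dir) (pF := pF) (pG := pG)
    convex_polytopeP (fun x hx => ((hu2 x).1 (hsub x hx).1).1) convex_mink hu1 hv1
    (fun x hx => ((hu2 x).1 (hsub x hx).1).2) (fun x hx => ((hv2 x).1 (hsub x hx).2).2) hpa hpb
    (add_sub_cancel_left _ _)
    (smul_ne_zero hR.ne' (intPoint_ne_zero (dir_idot_pos C hC))) hspan ?_ hF1.1 hF1.2
    (lt_of_le_of_ne (hv1 _ hF1.1) fun h => hF2 ⟨hF1.1, h⟩) hG1.1 hG1.2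
    (lt_of_le_of_ne (hu1 _ hG1.1) fun h => hG2 ⟨hG1.1, h⟩)
  intro w h1 h2 h3
  rw [real_inner_smul_left] at h3
  exact eq_zero_of_inner_eq_zero hok.2.2.1 h1 h2 ((mul_eq_zero.1 h3).resolve_left hR.ne')

/-- The vertex selections of the edges of `polytopeP`. -/
def edgeSelections : Finset (Fin 3 → Finset (Fin 4)) :=
  ((normalChains.flatMap NormalChain.arcList).map commonArgmax).toFinset

theorem mem_edgeSelections {M : Fin 3 → Finset (Fin 4)} :
    M ∈ edgeSelections ↔ ∃ C ∈ normalChains, ∃ uv ∈ C.arcList, commonArgmax uv = M := by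
  simp only [edgeSelections, List.mem_toFinset, List.mem_map, List.mem_flatMap]
  constructor
  · rintro ⟨uv, ⟨C, hC, huv⟩, rfl⟩
    exact ⟨C, hC, uv, huv, rfl⟩
  · rintro ⟨C, hC, uv, huv, rfl⟩
    exact ⟨uv, ⟨C, hC, huv⟩, rfl⟩

theorem polytopeEdges_polytopeP :
    polytopeEdges polytopeP = mink tetPoint scaleReal '' (edgeSelections : Set _) := by
  ext e
  simp only [Set.mem_image, Finset.mem_coe, mem_edgeSelections]
  constructor
  · intro he
    obtain ⟨C, hC, uv, huv, rfl⟩ := exists_arc_of_edge he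
    exact ⟨_, ⟨C, hC, uv, huv, rfl⟩, rfl⟩
  · rintro ⟨_, ⟨C, hC, uv, huv, rfl⟩, rfl⟩
    exact mem_polytopeEdges_arc hC huv

theorem injOn_mink_edgeSelections :
    Set.InjOn (mink tetPoint scaleReal) (edgeSelections : Set (Fin 3 → Finset (Fin 4))) := by
  intro M hM M' hM' h
  obtain ⟨C, hC, uv, huv, rfl⟩ := mem_edgeSelections.1 hM
  obtain ⟨C', hC', uv', huv', rfl⟩ := mem_edgeSelections.1 hM'
  rw [commonArgmax_eq_realArgmax hC huv, commonArgmax_eq_realArgmax hC' huv'] at h ⊢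
  funext i
  exact (mink_realArgmax_subset h.le i).antisymm (mink_realArgmax_subset h.ge i)

/-- The double counting behind additivity: the edges of the sum having a given tetrahedron edge as
summand correspond bijectively to the arcs of its chain. Selections are collected as a finset
because parallel edges of different tetrahedra, such as those along (2, 2, -1), list the same arc
twice. -/
theorem edgeSelections_filter : ∀ C ∈ normalChains,
    edgeSelections.filter (fun M => M C.i = {C.a, C.b}) =
      (C.arcList.map commonArgmax).toFinset ∧ (C.arcList.map commonArgmax).Nodup := by
  decide +kernel

/-- A nondegenerate summand is counted by exactly one chain and a summand that is a single vertex by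
none, so summing over the chains gives the length of an edge of the sum. -/
theorem chain_lengths : ∀ (j : Fin 3) (p q : Fin 4),
    ((normalChains.filter fun C => C.i = j).filter fun C => ({p, q} : Finset (Fin 4)) = {C.a, C.b}).map
      (fun C => idot C.dir C.dir) =
    if p = q then [] else
      [idot (tetVertex j q - tetVertex j p) (tetVertex j q - tetVertex j p)] := by
  decide +kernel

end NormalArc

/-! ### Regrouping sums over edges and chains -/

theorem list_sum_map_ite {A : Type*} (l : List A) (P : A → Prop) [DecidablePred P] (g : A → ℝ) :
    (l.map fun x => if P x then g x else 0).sum = ((l.filter fun x => P x).map g).sum := by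
  induction l with
  | nil => simp
  | cons x l ih =>
    by_cases h : P x <;> simp [h, ih]

theorem list_sum_map_fiber {A ι : Type*} [Fintype ι] [DecidableEq ι] (l : List A) (k : A → ι)
    (g : A → ℝ) : (l.map g).sum = ∑ j, ((l.filter fun x => k x = j).map g).sum := by
  induction l with
  | nil => simp
  | cons x l ih =>
    simp only [List.map_cons, List.sum_cons, ih, List.filter_cons]
    have : ∀ j, ((if decide (k x = j) = true then x :: l.filter (fun y => decide (k y = j))
        else l.filter (fun y => decide (k y = j))).map g).sum =
        (if k x = j then g x else 0) + ((l.filter fun y => decide (k y = j)).map g).sum := by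
      intro j
      by_cases h : k x = j <;> simp [h]
    simp only [this, Finset.sum_add_distrib]
    simp

theorem finset_sum_list_sum {A B : Type*} (s : Finset B) (l : List A) (g : B → A → ℝ) :
    ∑ b ∈ s, (l.map (g b)).sum = (l.map fun x => ∑ b ∈ s, g b x).sum := by
  induction l with
  | nil => simp
  | cons x l ih => simp [Finset.sum_add_distrib, ih]

theorem list_sum_map_neg {A : Type*} (l : List A) (g : A → ℝ) :
    (l.map fun x => -g x).sum = -(l.map g).sum := by
  induction l with
  | nil => simp
  | cons x l ih => simp [ih, add_comm]

/-- The length of an edge of `polytopeP` is the sum of the lengths of its summands. -/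
theorem diam_edgeSelection {M : Fin 3 → Finset (Fin 4)} (hM : M ∈ edgeSelections) :
    Metric.diam (mink tetPoint scaleReal M) = (normalChains.map fun C =>
      if M C.i = {C.a, C.b} then scaleReal C.i * √(idot C.dir C.dir : ℝ) else 0).sum := by
  obtain ⟨C, hC, uv, huv, rfl⟩ := mem_edgeSelections.1 hM
  choose p q hpq using (normalChains_arcOK C hC uv huv).1
  rw [diam_arc hC huv hpq, list_sum_map_fiber _ NormalChain.i]
  refine Finset.sum_congr rfl fun j _ => ?_
  rw [norm_intPoint]
  have h1 : ((normalChains.filter fun C => C.i = j).map fun C =>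
      if commonArgmax uv C.i = {C.a, C.b} then scaleReal C.i * √(idot C.dir C.dir : ℝ) else 0) =
      (normalChains.filter fun C => C.i = j).map fun C =>
      if ({p j, q j} : Finset (Fin 4)) = {C.a, C.b} then
        scaleReal j * √(idot C.dir C.dir : ℝ) else 0 := by
    refine List.map_congr_left fun C hC => ?_
    have hCj : C.i = j := by simpa using (List.mem_filter.1 hC).2
    rw [hCj, (hpq j).1]
  rw [h1, list_sum_map_ite]
  have h2 := congrArg (List.map fun n : ℤ => scaleReal j * √(n : ℝ)) (chain_lengths j (p j) (q j))
  rw [List.map_map] at h2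
  have h3 : (List.map (fun C : NormalChain => scaleReal j * √(idot C.dir C.dir : ℝ))
    ((normalChains.filter fun C => C.i = j).filter
      fun C => ({p j, q j} : Finset (Fin 4)) = {C.a, C.b})) = _ := h2
  rw [h3]
  split_ifs with h
  · rw [h]; simp [idot]
  · simp

/-- The end normals of the chains, up to the data that enters the Dehn invariant. -/
theorem normalChains_data : normalChains.map (fun C => (tetScale C.i, idot C.dir C.dir,
    idot C.first C.last, idot C.first C.first, idot C.last C.last)) =
    [(5, 2, -1, 3, 3), (5, 2, -1, 3, 3), (5, 2, -1, 3, 3), (5, 2, -1, 3, 3), (5, 2, -1, 3, 3),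
      (5, 2, -1, 3, 3), (12, 9, 0, 9, 9), (12, 9, 0, 9, 9), (12, 9, 0, 9, 9),
      (12, 18, -9, 9, 27), (12, 18, -9, 9, 27), (12, 18, -9, 9, 27),
      (19, 9, -9, 9, 18), (19, 18, 0, 9, 18), (19, 27, -9, 18, 18), (19, 9, 0, 9, 9),
      (19, 18, 0, 18, 9), (19, 9, -9, 18, 9)] := by
  decide +kernel

theorem angle_intPoint (u v : Fin 3 → ℤ) : InnerProductGeometry.angle (intPoint u) (intPoint v) =
    Real.arccos ((idot u v : ℝ) / (√(idot u u : ℝ) * √(idot v v : ℝ))) := by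
  rw [InnerProductGeometry.angle, inner_intPoint, norm_intPoint, norm_intPoint]

/-! ### Kagan functions at the dihedral angles, and the Dehn invariant -/

section Kagan

variable {f : ℝ → ℝ}

theorem IsKagan.zero (hf : IsKagan f) : f 0 = 0 := by
  have := hf.1 0 0
  simp at this
  exact this

theorem IsKagan.sub (hf : IsKagan f) (a b : ℝ) : f (a - b) = f a - f b := by
  have := hf.1 (a - b) b
  rw [sub_add_cancel] at this
  linarith

theorem IsKagan.natCast_mul (hf : IsKagan f) (n : ℕ) (a : ℝ) : f (n * a) = n * f a := by
  induction n with
  | zero => simp [hf.zero]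
  | succ n ih => rw [Nat.cast_succ, add_one_mul, hf.1, ih, add_one_mul]

theorem IsKagan.pi_mul_div (hf : IsKagan f) (m n : ℕ) (hn : n ≠ 0) :
    f (m * Real.pi / n) = 0 := by
  have h1 := hf.natCast_mul n (m * Real.pi / n)
  rw [mul_div_cancel₀ _ (by exact_mod_cast hn), hf.natCast_mul, hf.2, mul_zero] at h1
  exact (mul_eq_zero.1 h1.symm).resolve_left (by exact_mod_cast hn)

/-- The doubled angle has cosine 2/3 − 1 = −1/3 and lies between π and 2π, so subtracting π returns
it to the range of `arccos`. This is the one relation between the irrational angles of T₁ and T₂. -/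
theorem arccos_neg_inv_sqrt_three :
    2 * Real.arccos (-1 / √3) = Real.pi + Real.arccos (1 / 3) := by
  have h3 : (1 : ℝ) ≤ √3 := by
    rw [Real.one_le_sqrt]; norm_num
  have hpos : (0 : ℝ) < √3 := by linarith
  have hcos : Real.cos (2 * Real.arccos (-1 / √3)) = -(1 / 3) := by
    rw [Real.cos_two_mul, Real.cos_arccos, div_pow, Real.sq_sqrt (by norm_num)]
    · norm_num
    · rw [le_div_iff₀ hpos]; linarith
    · rw [div_le_iff₀ hpos]; linarith
  have hge : Real.pi / 2 ≤ Real.arccos (-1 / √3) := by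
    rw [← not_lt, Real.arccos_lt_pi_div_two, not_lt]
    exact div_nonpos_of_nonpos_of_nonneg (by norm_num) hpos.le
  have hle := Real.arccos_le_pi (-1 / √3)
  have h : Real.arccos (1 / 3) = 2 * Real.arccos (-1 / √3) - Real.pi := by
    rw [← neg_neg (1 / 3 : ℝ), ← hcos, ← Real.cos_sub_pi]
    exact Real.arccos_cos (by linarith) (by linarith)
  linarith

theorem sqrt_eighteen : √(18 : ℝ) = 3 * √2 := by
  rw [show (18 : ℝ) = 3 ^ 2 * 2 by norm_num, Real.sqrt_mul (by norm_num),
    Real.sqrt_sq (by norm_num)]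

theorem sqrt_twentySeven : √(27 : ℝ) = 3 * √3 := by
  rw [show (27 : ℝ) = 3 ^ 2 * 3 by norm_num, Real.sqrt_mul (by norm_num),
    Real.sqrt_sq (by norm_num)]

theorem sqrt_nine : √(9 : ℝ) = 3 := by
  rw [show (9 : ℝ) = 3 ^ 2 by norm_num, Real.sqrt_sq (by norm_num)]

theorem arccos_neg_half : Real.arccos (-1 / 2) = (2 : ℕ) * Real.pi / (3 : ℕ) := by
  rw [neg_div, Real.arccos_neg, ← Real.cos_pi_div_three, Real.arccos_cos (by positivity)
    (by linarith [Real.pi_pos])]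
  push_cast
  ring

theorem arccos_neg_inv_sqrt_two : Real.arccos (-1 / √2) = (3 : ℕ) * Real.pi / (4 : ℕ) := by
  have : (1 : ℝ) / √2 = √2 / 2 := by
    rw [div_eq_div_iff (by positivity) (by positivity), Real.mul_self_sqrt (by norm_num), one_mul]
  rw [neg_div, Real.arccos_neg, this, ← Real.cos_pi_div_four, Real.arccos_cos (by positivity)
    (by linarith [Real.pi_pos])]
  push_cast
  ring

end Kagan

/-- T₁ contributes 5·6·√2 times the value at arccos(1/3), T₂ contributes −12·3·(3√2)/2 times it, and
T₃ nothing: 30 − 54 = −24. -/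
theorem dehnInvariant_polytopeP {f : ℝ → ℝ} (hf : IsKagan f) :
    dehnInvariant f polytopeP = -24 * √2 * f (Real.arccos (1 / 3)) := by
  have hsum : dehnInvariant f polytopeP = -(normalChains.map fun C =>
      scaleReal C.i * √(idot C.dir C.dir : ℝ) *
        f (InnerProductGeometry.angle (intPoint C.first) (intPoint C.last))).sum := by
    rw [dehnInvariant, polytopeEdges_polytopeP, finsum_mem_image injOn_mink_edgeSelections,
      finsum_mem_coe_finset]
    have h1 : ∀ M ∈ edgeSelections, Metric.diam (mink tetPoint scaleReal M) *
        f (dihedralAngle polytopeP (mink tetPoint scaleReal M)) =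
        (normalChains.map fun C => if M C.i = {C.a, C.b} then
          scaleReal C.i * √(idot C.dir C.dir : ℝ) *
            f (dihedralAngle polytopeP (mink tetPoint scaleReal M)) else 0).sum := by
      intro M hM
      rw [diam_edgeSelection hM, ← List.sum_map_mul_right]
      simp only [ite_mul, zero_mul]
    rw [Finset.sum_congr rfl h1, finset_sum_list_sum, ← list_sum_map_neg]
    congr 1
    refine List.map_congr_left fun C hC => ?_
    obtain ⟨h2, h3⟩ := edgeSelections_filter C hC
    -- With the sums exchanged, the inner sum runs over the arcs of one chain. Each dihedral angle
    -- is π minus an arc and `f` kills π, so the arcs add up to minus `f` of the full normal angle.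
    rw [← Finset.sum_filter, h2, ← Finset.mul_sum, List.sum_toFinset _ h3, List.map_map,
      ← mul_neg, Sorted.angle_sum (normalChains_sorted C hC) hf.1, ← list_sum_map_neg]
    congr 2
    refine List.map_congr_left fun uv huv => ?_
    rw [Function.comp_apply, dihedralAngle_arc hC huv, hf.sub, hf.2, zero_sub]
  have hdata := congrArg (List.map fun x : ℤ × ℤ × ℤ × ℤ × ℤ => (x.1 : ℝ) * √(x.2.1 : ℝ) *
    f (Real.arccos ((x.2.2.1 : ℝ) / (√(x.2.2.2.1 : ℝ) * √(x.2.2.2.2 : ℝ))))) normalChains_data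
  rw [List.map_map] at hdata
  have hmap : (normalChains.map fun C => scaleReal C.i * √(idot C.dir C.dir : ℝ) *
      f (InnerProductGeometry.angle (intPoint C.first) (intPoint C.last))) = _ :=
    (List.map_congr_left fun C _ => by rw [angle_intPoint]; rfl).trans hdata
  rw [hsum, hmap]
  have hneg : f (Real.arccos (-(1 / 3))) = -f (Real.arccos (1 / 3)) := by
    rw [Real.arccos_neg, hf.sub, hf.2, zero_sub]
  have h0 : f (Real.arccos 0) = 0 := by
    have := hf.pi_mul_div 1 2 (by norm_num)
    rw [Real.arccos_zero]
    simpa using this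
  have hhalf : f (Real.arccos (-1 / 2)) = 0 := by
    rw [arccos_neg_half]; exact hf.pi_mul_div 2 3 (by norm_num)
  have hq : f (Real.arccos (-1 / √2)) = 0 := by
    rw [arccos_neg_inv_sqrt_two]; exact hf.pi_mul_div 3 4 (by norm_num)
  have h3 : f (Real.arccos (-1 / √3)) = f (Real.arccos (1 / 3)) / 2 := by
    have h := hf.natCast_mul 2 (Real.arccos (-1 / √3))
    push_cast at h
    rw [arccos_neg_inv_sqrt_three, hf.1, hf.2, zero_add] at h
    linarith
  have e1 : (-1 : ℝ) / (√3 * √3) = -(1 / 3) := by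
    rw [Real.mul_self_sqrt (by norm_num)]; norm_num
  have e2 : (-9 : ℝ) / (3 * (3 * √3)) = -1 / √3 := by
    rw [← mul_assoc, show (-9 : ℝ) = 3 * 3 * -1 by norm_num, mul_div_mul_left _ _ (by norm_num)]
  have e3 : (-9 : ℝ) / (3 * (3 * √2)) = -1 / √2 := by
    rw [← mul_assoc, show (-9 : ℝ) = 3 * 3 * -1 by norm_num, mul_div_mul_left _ _ (by norm_num)]
  have e4 : (-9 : ℝ) / (3 * √2 * (3 * √2)) = -1 / 2 := by
    have : 3 * √2 * (3 * √2) = (18 : ℝ) := by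
      linear_combination 9 * Real.mul_self_sqrt (show (0 : ℝ) ≤ 2 by norm_num)
    rw [this]; norm_num
  have e5 : (-9 : ℝ) / (3 * √2 * 3) = -1 / √2 := by
    rw [mul_comm (3 * √2), e3]
  simp only [List.map_cons, List.map_nil, List.sum_cons, List.sum_nil]
  push_cast
  rw [sqrt_nine, sqrt_eighteen, sqrt_twentySeven, e1, e2, e3, e4, e5]
  simp only [zero_div, h0, hhalf, hq, h3, hneg]
  ring

/-- By Niven's theorem arccos(1/3) is outside the rational line spanned by π, so a ℚ-linear
functional on ℝ can vanish on that line but not at arccos(1/3). -/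
theorem exists_kagan : ∃ f : ℝ → ℝ, IsKagan f ∧ f (Real.arccos (1 / 3)) ≠ 0 := by
  have hind : Real.arccos (1 / 3) ∉ Submodule.span ℚ {Real.pi} := by
    rw [Submodule.mem_span_singleton]
    rintro ⟨r, hr⟩
    have := niven ⟨r, by rw [← hr, Rat.smul_def]⟩
      (θ := Real.arccos (1 / 3)) ⟨1 / 3, by rw [Real.cos_arccos] <;> norm_num⟩
    rw [Real.cos_arccos (by norm_num) (by norm_num)] at this
    norm_num at this
  obtain ⟨g, hg, hker⟩ := Submodule.exists_le_ker_of_notMem hind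
  refine ⟨fun x => (g x : ℝ), ⟨fun a b => by simp, ?_⟩, ?_⟩
  · have : g Real.pi = 0 := hker (Submodule.mem_span_singleton_self _)
    simp [this]
  · simpa using hg

/-! ### Solid angles of convex bodies and additivity of the defect -/

/-- The Euclidean space of dimension three. -/
abbrev Space := EuclideanSpace ℝ (Fin 3)

/-- The proportion of the ball of radius `ε` around `x` that lies in `X`. -/
noncomputable def ballRatio (X : Set Space) (x : Space) (ε : ℝ) : ℝ :=
  volume.real (Metric.ball x ε ∩ X) / volume.real (Metric.ball x ε)

theorem volumeReal_ball_pos (x : Space) {ε : ℝ} (hε : 0 < ε) :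
    0 < volume.real (Metric.ball x ε) :=
  ENNReal.toReal_pos (Metric.measure_ball_pos _ _ hε).ne' measure_ball_lt_top.ne

theorem image_homothety_ball (x : Space) {r ε : ℝ} (hr : 0 < r) :
    AffineMap.homothety x r '' Metric.ball x ε = Metric.ball x (r * ε) := by
  ext y
  simp only [Set.mem_image, Metric.mem_ball, AffineMap.homothety_apply, vsub_eq_sub, vadd_eq_add]
  constructor
  · rintro ⟨z, hz, rfl⟩
    rw [dist_eq_norm] at hz ⊢
    rw [add_sub_cancel_right, norm_smul, Real.norm_of_nonneg hr.le]
    exact mul_lt_mul_of_pos_left hz hr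
  · intro hy
    refine ⟨r⁻¹ • (y - x) + x, ?_, ?_⟩
    · rw [dist_eq_norm] at hy ⊢
      rw [add_sub_cancel_right, norm_smul, Real.norm_of_nonneg (inv_pos.2 hr).le,
        inv_mul_lt_iff₀ hr]
      exact hy
    · rw [add_sub_cancel_right, smul_inv_smul₀ hr.ne', sub_add_cancel]

theorem volumeReal_image_homothety (x : Space) {r : ℝ} (hr : 0 < r) (s : Set Space) :
    volume.real (AffineMap.homothety x r '' s) = r ^ 3 * volume.real s := by
  rw [measureReal_def, Measure.addHaar_image_homothety, ENNReal.toReal_mul,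
    ENNReal.toReal_ofReal (abs_nonneg _), abs_of_nonneg (by positivity), measureReal_def]
  simp

theorem volumeReal_ball_inter_ne_top (X : Set Space) (x : Space) (ε : ℝ) :
    volume (Metric.ball x ε ∩ X) ≠ ⊤ :=
  ((measure_mono Set.inter_subset_left).trans_lt measure_ball_lt_top).ne

theorem ballRatio_le_one (X : Set Space) (x : Space) (ε : ℝ) : ballRatio X x ε ≤ 1 :=
  div_le_one_of_le₀ (measureReal_mono Set.inter_subset_left measure_ball_lt_top.ne)
    measureReal_nonneg

/-- By convexity the contraction towards `x` with ratio `ε / δ` maps the part of `X` in the larger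
ball into the part in the smaller one. Monotone and bounded ratios converge, so solid angles exist
for every compact convex set without a local description of it. -/
theorem antitoneOn_ballRatio {X : Set Space} (hX : Convex ℝ X) {x : Space} (hx : x ∈ X) :
    AntitoneOn (ballRatio X x) (Set.Ioi 0) := by
  intro ε hε δ hδ hle
  rw [Set.mem_Ioi] at hε hδ
  have hr : 0 < ε / δ := div_pos hε hδ
  have hr1 : ε / δ ≤ 1 := (div_le_one hδ).2 hle
  have hsub : AffineMap.homothety x (ε / δ) '' (Metric.ball x δ ∩ X) ⊆ Metric.ball x ε ∩ X := by
    rintro _ ⟨y, ⟨hy, hyX⟩, rfl⟩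
    constructor
    · have := Set.mem_image_of_mem (AffineMap.homothety x (ε / δ)) hy
      rwa [image_homothety_ball x hr, div_mul_cancel₀ _ hδ.ne'] at this
    · rw [AffineMap.homothety_apply, vsub_eq_sub, vadd_eq_add]
      have := hX hx hyX (sub_nonneg.2 hr1) hr.le (by ring)
      convert this using 1
      module
  have h1 := measureReal_mono hsub (volumeReal_ball_inter_ne_top X x ε)
  rw [volumeReal_image_homothety x hr] at h1
  have h2 : volume.real (Metric.ball x ε) = (ε / δ) ^ 3 * volume.real (Metric.ball x δ) := by
    rw [← volumeReal_image_homothety x hr, image_homothety_ball x hr, div_mul_cancel₀ _ hδ.ne']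
  have hpos := volumeReal_ball_pos x hδ
  rw [ballRatio, ballRatio, h2, div_le_div_iff₀ hpos (by positivity)]
  calc volume.real (Metric.ball x δ ∩ X) * ((ε / δ) ^ 3 * volume.real (Metric.ball x δ))
      = ((ε / δ) ^ 3 * volume.real (Metric.ball x δ ∩ X)) * volume.real (Metric.ball x δ) := by ring
    _ ≤ _ := mul_le_mul_of_nonneg_right h1 hpos.le

theorem ballRatio_eventually_zero {X : Set Space} (hX : IsClosed X) {x : Space} (hx : x ∉ X) :
    ballRatio X x =ᶠ[𝓝[>] 0] fun _ => 0 := by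
  obtain ⟨δ, hδ, hball⟩ := Metric.isOpen_iff.1 hX.isOpen_compl x hx
  filter_upwards [Ioo_mem_nhdsGT hδ] with ε hε
  have : Metric.ball x ε ∩ X = ∅ := by
    rw [Set.eq_empty_iff_forall_notMem]
    rintro y ⟨hy, hyX⟩
    exact hball (Metric.ball_subset_ball hε.2.le hy) hyX
  simp [ballRatio, this]

/-- Compact convex sets. -/
structure IsBody (X : Set Space) : Prop where
  convex : Convex ℝ X
  compact : IsCompact X

theorem IsBody.tendsto {X : Set Space} (hX : IsBody X) (x : Space) :
    Tendsto (ballRatio X x) (𝓝[>] 0) (𝓝 (solidAngle X x)) := by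
  have : ∃ a, Tendsto (ballRatio X x) (𝓝[>] 0) (𝓝 a) := by
    by_cases hx : x ∈ X
    · exact ⟨_, (antitoneOn_ballRatio hX.convex hx).tendsto_nhdsGT
        ⟨1, by rintro _ ⟨ε, -, rfl⟩; exact ballRatio_le_one X x ε⟩⟩
    · exact ⟨0, tendsto_const_nhds.congr' (ballRatio_eventually_zero hX.compact.isClosed hx).symm⟩
  exact tendsto_nhds_limUnder this

theorem solidAngle_eq_of_tendsto {X : Set Space} {x : Space} {a : ℝ}
    (h : Tendsto (ballRatio X x) (𝓝[>] 0) (𝓝 a)) : solidAngle X x = a :=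
  h.limUnder_eq

theorem solidAngle_eq_zero {X : Set Space} (hX : IsClosed X) {x : Space} (hx : x ∉ X) :
    solidAngle X x = 0 :=
  solidAngle_eq_of_tendsto (tendsto_const_nhds.congr' (ballRatio_eventually_zero hX hx).symm)

theorem integerLattice_three : integerLattice 3 = Set.range intPoint := by
  ext x
  simp only [integerLattice, Set.mem_ofPred_eq, Set.mem_range]
  constructor
  · intro h
    choose z hz using h
    exact ⟨z, by ext j; simp [hz]⟩
  · rintro ⟨z, rfl⟩ j
    exact ⟨z j, rfl⟩

theorem intPoint_injective : Function.Injective intPoint := by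
  intro z w h
  funext j
  have : intPoint z j = intPoint w j := by rw [h]
  simpa using this

theorem finite_intPoint_mem {X : Set Space} (hX : Bornology.IsBounded X) :
    {z : Fin 3 → ℤ | intPoint z ∈ X}.Finite := by
  obtain ⟨R, hR⟩ := hX.exists_norm_le
  refine (Set.finite_Icc (fun _ : Fin 3 => -⌈R⌉) (fun _ => ⌈R⌉)).subset fun z hz => ?_
  have h : ∀ j, |(z j : ℝ)| ≤ ⌈R⌉ := fun j =>
    ((PiLp.norm_apply_le (intPoint z) j).trans (hR _ hz)).trans (Int.le_ceil R)
  rw [Set.mem_Icc, Pi.le_def, Pi.le_def]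
  constructor <;> intro j
  · have := (abs_le.1 (h j)).1
    exact_mod_cast this
  · have := (abs_le.1 (h j)).2
    exact_mod_cast this

theorem IsBody.finite_support {X : Set Space} (hX : IsBody X) :
    (Function.support fun z => solidAngle X (intPoint z)).Finite := by
  refine (finite_intPoint_mem hX.compact.isBounded).subset fun z hz => ?_
  by_contra h
  exact hz (solidAngle_eq_zero hX.compact.isClosed h)

theorem IsBody.discreteVolume_eq {X : Set Space} (hX : IsBody X) :
    discreteVolume X = ∑ᶠ z, solidAngle X (intPoint z) := by
  rw [discreteVolume, integerLattice_three, ← finsum_mem_range intPoint_injective]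
  refine finsum_mem_inter_support_eq' _ _ _ fun x hx => ?_
  have : x ∈ X := by
    by_contra h
    exact hx (solidAngle_eq_zero hX.compact.isClosed h)
  simp [this]

/-- A finite family of compact convex sets with union `P` and null pairwise intersections. -/
structure IsDissection {κ : Type*} (P : Set Space) (C : κ → Set Space) : Prop where
  body : IsBody P
  body_cell : ∀ k, IsBody (C k)
  iUnion_eq : P = ⋃ k, C k
  null : ∀ k k', k ≠ k' → volume (C k ∩ C k') = 0

theorem IsDissection.volumeReal_inter {κ : Type*} [Fintype κ] {P : Set Space} {C : κ → Set Space}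
    (h : IsDissection P C) {B : Set Space} (hB : MeasurableSet B) :
    volume.real (B ∩ P) = ∑ k, volume.real (B ∩ C k) := by
  rw [h.iUnion_eq, Set.inter_iUnion, measureReal_def, measure_iUnion₀, tsum_fintype,
    ENNReal.toReal_sum]
  · rfl
  · exact fun k _ => ((measure_mono Set.inter_subset_right).trans_lt
      (h.body_cell k).compact.measure_lt_top).ne
  · intro k k' hk
    exact measure_mono_null (Set.inter_subset_inter Set.inter_subset_right Set.inter_subset_right)
      (h.null k k' hk)
  · exact fun k => (hB.inter (h.body_cell k).compact.measurableSet).nullMeasurableSet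

theorem IsDissection.solidAngle_eq {κ : Type*} [Fintype κ] {P : Set Space} {C : κ → Set Space}
    (h : IsDissection P C) (x : Space) : solidAngle P x = ∑ k, solidAngle (C k) x := by
  refine solidAngle_eq_of_tendsto ?_
  have h1 : ballRatio P x = fun ε => ∑ k, ballRatio (C k) x ε := by
    funext ε
    simp only [ballRatio]
    rw [h.volumeReal_inter Metric.isOpen_ball.measurableSet, Finset.sum_div]
  rw [h1]
  exact tendsto_finsetSum _ fun k _ => (h.body_cell k).tendsto x

/-- The volume defect is additive. -/
theorem IsDissection.volumeDefect_eq {κ : Type*} [Fintype κ] {P : Set Space} {C : κ → Set Space}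
    (h : IsDissection P C) : volumeDefect P = ∑ k, volumeDefect (C k) := by
  have h1 := h.volumeReal_inter MeasurableSet.univ
  simp only [Set.univ_inter] at h1
  simp only [volumeDefect, Finset.sum_sub_distrib, h1]
  rw [h.body.discreteVolume_eq]
  simp only [h.solidAngle_eq]
  rw [finsum_sum_comm _ _ fun k _ => (h.body_cell k).finite_support]
  simp only [(h.body_cell _).discreteVolume_eq]

theorem IsBody.vadd {X : Set Space} (hX : IsBody X) (v : Space) : IsBody (v +ᵥ X) :=
  ⟨hX.convex.vadd v, hX.compact.vadd v⟩

theorem IsBody.neg {X : Set Space} (hX : IsBody X) : IsBody (-X) :=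
  ⟨hX.convex.neg, hX.compact.neg⟩

theorem ballRatio_vadd (X : Set Space) (v x : Space) (ε : ℝ) :
    ballRatio (v +ᵥ X) (v + x) ε = ballRatio X x ε := by
  have h1 : Metric.ball (v + x) ε = v +ᵥ Metric.ball x ε := by
    rw [Metric.vadd_ball, vadd_eq_add]
  rw [ballRatio, ballRatio, h1, ← Set.vadd_set_inter, measureReal_def, measureReal_def,
    measure_vadd, measure_vadd]
  rfl

theorem solidAngle_vadd (X : Set Space) (v x : Space) :
    solidAngle (v +ᵥ X) (v + x) = solidAngle X x := by
  have : ballRatio (v +ᵥ X) (v + x) = ballRatio X x := funext fun ε => ballRatio_vadd X v x ε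
  exact congrArg (limUnder (𝓝[>] (0 : ℝ))) this

theorem IsBody.volumeDefect_vadd {X : Set Space} (hX : IsBody X) (v : Fin 3 → ℤ) :
    volumeDefect (intPoint v +ᵥ X) = volumeDefect X := by
  rw [volumeDefect, volumeDefect, (hX.vadd _).discreteVolume_eq, hX.discreteVolume_eq,
    ← finsum_comp_equiv (Equiv.addLeft v), measureReal_def, measure_vadd]
  simp only [Equiv.coe_addLeft, intPoint_add, solidAngle_vadd]
  rfl

theorem ballRatio_neg (X : Set Space) (x : Space) (ε : ℝ) :
    ballRatio (-X) (-x) ε = ballRatio X x ε := by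
  have h1 : Metric.ball (-x) ε = -Metric.ball x ε := by
    rw [neg_ball]
  rw [ballRatio, ballRatio, h1, ← Set.inter_neg, measureReal_def, measureReal_def,
    Measure.measure_neg, Measure.measure_neg]
  rfl

theorem intPoint_neg (z : Fin 3 → ℤ) : intPoint (-z) = -intPoint z := by
  ext j; simp

theorem IsBody.volumeDefect_neg {X : Set Space} (hX : IsBody X) :
    volumeDefect (-X) = volumeDefect X := by
  have h1 : ∀ x, solidAngle (-X) (-x) = solidAngle X x := fun x => by
    have : ballRatio (-X) (-x) = ballRatio X x := funext fun ε => ballRatio_neg X x ε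
    exact congrArg (limUnder (𝓝[>] (0 : ℝ))) this
  rw [volumeDefect, volumeDefect, hX.neg.discreteVolume_eq, hX.discreteVolume_eq,
    ← finsum_comp_equiv (Equiv.neg (Fin 3 → ℤ)), measureReal_def, Measure.measure_neg]
  simp only [Equiv.neg_apply, intPoint_neg, h1]
  rfl

/-! ### Parallelepipeds and prisms spanned by lattice vectors -/

theorem finsum_eq_index {A : Type*} [AddCommGroup A] (H : AddSubgroup A) [Finite (A ⧸ H)]
    {φ : A → ℝ} (hφ : (Function.support φ).Finite) (h : ∀ a, ∑ᶠ g : H, φ (a + g) = 1) :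
    ∑ᶠ a, φ a = H.index := by
  -- The group is the disjoint union of the cosets of `H`, and `φ` sums to one over each of them.
  have hbij : Function.Bijective fun x : (A ⧸ H) × H => x.1.out + (x.2 : A) := by
    constructor
    · rintro ⟨q, g⟩ ⟨q', g'⟩ heq
      have h1 : q = q' := by
        have := congrArg (QuotientAddGroup.mk (s := H)) heq
        simpa [QuotientAddGroup.mk_add_of_mem] using this
      subst h1
      simpa using heq
    · intro a
      have hmem : -(a : A ⧸ H).out + a ∈ H := by
        rw [← QuotientAddGroup.eq]
        simp
      exact ⟨(a, ⟨_, hmem⟩), by simp⟩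
  rw [← finsum_comp_equiv (Equiv.ofBijective _ hbij), finsum_curry]
  · simp only [Equiv.ofBijective_apply, h]
    have := Fintype.ofFinite (A ⧸ H)
    rw [finsum_eq_sum_of_fintype, AddSubgroup.index, Nat.card_eq_fintype_card]
    simp
  · exact hφ.preimage (Equiv.injective _).injOn

theorem isBody_parallelepiped (b : Module.Basis (Fin 3) ℝ Space) : IsBody (parallelepiped b) :=
  ⟨convex_parallelepiped _, (Module.Basis.parallelepiped b).isCompact⟩

theorem ball_vadd_eq (g x : Space) (ε : ℝ) : g +ᵥ Metric.ball x ε = Metric.ball (g + x) ε := by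
  rw [Metric.vadd_ball, vadd_eq_add]

/-- The translates of a parallelepiped by its lattice tile space. -/
theorem finsum_solidAngle_parallelepiped (b : Module.Basis (Fin 3) ℝ Space) (x : Space) :
    ∑ᶠ g : Submodule.span ℤ (Set.range b), solidAngle (parallelepiped b) (x + g) = 1 := by
  set L := Submodule.span ℤ (Set.range b)
  have hbody := isBody_parallelepiped b
  have hbdd : Bornology.IsBounded (-x +ᵥ Metric.cthickening 1 (parallelepiped b)) :=
    (hbody.compact.isBounded.cthickening).vadd _
  -- For all radii at most one, only the finitely many translates near `x` matter. This uniform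
  -- finite set allows the limit to pass through the sum.
  have hfin : {g : L | (g : Space) ∈ -x +ᵥ Metric.cthickening 1 (parallelepiped b)}.Finite :=
    ((ZSpan.setFinite_inter b hbdd).preimage Subtype.val_injective.injOn).subset
      fun g hg => ⟨hg, g.2⟩
  set S := hfin.toFinset
  have hS : ∀ (g : L) (ε : ℝ), ε ≤ 1 → g ∉ S →
      Metric.ball (x + g) ε ∩ parallelepiped b = ∅ := by
    intro g ε hε hg
    rw [Set.eq_empty_iff_forall_notMem]
    rintro y ⟨hy, hyb⟩
    refine hg (hfin.mem_toFinset.2 ?_)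
    rw [Set.mem_ofPred_eq, Set.mem_vadd_set_iff_neg_vadd_mem, neg_neg, vadd_eq_add]
    refine Metric.mem_cthickening_of_dist_le _ y _ _ hyb ?_
    rw [dist_comm]
    exact (Metric.mem_ball.1 hy).le.trans hε
  -- At each fixed radius the tiling is exact: the fundamental domain differs from the closed
  -- parallelepiped by a null set, so its translates share out the ball.
  have hsum : ∀ ε, 0 < ε → ε ≤ 1 → ∑ g ∈ S, ballRatio (parallelepiped b) (x + g) ε = 1 := by
    intro ε hε hε1
    have : VAddInvariantMeasure L Space volume :=
      inferInstanceAs (VAddInvariantMeasure L.toAddSubgroup Space volume)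
    have : MeasurableConstVAdd L Space :=
      inferInstanceAs (MeasurableConstVAdd L.toAddSubgroup Space)
    have h1 := (ZSpan.isAddFundamentalDomain b volume).measure_eq_tsum (Metric.ball x ε)
    have h2 : ∀ g : L, volume ((g +ᵥ Metric.ball x ε) ∩ ZSpan.fundamentalDomain b) =
        volume (Metric.ball (x + g) ε ∩ parallelepiped b) := by
      intro g
      have : g +ᵥ Metric.ball x ε = Metric.ball (x + g) ε := by
        rw [add_comm, ← ball_vadd_eq]
        rfl
      rw [this]
      exact measure_congr (ae_eq_set_inter (ae_eq_refl _)
        (ZSpan.fundamentalDomain_ae_parallelepiped b volume))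
    simp only [h2] at h1
    rw [tsum_eq_sum (s := S) (fun g hg => by rw [hS g ε hε1 hg, measure_empty])] at h1
    have hvol : ∀ g : L, volume.real (Metric.ball (x + g) ε) = volume.real (Metric.ball x ε) := by
      intro g
      rw [measureReal_def, measureReal_def, add_comm, ← ball_vadd_eq, measure_vadd]
    simp only [ballRatio, hvol, ← Finset.sum_div]
    rw [div_eq_one_iff_eq (volumeReal_ball_pos x hε).ne', measureReal_def, h1,
      ENNReal.toReal_sum fun g _ => volumeReal_ball_inter_ne_top _ _ _]
    rfl
  have hlim : ∑ g ∈ S, solidAngle (parallelepiped b) (x + g) = 1 := by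
    refine tendsto_nhds_unique (tendsto_finsetSum S fun g _ => hbody.tendsto (x + g)) ?_
    refine tendsto_const_nhds.congr' ?_
    filter_upwards [Ioo_mem_nhdsGT one_pos] with ε hε
    exact (hsum ε hε.1 hε.2.le).symm
  rw [← hlim]
  refine finsum_eq_sum_of_support_subset _ fun g hg => ?_
  by_contra hgS
  refine hg (solidAngle_eq_zero hbody.compact.isClosed fun hmem => ?_)
  have : x + (g : Space) ∈ Metric.ball (x + (g : Space)) 1 ∩ parallelepiped b :=
    ⟨Metric.mem_ball_self one_pos, hmem⟩
  rw [hS g 1 le_rfl hgS] at this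
  exact this

/-- The standard basis of space. -/
noncomputable def stdBasis : Module.Basis (Fin 3) ℝ Space :=
  (EuclideanSpace.basisFun (Fin 3) ℝ).toBasis

theorem mem_span_stdBasis (x : Space) :
    x ∈ Submodule.span ℤ (Set.range stdBasis) ↔ ∃ z, intPoint z = x := by
  rw [Module.Basis.mem_span_iff_repr_mem]
  constructor
  · intro h
    choose z hz using h
    refine ⟨z, ?_⟩
    ext j
    have := hz j
    simpa [stdBasis] using this
  · rintro ⟨z, rfl⟩ j
    exact ⟨z j, by simp [stdBasis]⟩

theorem covolume_eq_volumeReal (b : Module.Basis (Fin 3) ℝ Space) :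
    ZLattice.covolume (Submodule.span ℤ (Set.range b)) = volume.real (parallelepiped b) := by
  rw [ZLattice.covolume_eq_measure_fundamentalDomain _ _ (ZSpan.isAddFundamentalDomain b volume)]
  exact measureReal_congr (ZSpan.fundamentalDomain_ae_parallelepiped b volume)

theorem covolume_stdBasis :
    ZLattice.covolume (Submodule.span ℤ (Set.range stdBasis)) = 1 := by
  rw [covolume_eq_volumeReal, measureReal_def, stdBasis, OrthonormalBasis.coe_toBasis,
    OrthonormalBasis.volume_parallelepiped, ENNReal.toReal_one]

/-- The integer points as a lattice. -/
noncomputable def intPointEquiv :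
    (Fin 3 → ℤ) ≃ (Submodule.span ℤ (Set.range stdBasis)).toAddSubgroup :=
  Equiv.ofBijective (fun z => ⟨intPoint z, (mem_span_stdBasis _).2 ⟨z, rfl⟩⟩)
    ⟨fun z w h => intPoint_injective (congrArg Subtype.val h),
      fun x => by
        obtain ⟨z, hz⟩ := (mem_span_stdBasis _).1 x.2
        exact ⟨z, Subtype.ext hz⟩⟩

/-- A lattice parallelepiped has volume defect zero. -/
theorem volumeDefect_parallelepiped (b : Module.Basis (Fin 3) ℝ Space)
    (hb : ∀ i, ∃ z, intPoint z = b i) : volumeDefect (parallelepiped b) = 0 := by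
  have hbody := isBody_parallelepiped b
  have hle : Submodule.span ℤ (Set.range b) ≤ Submodule.span ℤ (Set.range stdBasis) := by
    rw [Submodule.span_le]
    rintro _ ⟨i, rfl⟩
    exact (mem_span_stdBasis _).2 (hb i)
  -- The integer lattice has covolume one, so the volume of the parallelepiped is the index of its
  -- lattice; the discrete volume is the same index, each coset counting one.
  have hind := ZLattice.covolume_div_covolume_eq_relIndex' _ _ hle
  rw [covolume_stdBasis, div_one, covolume_eq_volumeReal] at hind
  set L₁ := (Submodule.span ℤ (Set.range b)).toAddSubgroup
  set L₂ := (Submodule.span ℤ (Set.range stdBasis)).toAddSubgroup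
  have hle' : L₁ ≤ L₂ := hle
  have hpos : L₁.relIndex L₂ ≠ 0 := by
    intro h0
    rw [h0, Nat.cast_zero, ← covolume_eq_volumeReal] at hind
    exact ZLattice.covolume_ne_zero _ _ hind
  have : Finite (L₂ ⧸ L₁.addSubgroupOf L₂) := Nat.finite_of_card_ne_zero hpos
  have hfin : (Function.support fun a : L₂ => solidAngle (parallelepiped b) (a : Space)).Finite := by
    have := hbody.finite_support.preimage intPointEquiv.symm.injective.injOn
    refine this.subset fun a ha => ?_
    obtain ⟨z, rfl⟩ := intPointEquiv.surjective a
    rw [Set.mem_preimage, Equiv.symm_apply_apply]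
    exact ha
  have hchi : discreteVolume (parallelepiped b) = L₁.relIndex L₂ := by
    rw [hbody.discreteVolume_eq, AddSubgroup.relIndex, ← finsum_eq_index _ hfin,
      ← finsum_comp_equiv intPointEquiv]
    · rfl
    · intro a
      rw [← finsum_solidAngle_parallelepiped b a]
      exact finsum_comp_equiv (AddSubgroup.addSubgroupOfEquivOfLe hle').toEquiv
        (f := fun g : L₁ => solidAngle (parallelepiped b) ((a : Space) + g))
  rw [volumeDefect, hchi, hind, sub_self]

theorem volume_plane (φ : Space →ₗ[ℝ] ℝ) (hφ : φ ≠ 0) (c : ℝ) : volume {x | φ x = c} = 0 := by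
  rcases Set.eq_empty_or_nonempty {x | φ x = c} with h | ⟨x₀, hx₀⟩
  · rw [h, measure_empty]
  refine measure_mono_null (t := (AffineSubspace.mk' x₀ (LinearMap.ker φ) : Set Space)) ?_
    (Measure.addHaar_affineSubspace _ _ fun h => hφ ?_)
  · intro x hx
    have h1 : φ x = c := hx
    have h2 : φ x₀ = c := hx₀
    simp [AffineSubspace.mem_mk', h1, h2]
  · have := congrArg AffineSubspace.direction h
    rw [AffineSubspace.direction_mk', AffineSubspace.direction_top] at this
    exact LinearMap.ker_eq_top.1 this

/-- The triangular prism spanned by a basis. -/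
def prism (b : Module.Basis (Fin 3) ℝ Space) : Set Space :=
  {x | 0 ≤ b.repr x 0 ∧ 0 ≤ b.repr x 1 ∧ b.repr x 0 + b.repr x 1 ≤ 1 ∧ 0 ≤ b.repr x 2 ∧
    b.repr x 2 ≤ 1}

theorem continuous_repr (b : Module.Basis (Fin 3) ℝ Space) (i : Fin 3) :
    Continuous fun x => b.repr x i :=
  (b.coord i).continuous_of_finiteDimensional

theorem isBody_prism (b : Module.Basis (Fin 3) ℝ Space) : IsBody (prism b) := by
  have hsub : prism b ⊆ parallelepiped b := by
    rintro x ⟨h0, h1, h2, h3, h4⟩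
    rw [parallelepiped_basis_eq]
    intro i
    fin_cases i
    · exact ⟨h0, by simp; linarith⟩
    · exact ⟨h1, by simp; linarith⟩
    · exact ⟨h3, h4⟩
  have hc := continuous_repr b
  refine ⟨?_, (isBody_parallelepiped b).compact.of_isClosed_subset ?_ hsub⟩
  · rintro x ⟨h0, h1, h2, h3, h4⟩ y ⟨h0', h1', h2', h3', h4'⟩ p q hp hq hpq
    simp only [prism, Set.mem_ofPred_eq, map_add, map_smul, Finsupp.add_apply,
      Finsupp.smul_apply, smul_eq_mul]
    refine ⟨by positivity, by positivity, ?_, by positivity, ?_⟩ <;> nlinarith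
  · exact (isClosed_le continuous_const (hc 0)).inter <|
      (isClosed_le continuous_const (hc 1)).inter <|
      (isClosed_le ((hc 0).add (hc 1)) continuous_const).inter <|
      (isClosed_le continuous_const (hc 2)).inter (isClosed_le (hc 2) continuous_const)

/-- A prism and its point reflection make up a parallelepiped. -/
theorem isDissection_parallelepiped (b : Module.Basis (Fin 3) ℝ Space) :
    IsDissection (parallelepiped b) ![prism b, (b 0 + b 1 + b 2) +ᵥ -prism b] := by
  have hrefl : (b 0 + b 1 + b 2) +ᵥ -prism b =
      {x | b.repr x 0 ≤ 1 ∧ b.repr x 1 ≤ 1 ∧ 1 ≤ b.repr x 0 + b.repr x 1 ∧ 0 ≤ b.repr x 2 ∧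
        b.repr x 2 ≤ 1} := by
    ext x
    rw [Set.mem_vadd_set_iff_neg_vadd_mem, Set.mem_neg, vadd_eq_add, neg_add, neg_neg]
    simp only [prism, Set.mem_ofPred_eq, map_add, map_neg, Finsupp.add_apply, Finsupp.neg_apply,
      Module.Basis.repr_self, Finsupp.single_apply]
    norm_num [show (2 : Fin 3) ≠ 0 by decide, show (2 : Fin 3) ≠ 1 by decide,
      show (0 : Fin 3) ≠ 2 by decide, show (1 : Fin 3) ≠ 2 by decide]
    intro h0 h1
    constructor <;> rintro ⟨h2, h3, h4⟩ <;> refine ⟨?_, ?_, ?_⟩ <;> linarith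
  refine ⟨isBody_parallelepiped b, ?_, ?_, ?_⟩
  · intro k
    fin_cases k
    · exact isBody_prism b
    · exact (isBody_prism b).neg.vadd _
  · rw [hrefl, parallelepiped_basis_eq]
    ext x
    simp only [Set.mem_ofPred_eq, Set.mem_iUnion, Fin.exists_fin_two, Fin.forall_fin_succ,
      prism, Set.mem_Icc]
    simp
    constructor
    · rintro ⟨⟨h0, h0'⟩, ⟨h1, h1'⟩, h2, h2'⟩
      rcases le_total (b.repr x 0 + b.repr x 1) 1 with h | h
      · exact Or.inl ⟨h0, h1, h, h2, h2'⟩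
      · exact Or.inr ⟨h0', h1', h, h2, h2'⟩
    · rintro (⟨h0, h1, h2, h3, h4⟩ | ⟨h0, h1, h2, h3, h4⟩)
      · exact ⟨⟨h0, by linarith⟩, ⟨h1, by linarith⟩, h3, h4⟩
      · exact ⟨⟨by linarith, h0⟩, ⟨by linarith, h1⟩, h3, h4⟩
  · have hnull : volume (prism b ∩ ((b 0 + b 1 + b 2) +ᵥ -prism b)) = 0 := by
      refine measure_mono_null ?_ (volume_plane (b.coord 0 + b.coord 1) ?_ 1)
      · rw [hrefl]
        rintro x ⟨h1, h2⟩
        exact le_antisymm h1.2.2.1 h2.2.2.1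
      · intro h0
        have := congrArg (fun φ : Space →ₗ[ℝ] ℝ => φ (b 0)) h0
        simp at this
    intro k k' hk
    fin_cases k <;> fin_cases k'
    · exact absurd rfl hk
    · exact hnull
    · exact (Set.inter_comm _ _ ▸ hnull)
    · exact absurd rfl hk

/-- A lattice prism has volume defect zero. -/
theorem volumeDefect_prism (b : Module.Basis (Fin 3) ℝ Space)
    (hb : ∀ i, ∃ z, intPoint z = b i) : volumeDefect (prism b) = 0 := by
  choose z hz using hb
  have h := (isDissection_parallelepiped b).volumeDefect_eq
  rw [volumeDefect_parallelepiped b fun i => ⟨z i, hz i⟩, Fin.sum_univ_two] at h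
  simp only [Matrix.cons_val_zero, Matrix.cons_val_one] at h
  rw [← hz, ← hz, ← hz, ← intPoint_add, ← intPoint_add, (isBody_prism b).neg.volumeDefect_vadd,
    (isBody_prism b).volumeDefect_neg] at h
  linarith

theorem volumeReal_prism (b : Module.Basis (Fin 3) ℝ Space) :
    volume.real (prism b) = volume.real (parallelepiped b) / 2 := by
  have h := (isDissection_parallelepiped b).volumeReal_inter MeasurableSet.univ
  simp only [Set.univ_inter, Fin.sum_univ_two, Matrix.cons_val_zero, Matrix.cons_val_one] at h
  have h2 : volume.real ((b 0 + b 1 + b 2) +ᵥ -prism b) = volume.real (prism b) := by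
    rw [measureReal_def, measure_vadd, Measure.measure_neg, measureReal_def]
  linarith

theorem linearIndependent_intPoint {u v w : Fin 3 → ℤ} (h : det3 u v w ≠ 0) :
    LinearIndependent ℝ ![intPoint u, intPoint v, intPoint w] := by
  have h' : (det3 u v w : ℝ) ≠ 0 := by exact_mod_cast h
  rw [Fintype.linearIndependent_iff]
  intro c hc
  rw [Fin.sum_univ_three] at hc
  simp only [Matrix.cons_val_zero, Matrix.cons_val_one, Matrix.cons_val] at hc
  have e : ∀ j, c 0 * u j + c 1 * v j + c 2 * w j = 0 := fun j => by
    have := congrArg (fun x : Space => x j) hc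
    simpa using this
  have e0 := e 0
  have e1 := e 1
  have e2 := e 2
  have key : ∀ i, (det3 u v w : ℝ) * c i = 0 := by
    intro i
    simp only [det3]
    push_cast
    fin_cases i <;> simp only [Fin.zero_eta, Fin.mk_one, Fin.reduceFinMk]
    · linear_combination ((v 1 : ℝ) * w 2 - v 2 * w 1) * e0 + ((v 2 : ℝ) * w 0 - v 0 * w 2) * e1
        + ((v 0 : ℝ) * w 1 - v 1 * w 0) * e2
    · linear_combination ((w 1 : ℝ) * u 2 - w 2 * u 1) * e0 + ((w 2 : ℝ) * u 0 - w 0 * u 2) * e1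
        + ((w 0 : ℝ) * u 1 - w 1 * u 0) * e2
    · linear_combination ((u 1 : ℝ) * v 2 - u 2 * v 1) * e0 + ((u 2 : ℝ) * v 0 - u 0 * v 2) * e1
        + ((u 0 : ℝ) * v 1 - u 1 * v 0) * e2
  exact fun i => (mul_eq_zero.1 (key i)).resolve_left h'

/-- The basis formed by three independent integer vectors. -/
noncomputable def intBasis {u v w : Fin 3 → ℤ} (h : det3 u v w ≠ 0) :
    Module.Basis (Fin 3) ℝ Space :=
  basisOfLinearIndependentOfCardEqFinrank (linearIndependent_intPoint h) (by simp)

theorem coe_intBasis {u v w : Fin 3 → ℤ} (h : det3 u v w ≠ 0) :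
    ⇑(intBasis h) = ![intPoint u, intPoint v, intPoint w] :=
  coe_basisOfLinearIndependentOfCardEqFinrank _ _

theorem intBasis_integral {u v w : Fin 3 → ℤ} (h : det3 u v w ≠ 0) (i : Fin 3) :
    ∃ z, intPoint z = intBasis h i := by
  rw [coe_intBasis]
  fin_cases i
  exacts [⟨u, rfl⟩, ⟨v, rfl⟩, ⟨w, rfl⟩]

theorem intBasis_repr {u v w : Fin 3 → ℤ} (h : det3 u v w ≠ 0) (x : Space) :
    x = (intBasis h).repr x 0 • intPoint u + (intBasis h).repr x 1 • intPoint v +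
      (intBasis h).repr x 2 • intPoint w := by
  conv_lhs => rw [← (intBasis h).sum_repr x]
  rw [Fin.sum_univ_three, coe_intBasis]
  rfl

theorem intBasis_repr_comb {u v w : Fin 3 → ℤ} (h : det3 u v w ≠ 0) (r s t : ℝ) :
    (intBasis h).repr (r • intPoint u + s • intPoint v + t • intPoint w) 0 = r ∧
    (intBasis h).repr (r • intPoint u + s • intPoint v + t • intPoint w) 1 = s ∧
    (intBasis h).repr (r • intPoint u + s • intPoint v + t • intPoint w) 2 = t := by
  have hu : intPoint u = intBasis h 0 := by rw [coe_intBasis]; rfl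
  have hv : intPoint v = intBasis h 1 := by rw [coe_intBasis]; rfl
  have hw : intPoint w = intBasis h 2 := by rw [coe_intBasis]; rfl
  rw [hu, hv, hw]
  simp

/-- The segment from `p` to `p + u`. -/
def seg (p u : Space) : Set Space := {x | ∃ s : ℝ, 0 ≤ s ∧ s ≤ 1 ∧ x = p + s • u}

/-- The triangle with vertices `p`, `p + u`, `p + v`. -/
def tri (p u v : Space) : Set Space :=
  {x | ∃ s r : ℝ, 0 ≤ s ∧ 0 ≤ r ∧ s + r ≤ 1 ∧ x = p + (s • u + r • v)}

theorem volumeDefect_box {p q r u v w : Fin 3 → ℤ} (h : det3 u v w ≠ 0) :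
    volumeDefect (seg (intPoint p) (intPoint u) + seg (intPoint q) (intPoint v) +
      seg (intPoint r) (intPoint w)) = 0 := by
  have : seg (intPoint p) (intPoint u) + seg (intPoint q) (intPoint v) +
      seg (intPoint r) (intPoint w) = intPoint (p + q + r) +ᵥ parallelepiped (intBasis h) := by
    ext x
    rw [Set.mem_vadd_set_iff_neg_vadd_mem, parallelepiped_basis_eq, intPoint_add, intPoint_add]
    constructor
    · rintro ⟨_, ⟨_, ⟨s, hs0, hs1, rfl⟩, _, ⟨s', hs0', hs1', rfl⟩, rfl⟩, _, ⟨t, ht0, ht1, rfl⟩, rfl⟩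
      have : -(intPoint p + intPoint q + intPoint r) +ᵥ
          ((intPoint p + s • intPoint u) + (intPoint q + s' • intPoint v) +
            (intPoint r + t • intPoint w)) =
          s • intPoint u + s' • intPoint v + t • intPoint w := by
        rw [vadd_eq_add]; abel
      obtain ⟨e0, e1, e2⟩ := intBasis_repr_comb h s s' t
      rw [Set.mem_ofPred_eq, Fin.forall_fin_succ, Fin.forall_fin_two]
      change _ ∈ Set.Icc _ _ ∧ (intBasis h).repr _ 1 ∈ Set.Icc _ _ ∧
        (intBasis h).repr _ 2 ∈ Set.Icc _ _
      simp only
      rw [this, e0, e1, e2]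
      exact ⟨⟨hs0, hs1⟩, ⟨hs0', hs1'⟩, ht0, ht1⟩
    · intro hx
      have hrep := intBasis_repr h (-(intPoint p + intPoint q + intPoint r) +ᵥ x)
      refine ⟨_, ⟨_, ⟨_, (hx 0).1, (hx 0).2, rfl⟩, _, ⟨_, (hx 1).1, (hx 1).2, rfl⟩, rfl⟩, _,
        ⟨_, (hx 2).1, (hx 2).2, rfl⟩, ?_⟩
      have hx' : x = (intPoint p + intPoint q + intPoint r) +
          (-(intPoint p + intPoint q + intPoint r) +ᵥ x) := by
        rw [vadd_eq_add]; abel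
      conv_rhs => rw [hx', hrep]
      dsimp only
      abel
  rw [this, (isBody_parallelepiped _).volumeDefect_vadd,
    volumeDefect_parallelepiped _ (intBasis_integral h)]

theorem prism_sum_eq {p q r u v w : Fin 3 → ℤ} (h : det3 u v w ≠ 0) :
    tri (intPoint p) (intPoint u) (intPoint v) + seg (intPoint q) (intPoint w) +
      {intPoint r} = intPoint (p + q + r) +ᵥ prism (intBasis h) := by
  ext x
  rw [Set.mem_vadd_set_iff_neg_vadd_mem, prism, intPoint_add, intPoint_add]
  constructor
  · rintro ⟨_, ⟨_, ⟨s, s', hs, hs', hss, rfl⟩, _, ⟨t, ht0, ht1, rfl⟩, rfl⟩, _, rfl, rfl⟩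
    have : -(intPoint p + intPoint q + intPoint r) +ᵥ
        ((intPoint p + (s • intPoint u + s' • intPoint v)) + (intPoint q + t • intPoint w) +
          intPoint r) =
        s • intPoint u + s' • intPoint v + t • intPoint w := by
      rw [vadd_eq_add]; abel
    obtain ⟨e0, e1, e2⟩ := intBasis_repr_comb h s s' t
    rw [Set.mem_ofPred_eq]
    simp only
    rw [this, e0, e1, e2]
    exact ⟨hs, hs', hss, ht0, ht1⟩
  · rintro ⟨h0, h1, h2, h3, h4⟩
    have hrep := intBasis_repr h (-(intPoint p + intPoint q + intPoint r) +ᵥ x)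
    refine ⟨_, ⟨_, ⟨_, _, h0, h1, h2, rfl⟩, _, ⟨_, h3, h4, rfl⟩, rfl⟩, _, rfl, ?_⟩
    have hx' : x = (intPoint p + intPoint q + intPoint r) +
        (-(intPoint p + intPoint q + intPoint r) +ᵥ x) := by
      rw [vadd_eq_add]; abel
    conv_rhs => rw [hx', hrep]
    dsimp only
    abel

theorem volumeDefect_prism_sum {p q r u v w : Fin 3 → ℤ} (h : det3 u v w ≠ 0) :
    volumeDefect (tri (intPoint p) (intPoint u) (intPoint v) + seg (intPoint q) (intPoint w) +
      {intPoint r}) = 0 := by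
  rw [prism_sum_eq h, (isBody_prism _).volumeDefect_vadd,
    volumeDefect_prism _ (intBasis_integral h)]

/-! ### Regular mixed subdivisions -/

theorem isCompact_isWeight {ι α : Type*} [Fintype α] {lam : ι → ℝ} {M : ι → Finset α} :
    IsCompact {c : ι → α → ℝ | IsWeight lam M c} := by
  refine (isCompact_Icc (a := (0 : ι → α → ℝ)) (b := fun i _ => lam i)).of_isClosed_subset ?_ ?_
  · have hc : ∀ i a, Continuous fun c : ι → α → ℝ => c i a := fun i a =>
      (continuous_apply a).comp (continuous_apply i)
    simp only [IsWeight, Set.ofPred_and, Set.ofPred_forall]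
    refine IsClosed.inter ?_ (IsClosed.inter ?_ ?_)
    · exact isClosed_iInter fun i => isClosed_iInter fun a => isClosed_le continuous_const (hc i a)
    · exact isClosed_iInter fun i => isClosed_iInter fun a => isClosed_iInter fun _ =>
        isClosed_eq (hc i a) continuous_const
    · exact isClosed_iInter fun i => isClosed_eq (continuous_finsetSum _ fun a _ => hc i a)
        continuous_const
  · rintro c ⟨h0, -, h2⟩
    refine ⟨fun i a => h0 i a, fun i a => ?_⟩
    change c i a ≤ lam i
    rw [← h2 i]
    exact Finset.single_le_sum (fun a _ => h0 i a) (Finset.mem_univ a)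

section Subdivision

variable {ι α : Type*} [Fintype ι] [Fintype α] {t : ι → α → Space} {lam : ι → ℝ}
  {M : ι → Finset α}

theorem continuous_weightedPoint : Continuous (weightedPoint t) := by
  unfold weightedPoint
  fun_prop

theorem isBody_mink : IsBody (mink t lam M) := by
  refine ⟨convex_mink, ?_⟩
  have : mink t lam M = weightedPoint t '' {c | IsWeight lam M c} := rfl
  rw [this]
  exact isCompact_isWeight.image continuous_weightedPoint

/-- A regular mixed subdivision: the weights `w` attain their lower convex hull over the `k`-th
cell at the affine function given by `l k` and `h k`. -/
theorem isDissection_mink {κ : Type*} {M : κ → ι → Finset α} {w : ι → α → ℝ}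
    {l : κ → Space →ₗ[ℝ] ℝ} {h : κ → ι → ℝ} (hle : ∀ k i a, l k (t i a) + h k i ≤ w i a)
    (heq : ∀ k i, ∀ a ∈ M k i, l k (t i a) + h k i = w i a) (hinj : Function.Injective l)
    (hcov : ∀ c, IsWeight lam (fun _ => Finset.univ) c →
      (∀ c', IsWeight lam (fun _ => Finset.univ) c' → weightedPoint t c' = weightedPoint t c →
        ∑ i, ∑ a, c i a * w i a ≤ ∑ i, ∑ a, c' i a * w i a) →
      ∃ k, ∀ i a, c i a ≠ 0 → a ∈ M k i) :
    IsDissection (mink t lam fun _ => Finset.univ) fun k => mink t lam (M k) := by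
  have hsum : ∀ k c, IsWeight lam (fun _ => Finset.univ) c →
      ∑ i, ∑ a, c i a * (l k (t i a) + h k i) = l k (weightedPoint t c) + ∑ i, lam i * h k i := by
    intro k c hc
    rw [map_weightedPoint, ← Finset.sum_add_distrib]
    refine Finset.sum_congr rfl fun i _ => ?_
    rw [← hc.2.2 i, Finset.sum_mul, ← Finset.sum_add_distrib]
    exact Finset.sum_congr rfl fun a _ => by rw [smul_eq_mul]; ring
  have hmono : ∀ k, ∀ c, IsWeight lam (M k) c → IsWeight lam (fun _ => Finset.univ) c :=
    fun k c hc => ⟨hc.1, by simp, hc.2.2⟩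
  refine ⟨isBody_mink, fun k => isBody_mink, ?_, ?_⟩
  · apply Set.Subset.antisymm
    · rintro x ⟨c₀, hc₀, rfl⟩
      -- Among all representations of the point, one of least lifting weight exists by compactness;
      -- by `hcov` its support lies in a single cell.
      have hcomp : IsCompact {c | IsWeight lam (fun _ => Finset.univ) c ∧
          weightedPoint t c = weightedPoint t c₀} :=
        isCompact_isWeight.inter_right (isClosed_eq continuous_weightedPoint continuous_const)
      obtain ⟨c, ⟨hc, hct⟩, hmin⟩ := hcomp.exists_isMinOn ⟨c₀, hc₀, rfl⟩
        (f := fun c => ∑ i, ∑ a, c i a * w i a) (by fun_prop)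
      obtain ⟨k, hk⟩ := hcov c hc fun c' hc' h' => hmin ⟨hc', h'.trans hct⟩
      rw [Set.mem_iUnion]
      refine ⟨k, c, ⟨hc.1, fun i a ha => ?_, hc.2.2⟩, hct⟩
      by_contra h0
      exact ha (hk i a h0)
    · exact Set.iUnion_subset fun k => mink_mono fun i => Finset.subset_univ _
  · intro k k' hk
    refine measure_mono_null ?_ (volume_plane (l k - l k') (sub_ne_zero.2 fun h0 => hk (hinj h0))
      (∑ i, lam i * h k' i - ∑ i, lam i * h k i))
    -- Over its own cell an affine function reaches the lifting weights, so it dominates the other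
    -- ones there. On a common point the two functions agree, and since the linear parts differ this
    -- is a plane.
    have key : ∀ k k' x, x ∈ mink t lam (M k) → x ∈ mink t lam (M k') →
        l k' x + ∑ i, lam i * h k' i ≤ l k x + ∑ i, lam i * h k i := by
      rintro k k' x ⟨c, hc, rfl⟩ -
      rw [← hsum k c (hmono k c hc), ← hsum k' c (hmono k c hc)]
      refine Finset.sum_le_sum fun i _ => Finset.sum_le_sum fun a _ => ?_
      by_cases ha : a ∈ M k i
      · rw [heq k i a ha]
        exact mul_le_mul_of_nonneg_left (hle k' i a) (hc.1 i a)
      · simp [hc.2.1 i a ha]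
    rintro x ⟨hx, hx'⟩
    have h1 := key k k' x hx hx'
    have h2 := key k' k x hx' hx
    rw [Set.mem_ofPred_eq, LinearMap.sub_apply]
    linarith

/-- An affine relation of negative weight cannot be applied to a minimal representation. -/
theorem exists_eq_zero_of_minimal {w : ι → α → ℝ} {c : ι → α → ℝ}
    (hc : IsWeight lam (fun _ => Finset.univ) c)
    (hmin : ∀ c', IsWeight lam (fun _ => Finset.univ) c' →
      weightedPoint t c' = weightedPoint t c →
        ∑ i, ∑ a, c i a * w i a ≤ ∑ i, ∑ a, c' i a * w i a)
    {u : ι → α → ℝ} (hu : ∀ i, ∑ a, u i a = 0) (hut : weightedPoint t u = 0)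
    (huw : ∑ i, ∑ a, u i a * w i a < 0) : ∃ i a, u i a < 0 ∧ c i a = 0 := by
  by_contra hcon
  push Not at hcon
  -- If every decreasing coordinate were positive, a small multiple of `u` could be added without
  -- leaving the admissible weights, lowering the total weight.
  have hev : ∀ᶠ ε : ℝ in 𝓝[>] 0, ∀ i a, 0 ≤ c i a + ε * u i a := by
    refine eventually_all.2 fun i => eventually_all.2 fun a => ?_
    rcases lt_or_ge (u i a) 0 with hneg | hnn
    · have hpos : 0 < c i a := lt_of_le_of_ne (hc.1 i a) (hcon i a hneg).symm
      have hcont : Continuous fun ε : ℝ => c i a + ε * u i a := by fun_prop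
      have := (hcont.tendsto 0).eventually (lt_mem_nhds (by simpa using hpos))
      exact (this.filter_mono nhdsWithin_le_nhds).mono fun ε hε => hε.le
    · filter_upwards [self_mem_nhdsWithin] with ε hε
      exact add_nonneg (hc.1 i a) (mul_nonneg (le_of_lt hε) hnn)
  obtain ⟨ε, hε, hε0⟩ := (hev.and self_mem_nhdsWithin).exists
  have h := hmin (fun i a => c i a + ε * u i a) ⟨hε, by simp, fun i => by
    rw [Finset.sum_add_distrib, ← Finset.mul_sum, hu, hc.2.2, mul_zero, add_zero]⟩ (by
    have : weightedPoint t (fun i a => c i a + ε * u i a) =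
        weightedPoint t c + ε • weightedPoint t u := by
      simp only [weightedPoint, add_smul, Finset.sum_add_distrib, Finset.smul_sum, mul_smul]
    rw [this, hut, smul_zero, add_zero])
  simp only [add_mul, Finset.sum_add_distrib, mul_assoc, ← Finset.mul_sum] at h
  nlinarith

end Subdivision

/-! ### The integer data of the subdivision -/

/-- A cell of the mixed subdivision, with the supporting affine function, scaled by `den`. -/
structure MixedCell where
  sel : Fin 3 → Finset (Fin 4)
  den : ℤ
  normal : Fin 3 → ℤ
  height : Fin 3 → ℤ

/-- The lifting weights of the vertices of the three tetrahedra. -/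
def liftWeight : Fin 3 → Fin 4 → ℤ := ![![8, 17, 14, 17], ![14, 0, 12, 10], ![5, 8, 15, 0]]

/-- The cells of the mixed subdivision of `polytopeP`. -/
def mixedCell : Fin 18 → MixedCell :=
  ![⟨![{0}, {1}, {0, 1, 2, 3}], 9, ![-17, 7, -47], ![72, -27, 45]⟩,
    ⟨![{0}, {0, 1, 2, 3}, {0}], 1, ![-4, -2, 2], ![8, 14, 5]⟩,
    ⟨![{0, 1, 2, 3}, {1}, {1}], 1, ![3, 6, 3], ![8, -15, -7]⟩,
    ⟨![{0}, {1, 3}, {0, 2, 3}], 9, ![-20, -5, -50], ![72, 0, 45]⟩,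
    ⟨![{2}, {1, 2}, {0, 1, 3}], 9, ![13, 37, 73], ![40, -27, 45]⟩,
    ⟨![{0}, {1, 2, 3}, {0, 3}], 9, ![-11, -23, 13], ![72, 81, 45]⟩,
    ⟨![{0, 1}, {1}, {1, 2, 3}], 12, ![38, 70, -93], ![96, -309, -213]⟩,
    ⟨![{0, 2}, {1}, {0, 1, 3}], 15, ![11, 51, 79], ![120, -45, 75]⟩,
    ⟨![{0, 2}, {1, 2, 3}, {3}], 1, ![6, -4, 0], ![8, -4, -34]⟩,
    ⟨![{0, 3}, {0, 1, 2}, {0}], 4, ![-25, 10, 26], ![32, 56, 20]⟩,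
    ⟨![{0, 1, 2}, {1}, {1, 3}], 6, ![19, 35, 17], ![48, -91, -43]⟩,
    ⟨![{0, 2, 3}, {1}, {0, 1}], 5, ![3, 18, 27], ![40, -15, 25]⟩,
    ⟨![{0, 1, 2}, {1, 3}, {3}], 1, ![13, -4, -7], ![8, -25, -76]⟩,
    ⟨![{0, 2, 3}, {1, 2}, {0}], 2, ![-1, 5, 13], ![16, 5, 10]⟩,
    ⟨![{0, 1}, {1, 3}, {2, 3}], 9, ![86, -5, -156], ![72, -318, -591]⟩,
    ⟨![{0, 2}, {1, 2}, {0, 3}], 7, ![3, 11, 39], ![56, 11, 35]⟩,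
    ⟨![{0, 2}, {2, 3}, {0, 3}], 1, ![-7, -43, 13], ![8, -43, 5]⟩,
    ⟨![{2, 3}, {1, 2}, {0, 1}], 3, ![4, 13, 25], ![13, -9, 15]⟩]

/-- Affine relations between the vertices that decrease the lifting weight. -/
def liftRelation : Fin 15 → Fin 3 → Fin 4 → ℤ :=
  ![![![9, -12, 0, 3], ![-6, 5, 1, 0], ![0, 0, 0, 0]],
    ![![9, 0, -12, 3], ![-6, 1, 5, 0], ![0, 0, 0, 0]],
    ![![0, -3, 3, 0], ![0, 1, -1, 0], ![0, 0, 0, 0]],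
    ![![9, 0, 0, -9], ![2, 1, 1, -4], ![0, 0, 0, 0]],
    ![![3, -5, 1, 1], ![0, 0, 0, 0], ![-2, 2, 0, 0]],
    ![![27, 0, -27, 0], ![0, -1, 8, -7], ![-4, 0, 0, 4]],
    ![![0, 0, 0, 0], ![-1, 1, 0, 0], ![1, -1, 0, 0]],
    ![![-9, 0, 9, 0], ![0, 5, -5, 0], ![6, -7, 0, 1]],
    ![![0, 0, 0, 0], ![0, 1, 0, -1], ![1, -2, 1, 0]],
    ![![9, 3, -12, 0], ![0, 0, 0, 0], ![0, 1, -6, 5]],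
    ![![9, 3, 0, -12], ![0, 0, 0, 0], ![0, 5, -6, 1]],
    ![![0, 0, 0, 0], ![-2, 1, 0, 1], ![1, 0, -1, 0]],
    ![![0, 0, 0, 0], ![0, 1, -2, 1], ![1, 0, -3, 2]],
    ![![0, 0, 3, -3], ![0, 0, 0, 0], ![0, 1, 0, -1]],
    ![![0, 0, 0, 0], ![-3, 1, 1, 1], ![1, 0, 0, -1]]]

theorem mixedCell_den_pos : ∀ k, 0 < (mixedCell k).den := by
  decide +kernel

theorem mixedCell_le : ∀ k i a, idot (mixedCell k).normal (tetVertex i a) + (mixedCell k).height i ≤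
    (mixedCell k).den * liftWeight i a := by
  decide +kernel

theorem mixedCell_eq : ∀ k i, ∀ a ∈ (mixedCell k).sel i,
    idot (mixedCell k).normal (tetVertex i a) + (mixedCell k).height i =
    (mixedCell k).den * liftWeight i a := by
  decide +kernel

theorem mixedCell_normal_injective : ∀ k k',
    (mixedCell k').den • (mixedCell k).normal = (mixedCell k).den • (mixedCell k').normal →
      k = k' := by
  decide +kernel

theorem liftRelation_affine : ∀ r, (∀ i, ∑ a, liftRelation r i a = 0) ∧
    ∑ i, ∑ a, liftRelation r i a • tetVertex i a = 0 ∧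
    ∑ i, ∑ a, liftRelation r i a * liftWeight i a < 0 := by
  decide +kernel

/-- The sets are the possible supports of a minimal representation. In the first alternative a
weight-decreasing relation can be applied, so minimality fails; otherwise the support fits into a
cell. This replaces any geometric argument that the cells cover. -/
theorem mixedCell_cover : ∀ S₀ S₁ S₂ : Finset (Fin 4), S₀.Nonempty → S₁.Nonempty → S₂.Nonempty →
    (∃ r, ∀ i a, liftRelation r i a < 0 → a ∈ (![S₀, S₁, S₂] : Fin 3 → Finset (Fin 4)) i) ∨
    ∃ k, ∀ i, (![S₀, S₁, S₂] : Fin 3 → Finset (Fin 4)) i ⊆ (mixedCell k).sel i := by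
  decide +kernel

/-! ### Cells as sums of simplices, triangles, segments and points -/

section Piece

variable {α : Type*}

/-- The dilate by `r` of the convex hull of the points `t a`, `a ∈ S`. -/
def piece (t : α → Space) (r : ℝ) (S : Finset α) : Set Space :=
  {x | ∃ c : α → ℝ, (∀ a ∈ S, 0 ≤ c a) ∧ ∑ a ∈ S, c a = r ∧ ∑ a ∈ S, c a • t a = x}

theorem mink_eq_sum_piece {ι : Type*} [Fintype ι] [Fintype α] (t : ι → α → Space)
    (lam : ι → ℝ) (M : ι → Finset α) : mink t lam M = ∑ i, piece (t i) (lam i) (M i) := by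
  classical
  ext x
  rw [Set.mem_fintype_sum]
  constructor
  · rintro ⟨c, ⟨h0, h1, h2⟩, rfl⟩
    refine ⟨fun i => ∑ a, c i a • t i a, fun i => ⟨c i, fun a _ => h0 i a, ?_, ?_⟩, rfl⟩
    · rw [← h2 i]
      exact Finset.sum_subset (Finset.subset_univ _) fun a _ ha => h1 i a ha
    · exact Finset.sum_subset (Finset.subset_univ _) fun a _ ha => by rw [h1 i a ha, zero_smul]
  · rintro ⟨g, hg, rfl⟩
    choose c h0 h1 h2 using hg
    refine ⟨fun i a => if a ∈ M i then c i a else 0, ⟨?_, ?_, ?_⟩, ?_⟩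
    · intro i a
      dsimp only
      split_ifs with h
      exacts [h0 i a h, le_rfl]
    · intro i a ha
      simp [ha]
    · intro i
      rw [← h1 i, Finset.sum_ite_mem, Finset.univ_inter]
    · refine Finset.sum_congr rfl fun i _ => ?_
      rw [← h2 i]
      simp only [ite_smul, zero_smul]
      rw [Finset.sum_ite_mem, Finset.univ_inter]

theorem piece_univ [Fintype α] {t : α → Space} {r : ℝ} (hr : 0 < r) :
    piece t r Finset.univ = r • convexHull ℝ (Set.range t) := by
  ext x
  rw [mem_smul_convexHull_range_iff hr]
  simp [piece]

theorem piece_singleton (t : α → Space) {r : ℝ} (hr : 0 ≤ r) (a : α) :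
    piece t r {a} = {r • t a} := by
  ext x
  simp only [piece, Finset.mem_singleton, forall_eq, Finset.sum_singleton, Set.mem_ofPred_eq,
    Set.mem_singleton_iff]
  constructor
  · rintro ⟨c, -, rfl, rfl⟩
    rfl
  · rintro rfl
    exact ⟨fun _ => r, hr, rfl, rfl⟩

theorem piece_pair [DecidableEq α] (t : α → Space) {r : ℝ} (hr : 0 < r) {a b : α} (hab : a ≠ b) :
    piece t r {a, b} = seg (r • t a) (r • (t b - t a)) := by
  ext x
  simp only [piece, Finset.mem_insert, Finset.mem_singleton, forall_eq_or_imp, forall_eq,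
    Finset.sum_pair hab, seg, Set.mem_ofPred_eq]
  constructor
  · rintro ⟨c, ⟨h0, h1⟩, hs, rfl⟩
    refine ⟨c b / r, by positivity, (div_le_one hr).2 (by linarith), ?_⟩
    rw [smul_smul, div_mul_cancel₀ _ hr.ne', ← hs]
    module
  · rintro ⟨s, h0, h1, rfl⟩
    refine ⟨fun x => if x = a then r * (1 - s) else r * s, ?_, ?_, ?_⟩
    · simp only [if_true, if_neg hab.symm]
      exact ⟨mul_nonneg hr.le (by linarith), by positivity⟩
    · simp only [if_true, if_neg hab.symm]
      ring
    · simp only [if_true, if_neg hab.symm]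
      module

theorem piece_triple [DecidableEq α] (t : α → Space) {r : ℝ} (hr : 0 < r) {a b c : α}
    (hab : a ≠ b) (hac : a ≠ c) (hbc : b ≠ c) :
    piece t r {a, b, c} = tri (r • t a) (r • (t b - t a)) (r • (t c - t a)) := by
  have ha : a ∉ ({b, c} : Finset α) := by simp [hab, hac]
  ext x
  simp only [piece, Finset.mem_insert, Finset.mem_singleton, forall_eq_or_imp, forall_eq,
    Finset.sum_insert ha, Finset.sum_pair hbc, tri, Set.mem_ofPred_eq]
  constructor
  · rintro ⟨d, ⟨h0, h1, h2⟩, hs, rfl⟩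
    refine ⟨d b / r, d c / r, by positivity, by positivity, ?_, ?_⟩
    · rw [← add_div]
      exact (div_le_one hr).2 (by linarith)
    · rw [smul_smul, smul_smul, div_mul_cancel₀ _ hr.ne', div_mul_cancel₀ _ hr.ne', ← hs]
      module
  · rintro ⟨s, s', h0, h1, h2, rfl⟩
    refine ⟨fun x => if x = a then r * (1 - s - s') else if x = b then r * s else r * s',
      ?_, ?_, ?_⟩
    · simp only [if_true, if_neg hab.symm, if_neg hac.symm, if_neg hbc.symm]
      exact ⟨mul_nonneg hr.le (by linarith), by positivity, by positivity⟩
    · simp only [if_true, if_neg hab.symm, if_neg hac.symm, if_neg hbc.symm]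
      ring
    · simp only [if_true, if_neg hab.symm, if_neg hac.symm, if_neg hbc.symm]
      module

end Piece

theorem det3_smul (r s t : ℤ) (u v w : Fin 3 → ℤ) :
    det3 (r • u) (s • v) (t • w) = r * s * t * det3 u v w := by
  simp [det3]; ring

/-- The dilate by `r` of a lattice polytope given by some of the points `v a`. -/
noncomputable def intPiece {α : Type*} (v : α → Fin 3 → ℤ) (r : ℤ) (S : Finset α) : Set Space :=
  piece (fun a => intPoint (v a)) r S

theorem intPiece_singleton {α : Type*} (v : α → Fin 3 → ℤ) {r : ℤ} (hr : 0 < r) (a : α) :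
    intPiece v r {a} = {intPoint (r • v a)} := by
  rw [intPiece, piece_singleton _ (by exact_mod_cast hr.le), intPoint_smul]

section IntPiece

variable {α : Type*} [DecidableEq α] (v v' v'' : α → Fin 3 → ℤ) {r r' r'' : ℤ}

theorem intPiece_pair (hr : 0 < r) {a b : α} (hab : a ≠ b) :
    intPiece v r {a, b} = seg (intPoint (r • v a)) (intPoint (r • (v b - v a))) := by
  rw [intPiece, piece_pair _ (by exact_mod_cast hr) hab, intPoint_smul, intPoint_smul, intPoint_sub]

theorem intPiece_triple (hr : 0 < r) {a b c : α} (hab : a ≠ b) (hac : a ≠ c) (hbc : b ≠ c) :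
    intPiece v r {a, b, c} =
      tri (intPoint (r • v a)) (intPoint (r • (v b - v a))) (intPoint (r • (v c - v a))) := by
  rw [intPiece, piece_triple _ (by exact_mod_cast hr) hab hac hbc, intPoint_smul, intPoint_smul,
    intPoint_smul, intPoint_sub, intPoint_sub]

theorem volumeDefect_intPiece_prism (hr : 0 < r) (hr' : 0 < r') {a b c d e : α} (p : Fin 3 → ℤ)
    (hab : a ≠ b) (hac : a ≠ c) (hbc : b ≠ c) (hde : d ≠ e)
    (h : det3 (v b - v a) (v c - v a) (v' e - v' d) ≠ 0) :
    volumeDefect (intPiece v r {a, b, c} + intPiece v' r' {d, e} + {intPoint p}) = 0 := by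
  rw [intPiece_triple v hr hab hac hbc, intPiece_pair v' hr' hde]
  refine volumeDefect_prism_sum ?_
  rw [det3_smul]
  exact mul_ne_zero (mul_ne_zero (mul_ne_zero hr.ne' hr.ne') hr'.ne') h

theorem volumeDefect_intPiece_box (hr : 0 < r) (hr' : 0 < r') (hr'' : 0 < r'') {a b c d e f : α}
    (hab : a ≠ b) (hcd : c ≠ d) (hef : e ≠ f)
    (h : det3 (v b - v a) (v' d - v' c) (v'' f - v'' e) ≠ 0) :
    volumeDefect (intPiece v r {a, b} + intPiece v' r' {c, d} + intPiece v'' r'' {e, f}) = 0 := by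
  rw [intPiece_pair v hr hab, intPiece_pair v' hr' hcd, intPiece_pair v'' hr'' hef]
  refine volumeDefect_box ?_
  rw [det3_smul]
  exact mul_ne_zero (mul_ne_zero (mul_ne_zero hr.ne' hr'.ne') hr''.ne') h

end IntPiece

theorem tetScale_pos (i : Fin 3) : 0 < tetScale i := by
  fin_cases i <;> simp [tetScale]

/-- The functional supporting the `k`-th cell. -/
noncomputable def cellFunctional (k : Fin 18) : Space →ₗ[ℝ] ℝ :=
  ((mixedCell k).den : ℝ)⁻¹ • (innerₛₗ ℝ (intPoint (mixedCell k).normal))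

theorem isDissection_polytopeP :
    IsDissection polytopeP fun k => mink tetPoint scaleReal (mixedCell k).sel := by
  have hden : ∀ k, (0 : ℝ) < (mixedCell k).den := fun k => by exact_mod_cast mixedCell_den_pos k
  have hval : ∀ k i a, cellFunctional k (tetPoint i a) +
      ((mixedCell k).height i : ℝ) / (mixedCell k).den =
      ((idot (mixedCell k).normal (tetVertex i a) + (mixedCell k).height i : ℤ) : ℝ) /
        (mixedCell k).den := by
    intro k i a
    rw [cellFunctional, LinearMap.smul_apply, innerₛₗ_apply_apply, tetPoint, inner_intPoint,
      smul_eq_mul]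
    push_cast
    ring
  rw [polytopeP_eq_mink]
  refine isDissection_mink (w := fun i a => (liftWeight i a : ℝ)) (l := cellFunctional)
    (h := fun k i => ((mixedCell k).height i : ℝ) / (mixedCell k).den) ?_ ?_ ?_ ?_
  · intro k i a
    rw [hval, div_le_iff₀ (hden k), mul_comm]
    exact_mod_cast mixedCell_le k i a
  · intro k i a ha
    rw [hval, div_eq_iff (hden k).ne', mul_comm]
    exact_mod_cast mixedCell_eq k i a ha
  · intro k k' hkk
    refine mixedCell_normal_injective k k' (intPoint_injective ?_)
    rw [intPoint_smul, intPoint_smul]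
    have h1 : ∀ x, inner ℝ (((mixedCell k').den : ℝ) • intPoint (mixedCell k).normal) x =
        inner ℝ (((mixedCell k).den : ℝ) • intPoint (mixedCell k').normal) x := by
      intro x
      have := LinearMap.congr_fun hkk x
      simp only [cellFunctional, LinearMap.smul_apply, innerₛₗ_apply_apply, smul_eq_mul] at this
      have h1 := hden k
      have h2 := hden k'
      rw [real_inner_smul_left, real_inner_smul_left]
      field_simp at this
      linarith
    exact ext_inner_right ℝ h1
  · intro c hc hmin
    have hne : ∀ i, (Finset.univ.filter fun a => c i a ≠ 0).Nonempty := by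
      intro i
      by_contra h
      rw [Finset.not_nonempty_iff_eq_empty, Finset.filter_eq_empty_iff] at h
      have h2 := hc.2.2 i
      rw [Finset.sum_eq_zero fun a ha => not_not.1 (h ha)] at h2
      exact (scaleReal_pos i).ne h2
    rcases mixedCell_cover _ _ _ (hne 0) (hne 1) (hne 2) with ⟨ρ, hρ⟩ | ⟨k, hk⟩
    · exfalso
      obtain ⟨h1, h2, h3⟩ := liftRelation_affine ρ
      obtain ⟨i, a, hneg, h0⟩ := exists_eq_zero_of_minimal hc hmin
        (u := fun i a => (liftRelation ρ i a : ℝ)) (fun i => by exact_mod_cast h1 i)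
        (by
          have : weightedPoint tetPoint (fun i a => (liftRelation ρ i a : ℝ)) =
              intPoint (∑ i, ∑ a, liftRelation ρ i a • tetVertex i a) := by
            ext j
            simp [weightedPoint, tetPoint]
          rw [this, h2]
          ext j
          simp)
        (by exact_mod_cast h3)
      have hmem := hρ i a (by exact_mod_cast hneg)
      fin_cases i <;> simp_all
    · refine ⟨k, fun i a ha => hk i ?_⟩
      fin_cases i <;> simpa using ha

theorem mink_tetPoint_eq (M : Fin 3 → Finset (Fin 4)) : mink tetPoint scaleReal M =
    intPiece (tetVertex 0) (tetScale 0) (M 0) + intPiece (tetVertex 1) (tetScale 1) (M 1) +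
      intPiece (tetVertex 2) (tetScale 2) (M 2) := by
  rw [mink_eq_sum_piece, Fin.sum_univ_three]
  rfl

theorem singleton_add_eq_vadd (x : Space) (X : Set Space) : {x} + X = x +ᵥ X :=
  Set.singleton_add

/-- The tetrahedron with vertices `v a`. -/
noncomputable def intSimplex (v : Fin 4 → Fin 3 → ℤ) : Set Space :=
  convexHull ℝ (Set.range fun a => intPoint (v a))

theorem intPiece_univ (v : Fin 4 → Fin 3 → ℤ) {r : ℤ} (hr : 0 < r) :
    intPiece v r Finset.univ = (r : ℝ) • intSimplex v :=
  piece_univ (by exact_mod_cast hr)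

theorem isBody_intSimplex (v : Fin 4 → Fin 3 → ℤ) : IsBody (intSimplex v) :=
  ⟨convex_convexHull _ _, (Set.finite_range _).isCompact_convexHull ℝ⟩

theorem IsBody.smul {X : Set Space} (hX : IsBody X) (r : ℝ) : IsBody (r • X) :=
  ⟨hX.convex.smul r, hX.compact.smul r⟩

/-! ### Dilates of a lattice tetrahedron -/

/-- The functional with value `min a k` on the edge from vertex `0` to vertex `a`. -/
noncomputable def minFunctional {v : Fin 4 → Fin 3 → ℤ}
    (h : det3 (v 1 - v 0) (v 2 - v 0) (v 3 - v 0) ≠ 0) (k : Fin 4) : Space →ₗ[ℝ] ℝ :=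
  ∑ i : Fin 3, ((min i.succ k : Fin 4) : ℕ) • (intBasis h).coord i

theorem minFunctional_apply {v : Fin 4 → Fin 3 → ℤ}
    (h : det3 (v 1 - v 0) (v 2 - v 0) (v 3 - v 0) ≠ 0) (k a : Fin 4) :
    minFunctional h k (intPoint (v a)) =
      minFunctional h k (intPoint (v 0)) + ((min a k : Fin 4) : ℕ) := by
  have hb : ∀ i : Fin 3, intPoint (v i.succ) - intPoint (v 0) = intBasis h i := by
    intro i
    rw [coe_intBasis, ← intPoint_sub]
    fin_cases i <;> rfl
  rw [← sub_eq_iff_eq_add', ← map_sub]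
  refine Fin.cases ?_ (fun i => ?_) a
  · simp
  · rw [hb]
    simp [minFunctional, Finsupp.single_apply]

/-- Lift the second summand by the vertex index and leave the first at height zero. If a minimal
representation used `a` in the first and `b` in the second with `a < b`, exchanging a little of them
would lower the weight; so the support of the second lies below that of the first. -/
theorem isDissection_smul_intSimplex {v : Fin 4 → Fin 3 → ℤ}
    (h : det3 (v 1 - v 0) (v 2 - v 0) (v 3 - v 0) ≠ 0) (lam : Fin 2 → ℝ) (hlam : ∀ i, 0 < lam i) :
    IsDissection (mink (fun _ a => intPoint (v a)) lam fun _ => Finset.univ) fun k : Fin 4 =>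
      mink (fun _ a => intPoint (v a)) lam ![Finset.Ici k, Finset.Iic k] := by
  refine isDissection_mink (w := ![0, fun a => ((a : ℕ) : ℝ)]) (l := minFunctional h)
    (h := fun k => ![-minFunctional h k (intPoint (v 0)) - ((k : ℕ) : ℝ),
      -minFunctional h k (intPoint (v 0))]) ?_ ?_ ?_ ?_
  · intro k i a
    rw [minFunctional_apply]
    have h1 : (((min a k : Fin 4) : ℕ) : ℝ) ≤ ((a : ℕ) : ℝ) := by
      exact_mod_cast Fin.le_def.1 (min_le_left a k)
    have h2 : (((min a k : Fin 4) : ℕ) : ℝ) ≤ ((k : ℕ) : ℝ) := by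
      exact_mod_cast Fin.le_def.1 (min_le_right a k)
    fin_cases i
    · change _ + (-_ - _) ≤ (0 : ℝ)
      linarith
    · change _ + -_ ≤ ((a : ℕ) : ℝ)
      linarith
  · intro k i a
    rw [minFunctional_apply]
    fin_cases i
    · intro ha
      rw [min_eq_right (Finset.mem_Ici.1 ha)]
      change _ + (-_ - _) = (0 : ℝ)
      ring
    · intro ha
      rw [min_eq_left (Finset.mem_Iic.1 ha)]
      change _ + -_ = ((a : ℕ) : ℝ)
      ring
  · intro k k' hk
    have h1 := minFunctional_apply h k 3
    have h2 := minFunctional_apply h k' 3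
    rw [show min 3 k = k from min_eq_right (Fin.le_last k)] at h1
    rw [show min 3 k' = k' from min_eq_right (Fin.le_last k')] at h2
    rw [hk, h2] at h1
    have : (k' : ℕ) = (k : ℕ) := by exact_mod_cast add_left_cancel h1
    exact (Fin.ext this).symm
  · intro c hc hmin
    have hle : ∀ a b, c 0 a ≠ 0 → c 1 b ≠ 0 → b ≤ a := by
      intro a b ha hb
      by_contra hlt
      rw [not_le] at hlt
      obtain ⟨i, x, hneg, h0⟩ := exists_eq_zero_of_minimal hc hmin
        (u := ![Pi.single b 1 - Pi.single a 1, Pi.single a 1 - Pi.single b 1])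
        (by intro i; fin_cases i <;> simp)
        (by
          simp only [weightedPoint, Fin.sum_univ_two, Matrix.cons_val_zero, Matrix.cons_val_one,
            Pi.sub_apply, sub_smul, Finset.sum_sub_distrib]
          abel)
        (by
          simp only [Fin.sum_univ_two, Matrix.cons_val_zero, Matrix.cons_val_one,
            Pi.sub_apply, sub_mul, Finset.sum_sub_distrib]
          have h3 : ∀ d : Fin 4, ∑ x, (Pi.single d 1 : Fin 4 → ℝ) x * ((x : ℕ) : ℝ) =
              ((d : ℕ) : ℝ) := by
            intro d
            simp [Pi.single_apply]
          rw [h3, h3]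
          simpa using hlt)
      fin_cases i
      · simp only [Fin.zero_eta, Matrix.cons_val_zero, Pi.sub_apply, Pi.single_apply] at hneg
        by_cases hx : x = a
        · exact ha (hx ▸ h0)
        · rw [if_neg hx] at hneg
          split_ifs at hneg <;> norm_num at hneg
      · simp only [Fin.mk_one, Matrix.cons_val_one, Matrix.cons_val_zero, Pi.sub_apply,
          Pi.single_apply] at hneg
        by_cases hx : x = b
        · exact hb (hx ▸ h0)
        · rw [if_neg hx] at hneg
          split_ifs at hneg <;> norm_num at hneg
    have hne : (Finset.univ.filter fun a => c 0 a ≠ 0).Nonempty := by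
      by_contra hn
      rw [Finset.not_nonempty_iff_eq_empty, Finset.filter_eq_empty_iff] at hn
      have h2 := hc.2.2 0
      rw [Finset.sum_eq_zero fun a ha => not_not.1 (hn ha)] at h2
      exact (hlam 0).ne h2
    -- The cell is that of the smallest vertex used in the first summand.
    obtain ⟨k, hk, hkmin⟩ := Finset.exists_min_image _ id hne
    simp only [Finset.mem_filter, Finset.mem_univ, true_and, id] at hk hkmin
    refine ⟨k, fun i a ha => ?_⟩
    fin_cases i
    · simpa using hkmin a ha
    · simpa using hle k a hk ha

/-- In the dissection of (n+1)T = nT + T, the outer cells are translates of nT and T, and the two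
middle cells are prisms with defect zero. -/
theorem volumeDefect_smul_intSimplex {v : Fin 4 → Fin 3 → ℤ}
    (h : det3 (v 1 - v 0) (v 2 - v 0) (v 3 - v 0) ≠ 0) {n : ℕ} (hn : 1 ≤ n) :
    volumeDefect ((n : ℝ) • intSimplex v) = n * volumeDefect (intSimplex v) := by
  induction n, hn using Nat.le_induction with
  | base => simp
  | succ n hn ih =>
    have hn0 : (0 : ℤ) < n := by exact_mod_cast hn
    set lam : Fin 2 → ℝ := fun i => ((![(n : ℤ), 1] i : ℤ) : ℝ) with hlam
    have hsum : ∀ M : Fin 2 → Finset (Fin 4), mink (fun _ a => intPoint (v a)) lam M =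
        intPiece v n (M 0) + intPiece v 1 (M 1) := by
      intro M
      rw [mink_eq_sum_piece, Fin.sum_univ_two]
      rfl
    have hd := (isDissection_smul_intSimplex h lam (by
      intro i; fin_cases i
      · simp [hlam]; omega
      · simp [hlam])).volumeDefect_eq
    simp only [hsum, Fin.sum_univ_four, Matrix.cons_val_zero, Matrix.cons_val_one] at hd
    have e : (intPiece v n Finset.univ + intPiece v 1 Finset.univ) =
        ((n + 1 : ℕ) : ℝ) • intSimplex v := by
      rw [intPiece_univ v hn0, intPiece_univ v one_pos]
      push_cast
      rw [(isBody_intSimplex v).convex.add_smul (by positivity) zero_le_one]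
    rw [e] at hd
    rw [hd]
    have c0 : volumeDefect (intPiece v n (Finset.Ici 0) + intPiece v 1 (Finset.Iic 0)) =
        n * volumeDefect (intSimplex v) := by
      rw [show (Finset.Ici 0 : Finset (Fin 4)) = Finset.univ by decide,
        show (Finset.Iic 0 : Finset (Fin 4)) = {0} by decide, intPiece_univ v hn0,
        intPiece_singleton v one_pos, add_comm, singleton_add_eq_vadd,
        ((isBody_intSimplex v).smul _).volumeDefect_vadd]
      exact ih
    have c1 : volumeDefect (intPiece v n (Finset.Ici 1) + intPiece v 1 (Finset.Iic 1)) = 0 := by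
      rw [show (Finset.Ici 1 : Finset (Fin 4)) = {1, 2, 3} by decide,
        show (Finset.Iic 1 : Finset (Fin 4)) = {0, 1} by decide]
      have := volumeDefect_intPiece_prism v v hn0 one_pos (a := 1) (b := 2) (c := 3) (d := 0)
        (e := 1) 0 (by decide) (by decide) (by decide) (by decide) (by
          convert h using 1
          simp [det3]; ring)
      rwa [show ({intPoint 0} : Set Space) = 0 by ext; simp [intPoint]; rfl, add_zero] at this
    have c2 : volumeDefect (intPiece v n (Finset.Ici 2) + intPiece v 1 (Finset.Iic 2)) = 0 := by
      rw [show (Finset.Ici 2 : Finset (Fin 4)) = {2, 3} by decide,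
        show (Finset.Iic 2 : Finset (Fin 4)) = {0, 1, 2} by decide, add_comm]
      have := volumeDefect_intPiece_prism v v one_pos hn0 (a := 0) (b := 1) (c := 2) (d := 2)
        (e := 3) 0 (by decide) (by decide) (by decide) (by decide) (by
          convert h using 1
          simp [det3]; ring)
      rwa [show ({intPoint 0} : Set Space) = 0 by ext; simp [intPoint]; rfl, add_zero] at this
    have c3 : volumeDefect (intPiece v n (Finset.Ici 3) + intPiece v 1 (Finset.Iic 3)) =
        volumeDefect (intSimplex v) := by
      rw [show (Finset.Ici 3 : Finset (Fin 4)) = {3} by decide,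
        show (Finset.Iic 3 : Finset (Fin 4)) = Finset.univ by decide, intPiece_univ v one_pos,
        intPiece_singleton v hn0, singleton_add_eq_vadd,
        ((isBody_intSimplex v).smul _).volumeDefect_vadd]
      simp
    rw [c0, c1, c2, c3]
    push_cast
    ring

/-! ### The defect of the polytope from its cells -/

theorem mink_tetPoint_perm {i j k : Fin 3} (hij : i ≠ j) (hik : i ≠ k) (hjk : j ≠ k)
    (M : Fin 3 → Finset (Fin 4)) : mink tetPoint scaleReal M =
    intPiece (tetVertex i) (tetScale i) (M i) + intPiece (tetVertex j) (tetScale j) (M j) +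
      intPiece (tetVertex k) (tetScale k) (M k) := by
  have h : (Finset.univ : Finset (Fin 3)) = {i, j, k} := by
    revert i j k
    decide
  rw [mink_eq_sum_piece, h, Finset.sum_insert (by simp [hij, hik]), Finset.sum_pair hjk, add_assoc]
  rfl

theorem volumeDefect_mink_prism {M : Fin 3 → Finset (Fin 4)} (i j k : Fin 3) (a b c d e g : Fin 4)
    (hij : i ≠ j ∧ i ≠ k ∧ j ≠ k) (hM : M i = {a, b, c} ∧ M j = {d, e} ∧ M k = {g})
    (hne : a ≠ b ∧ a ≠ c ∧ b ≠ c ∧ d ≠ e)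
    (h : det3 (tetVertex i b - tetVertex i a) (tetVertex i c - tetVertex i a)
      (tetVertex j e - tetVertex j d) ≠ 0) : volumeDefect (mink tetPoint scaleReal M) = 0 := by
  rw [mink_tetPoint_perm hij.1 hij.2.1 hij.2.2, hM.1, hM.2.1, hM.2.2,
    intPiece_singleton _ (tetScale_pos k)]
  exact volumeDefect_intPiece_prism _ _ (tetScale_pos i) (tetScale_pos j) _ hne.1 hne.2.1 hne.2.2.1
    hne.2.2.2 h

theorem volumeDefect_mink_box {M : Fin 3 → Finset (Fin 4)} (a b c d e g : Fin 4)
    (hM : M 0 = {a, b} ∧ M 1 = {c, d} ∧ M 2 = {e, g})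
    (hne : a ≠ b ∧ c ≠ d ∧ e ≠ g)
    (h : det3 (tetVertex 0 b - tetVertex 0 a) (tetVertex 1 d - tetVertex 1 c)
      (tetVertex 2 g - tetVertex 2 e) ≠ 0) : volumeDefect (mink tetPoint scaleReal M) = 0 := by
  rw [mink_tetPoint_eq, hM.1, hM.2.1, hM.2.2]
  exact volumeDefect_intPiece_box _ _ _ (tetScale_pos 0) (tetScale_pos 1) (tetScale_pos 2) hne.1
    hne.2.1 hne.2.2 h

theorem volumeDefect_mink_simplex {M : Fin 3 → Finset (Fin 4)} (i j k : Fin 3) (a b : Fin 4)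
    (hij : i ≠ j ∧ i ≠ k ∧ j ≠ k) (hM : M i = Finset.univ ∧ M j = {a} ∧ M k = {b})
    (h : det3 (tetVertex i 1 - tetVertex i 0) (tetVertex i 2 - tetVertex i 0)
      (tetVertex i 3 - tetVertex i 0) ≠ 0) :
    volumeDefect (mink tetPoint scaleReal M) =
      tetScale i * volumeDefect (intSimplex (tetVertex i)) := by
  rw [mink_tetPoint_perm hij.1 hij.2.1 hij.2.2, hM.1, hM.2.1, hM.2.2,
    intPiece_singleton _ (tetScale_pos k), intPiece_singleton _ (tetScale_pos j),
    intPiece_univ _ (tetScale_pos i), add_assoc, Set.singleton_add_singleton, ← intPoint_add,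
    add_comm, singleton_add_eq_vadd, ((isBody_intSimplex _).smul _).volumeDefect_vadd]
  have hpos := tetScale_pos i
  obtain ⟨n, hn⟩ := Int.eq_ofNat_of_zero_le hpos.le
  rw [hn] at hpos ⊢
  exact_mod_cast volumeDefect_smul_intSimplex h (n := n) (by omega)

theorem volumeDefect_polytopeP_eq : volumeDefect polytopeP =
    5 * volumeDefect (intSimplex (tetVertex 0)) + 12 * volumeDefect (intSimplex (tetVertex 1)) +
      19 * volumeDefect (intSimplex (tetVertex 2)) := by
  have h0 : volumeDefect (mink tetPoint scaleReal (mixedCell 0).sel) =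
      19 * volumeDefect (intSimplex (tetVertex 2)) := by
    rw [volumeDefect_mink_simplex 2 0 1 0 1 (by decide) (by decide) (by decide)]
    simp [tetScale]
  have h1 : volumeDefect (mink tetPoint scaleReal (mixedCell 1).sel) =
      12 * volumeDefect (intSimplex (tetVertex 1)) := by
    rw [volumeDefect_mink_simplex 1 0 2 0 0 (by decide) (by decide) (by decide)]
    simp [tetScale]
  have h2 : volumeDefect (mink tetPoint scaleReal (mixedCell 2).sel) =
      5 * volumeDefect (intSimplex (tetVertex 0)) := by
    rw [volumeDefect_mink_simplex 0 1 2 1 1 (by decide) (by decide) (by decide)]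
    simp [tetScale]
  -- All remaining cells have defect zero: eleven prisms, triangle plus segment plus point, and four
  -- parallelepipeds with an edge from each tetrahedron.
  have h : ∀ k : Fin 15, volumeDefect (mink tetPoint scaleReal
      (mixedCell k.succ.succ.succ).sel) = 0 := by
    intro k
    fin_cases k
    · exact volumeDefect_mink_prism 2 1 0 0 2 3 1 3 0 (by decide) (by decide) (by decide) (by decide)
    · exact volumeDefect_mink_prism 2 1 0 0 1 3 1 2 2 (by decide) (by decide) (by decide) (by decide)
    · exact volumeDefect_mink_prism 1 2 0 1 2 3 0 3 0 (by decide) (by decide) (by decide) (by decide)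
    · exact volumeDefect_mink_prism 2 0 1 1 2 3 0 1 1 (by decide) (by decide) (by decide) (by decide)
    · exact volumeDefect_mink_prism 2 0 1 0 1 3 0 2 1 (by decide) (by decide) (by decide) (by decide)
    · exact volumeDefect_mink_prism 1 0 2 1 2 3 0 2 3 (by decide) (by decide) (by decide) (by decide)
    · exact volumeDefect_mink_prism 1 0 2 0 1 2 0 3 0 (by decide) (by decide) (by decide) (by decide)
    · exact volumeDefect_mink_prism 0 2 1 0 1 2 1 3 1 (by decide) (by decide) (by decide) (by decide)
    · exact volumeDefect_mink_prism 0 2 1 0 2 3 0 1 1 (by decide) (by decide) (by decide) (by decide)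
    · exact volumeDefect_mink_prism 0 1 2 0 1 2 1 3 3 (by decide) (by decide) (by decide) (by decide)
    · exact volumeDefect_mink_prism 0 1 2 0 2 3 1 2 0 (by decide) (by decide) (by decide) (by decide)
    · exact volumeDefect_mink_box 0 1 1 3 2 3 (by decide) (by decide) (by decide)
    · exact volumeDefect_mink_box 0 2 1 2 0 3 (by decide) (by decide) (by decide)
    · exact volumeDefect_mink_box 0 2 2 3 0 3 (by decide) (by decide) (by decide)
    · exact volumeDefect_mink_box 2 3 1 2 0 1 (by decide) (by decide) (by decide)
  rw [isDissection_polytopeP.volumeDefect_eq, Fin.sum_univ_succ, Fin.sum_univ_succ,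
    Fin.sum_univ_succ, Finset.sum_eq_zero fun k _ => h k]
  change volumeDefect (mink tetPoint scaleReal (mixedCell 0).sel) +
    (volumeDefect (mink tetPoint scaleReal (mixedCell 1).sel) +
      (volumeDefect (mink tetPoint scaleReal (mixedCell 2).sel) + 0)) = _
  rw [h0, h1, h2]
  ring

/-! ### Solid angles of wedges and trihedral cones -/

/-- The solid angle at the origin of a cone. -/
noncomputable def coneRatio (S : Set Space) : ℝ := ballRatio S 0 1

theorem coneRatio_univ : coneRatio Set.univ = 1 := by
  rw [coneRatio, ballRatio, Set.inter_univ, div_self (volumeReal_ball_pos _ one_pos).ne']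

theorem coneRatio_neg (S : Set Space) : coneRatio (-S) = coneRatio S := by
  have := ballRatio_neg S 0 1
  rwa [neg_zero] at this

theorem coneRatio_preimage (e : Space ≃ₗᵢ[ℝ] Space) (S : Set Space) :
    coneRatio (e ⁻¹' S) = coneRatio S := by
  have h : Metric.ball 0 1 ∩ e ⁻¹' S = e.toMeasurableEquiv ⁻¹' (Metric.ball 0 1 ∩ S) := by
    ext x
    simp
  simp only [coneRatio, ballRatio, h, measureReal_def]
  rw [(e.measurePreserving : MeasurePreserving e.toMeasurableEquiv _ _).measure_preimage_equiv]

/-- The closed half-space with inner normal `n`. -/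
def halfSpace (n : Space) : Set Space := {y | 0 ≤ inner ℝ n y}

theorem neg_halfSpace (n : Space) : -halfSpace n = halfSpace (-n) := by
  ext y
  simp [halfSpace]

theorem halfSpace_smul {r : ℝ} (hr : 0 < r) (n : Space) : halfSpace (r • n) = halfSpace n := by
  ext y
  simp only [halfSpace, Set.mem_ofPred_eq, real_inner_smul_left]
  exact mul_nonneg_iff_of_pos_left hr

theorem coneRatio_split (S : Set Space) {n : Space} (hn : n ≠ 0) :
    coneRatio (S ∩ halfSpace n) + coneRatio (S ∩ halfSpace (-n)) = coneRatio S := by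
  have hm : MeasurableSet (halfSpace n) :=
    (isClosed_le continuous_const (by fun_prop)).measurableSet
  have hae : (Metric.ball (0 : Space) 1 ∩ (S ∩ halfSpace (-n)) : Set Space) =ᵐ[volume]
      ((Metric.ball 0 1 ∩ S) \ halfSpace n : Set Space) := by
    have hp := volume_plane (innerₛₗ ℝ n) (fun h => hn (by
      have := LinearMap.congr_fun h n
      simpa using this)) 0
    have hp' : ∀ᵐ y : Space, inner ℝ n y ≠ 0 := by
      rw [ae_iff]
      simpa using hp
    rw [Filter.eventuallyEq_set]
    filter_upwards [hp'] with y hy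
    have hiff : 0 ≤ -inner ℝ n y ↔ ¬ 0 ≤ inner ℝ n y := by
      rw [neg_nonneg, not_le]
      exact ⟨fun h => lt_of_le_of_ne h hy, le_of_lt⟩
    simp only [Set.mem_inter_iff, Set.mem_sdiff, halfSpace, Set.mem_ofPred_eq, inner_neg_left,
      hiff, and_assoc]
  have h := measureReal_inter_add_sdiff (μ := volume) (s := Metric.ball 0 1 ∩ S) hm
    (volumeReal_ball_inter_ne_top S 0 1)
  simp only [coneRatio, ballRatio]
  rw [measureReal_congr hae, ← Set.inter_assoc, ← add_div, h]

/-- The solid angle of the wedge with inner normals `n` and `m`. -/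
noncomputable def wedgeRatio (n m : Space) : ℝ := coneRatio (halfSpace n ∩ halfSpace m)

theorem coneRatio_halfSpace {n : Space} (hn : n ≠ 0) : coneRatio (halfSpace n) = 1 / 2 := by
  have h := coneRatio_split Set.univ hn
  rw [Set.univ_inter, Set.univ_inter, ← neg_halfSpace, coneRatio_neg, coneRatio_univ] at h
  linarith

theorem wedgeRatio_neg_neg (n m : Space) : wedgeRatio (-n) (-m) = wedgeRatio n m := by
  rw [wedgeRatio, ← neg_halfSpace, ← neg_halfSpace, ← Set.inter_neg, coneRatio_neg, wedgeRatio]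

theorem wedgeRatio_neg_right {n m : Space} (hn : n ≠ 0) (hm : m ≠ 0) :
    wedgeRatio n (-m) = 1 / 2 - wedgeRatio n m := by
  rw [← coneRatio_halfSpace hn, ← coneRatio_split (halfSpace n) hm, wedgeRatio, wedgeRatio]
  ring

/-- Girard's formula. Each of three wedges is split by the remaining plane; the alternating sum
cancels the intermediate cones, and the antipodal cone has the same measure, so twice the trihedral
ratio remains. -/
theorem coneRatio_three {n m p : Space} (hn : n ≠ 0) (hm : m ≠ 0) (hp : p ≠ 0) :
    coneRatio (halfSpace n ∩ halfSpace m ∩ halfSpace p) =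
      (wedgeRatio n m + wedgeRatio n p + wedgeRatio m p - 1 / 2) / 2 := by
  have h1 := coneRatio_split (halfSpace n ∩ halfSpace m) hp
  have h2 := coneRatio_split (halfSpace m ∩ halfSpace (-p)) hn
  have h3 := coneRatio_split (halfSpace (-n) ∩ halfSpace (-p)) hm
  have h4 := wedgeRatio_neg_right hm hp
  have h5 := wedgeRatio_neg_neg n p
  have h6 : coneRatio (halfSpace (-n) ∩ halfSpace (-p) ∩ halfSpace (-m)) =
      coneRatio (halfSpace n ∩ halfSpace m ∩ halfSpace p) := by
    rw [← coneRatio_neg]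
    simp only [Set.inter_neg, neg_halfSpace, neg_neg]
    rw [Set.inter_right_comm]
  have h7 : halfSpace m ∩ halfSpace (-p) ∩ halfSpace n =
      halfSpace n ∩ halfSpace m ∩ halfSpace (-p) := by
    rw [Set.inter_right_comm, Set.inter_comm (halfSpace m)]
  have h8 : halfSpace m ∩ halfSpace (-p) ∩ halfSpace (-n) =
      halfSpace (-n) ∩ halfSpace (-p) ∩ halfSpace m := by
    rw [Set.inter_assoc, Set.inter_comm, Set.inter_comm (halfSpace (-p))]
  rw [h7, h8] at h2
  rw [h6] at h3
  simp only [wedgeRatio] at *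
  linarith

/-- Additivity of angles. -/
theorem wedgeRatio_add_wedgeRatio {n m : Space} (hn : n ≠ 0) (hm : m ≠ 0) (h : n + m ≠ 0) :
    wedgeRatio n (n + m) + wedgeRatio m (n + m) = wedgeRatio n m + 1 / 2 := by
  have h1 := coneRatio_three hn hm h
  -- The half-space of `n + m` contains the wedge, so Girard's formula degenerates to additivity of
  -- planar angles.
  have h2 : halfSpace n ∩ halfSpace m ∩ halfSpace (n + m) = halfSpace n ∩ halfSpace m := by
    refine Set.inter_eq_left.2 fun y hy => ?_
    have h1 : 0 ≤ inner ℝ n y := hy.1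
    have h2 : 0 ≤ inner ℝ m y := hy.2
    change 0 ≤ inner ℝ (n + m) y
    rw [inner_add_left]
    exact add_nonneg h1 h2
  rw [h2, ← wedgeRatio] at h1
  linarith

/-- Two reflections suffice: one takes `u₁` to `w₁`, the next takes the image of `u₂` to `w₂`. The
second fixes `w₁`, which by equality of the inner products is orthogonal to its axis. -/
theorem exists_isometry_of_gram {u₁ u₂ w₁ w₂ : Space} (h₁ : ‖u₁‖ = ‖w₁‖) (h₂ : ‖u₂‖ = ‖w₂‖)
    (h : inner ℝ u₁ u₂ = inner ℝ w₁ w₂) : ∃ e : Space ≃ₗᵢ[ℝ] Space, e u₁ = w₁ ∧ e u₂ = w₂ := by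
  set e := (ℝ ∙ (u₁ - w₁))ᗮ.reflection
  have he : e u₁ = w₁ := Submodule.reflection_sub h₁
  set e' := (ℝ ∙ (e u₂ - w₂))ᗮ.reflection
  refine ⟨e.trans e', ?_, ?_⟩
  · rw [LinearIsometryEquiv.trans_apply, he]
    refine Submodule.reflection_mem_subspace_eq_self ?_
    rw [Submodule.mem_orthogonal_singleton_iff_inner_left, inner_sub_right, ← h, ← he,
      e.inner_map_map, sub_self]
  · rw [LinearIsometryEquiv.trans_apply]
    exact Submodule.reflection_sub (by rw [e.norm_map, h₂])

/-- Invariance under isometries replaces evaluation: wedge ratios are never computed as an angle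
over 2π, only compared for equal angles. -/
theorem wedgeRatio_congr {u₁ u₂ w₁ w₂ : Space} (hu₁ : u₁ ≠ 0) (hu₂ : u₂ ≠ 0) (hw₁ : w₁ ≠ 0)
    (hw₂ : w₂ ≠ 0) (h : InnerProductGeometry.angle u₁ u₂ = InnerProductGeometry.angle w₁ w₂) :
    wedgeRatio u₁ u₂ = wedgeRatio w₁ w₂ := by
  have hnorm : ∀ u : Space, u ≠ 0 → ‖(‖u‖⁻¹ • u)‖ = 1 := fun u hu => by
    rw [norm_smul, norm_inv, norm_norm, inv_mul_cancel₀ (norm_ne_zero_iff.2 hu)]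
  have hpos : ∀ u : Space, u ≠ 0 → 0 < ‖u‖⁻¹ := fun u hu => inv_pos.2 (norm_pos_iff.2 hu)
  have hunit : ∀ u v : Space, u ≠ 0 → v ≠ 0 →
      wedgeRatio u v = wedgeRatio (‖u‖⁻¹ • u) (‖v‖⁻¹ • v) := fun u v hu hv => by
    rw [wedgeRatio, wedgeRatio, halfSpace_smul (hpos u hu), halfSpace_smul (hpos v hv)]
  have hinner : ∀ u v : Space, inner ℝ (‖u‖⁻¹ • u) (‖v‖⁻¹ • v) =
      Real.cos (InnerProductGeometry.angle u v) := fun u v => by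
    rw [real_inner_smul_left, real_inner_smul_right, InnerProductGeometry.cos_angle]
    field_simp
  obtain ⟨e, h₁, h₂⟩ := exists_isometry_of_gram ((hnorm u₁ hu₁).trans (hnorm w₁ hw₁).symm)
    ((hnorm u₂ hu₂).trans (hnorm w₂ hw₂).symm) (by rw [hinner, hinner, h])
  rw [hunit _ _ hu₁ hu₂, hunit _ _ hw₁ hw₂, wedgeRatio, wedgeRatio,
    ← coneRatio_preimage e (halfSpace (‖w₁‖⁻¹ • w₁) ∩ _)]
  have hpre : ∀ n, e ⁻¹' halfSpace (e n) = halfSpace n := fun n => by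
    ext y
    simp [halfSpace]
  rw [Set.preimage_inter, ← h₁, ← h₂, hpre, hpre]

theorem ballRatio_cone {S : Set Space} (hS : ∀ r : ℝ, 0 < r → ∀ y ∈ S, r • y ∈ S) {ε : ℝ}
    (hε : 0 < ε) : ballRatio S 0 ε = coneRatio S := by
  have h : AffineMap.homothety (0 : Space) ε '' (Metric.ball 0 1 ∩ S) = Metric.ball 0 ε ∩ S := by
    apply Set.Subset.antisymm
    · rintro _ ⟨y, ⟨hy, hyS⟩, rfl⟩
      constructor
      · have := Set.mem_image_of_mem (AffineMap.homothety (0 : Space) ε) hy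
        rwa [image_homothety_ball _ hε, mul_one] at this
      · simpa [AffineMap.homothety_apply] using hS ε hε y hyS
    · rintro y ⟨hy, hyS⟩
      refine ⟨ε⁻¹ • y, ⟨?_, hS _ (inv_pos.2 hε) y hyS⟩, ?_⟩
      · rw [mem_ball_zero_iff] at hy ⊢
        rw [norm_smul, norm_inv, Real.norm_of_nonneg hε.le, inv_mul_lt_iff₀ hε, mul_one]
        exact hy
      · simp [AffineMap.homothety_apply, smul_inv_smul₀ hε.ne']
  have h' := image_homothety_ball (0 : Space) (ε := 1) hε
  rw [mul_one] at h'
  rw [coneRatio, ballRatio, ballRatio, ← h, ← h', volumeReal_image_homothety _ hε,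
    volumeReal_image_homothety _ hε, mul_div_mul_left _ _ (by positivity)]

theorem solidAngle_eq_coneRatio {X S : Set Space} {x : Space}
    (hS : ∀ r : ℝ, 0 < r → ∀ y ∈ S, r • y ∈ S)
    (h : ∀ᶠ y in 𝓝 x, y ∈ X ↔ y - x ∈ S) : solidAngle X x = coneRatio S := by
  obtain ⟨δ, hδ, hball⟩ := Metric.eventually_nhds_iff_ball.1 h
  refine solidAngle_eq_of_tendsto (tendsto_const_nhds.congr' ?_)
  filter_upwards [Ioo_mem_nhdsGT hδ] with ε hε
  rw [← ballRatio_cone hS hε.1, ← ballRatio_vadd S x 0 ε, add_zero, ballRatio, ballRatio]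
  congr 2
  ext y
  simp only [Set.mem_inter_iff]
  refine and_congr_right fun hy => ?_
  rw [hball y (Metric.ball_subset_ball hε.2.le hy), Set.mem_vadd_set_iff_neg_vadd_mem, vadd_eq_add,
    neg_add_eq_sub]

/-! ### Volumes of lattice tetrahedra -/

theorem volumeReal_parallelepiped_intBasis {u v w : Fin 3 → ℤ} (h : det3 u v w ≠ 0) :
    volume.real (parallelepiped (intBasis h)) = |(det3 u v w : ℝ)| := by
  have h1 := Measure.addHaar_parallelepiped stdBasis (intBasis h)
  have h2 : stdBasis.addHaar = volume := (EuclideanSpace.basisFun (Fin 3) ℝ).addHaar_eq_volume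
  rw [h2] at h1
  rw [measureReal_def, h1, ENNReal.toReal_ofReal (abs_nonneg _), coe_intBasis,
    Module.Basis.det_apply, Matrix.det_fin_three]
  congr 1
  simp [Module.Basis.toMatrix_apply, stdBasis, det3]
  ring

theorem volumeReal_intPiece_prism {α : Type*} [DecidableEq α] (v v' : α → Fin 3 → ℤ)
    {a b c d e : α} (p : Fin 3 → ℤ) (hab : a ≠ b) (hac : a ≠ c) (hbc : b ≠ c) (hde : d ≠ e)
    (h : det3 (v b - v a) (v c - v a) (v' e - v' d) ≠ 0) :
    volume.real (intPiece v 1 {a, b, c} + intPiece v' 1 {d, e} + {intPoint p}) =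
      |(det3 (v b - v a) (v c - v a) (v' e - v' d) : ℝ)| / 2 := by
  rw [intPiece_triple v one_pos hab hac hbc, intPiece_pair v' one_pos hde]
  simp only [one_smul]
  rw [prism_sum_eq h, measureReal_def, measure_vadd, ← measureReal_def, volumeReal_prism,
    volumeReal_parallelepiped_intBasis]

/-- The volume of a tetrahedron, from the dissection of its dilate by two into two translates and
two prisms. -/
theorem volumeReal_intSimplex {v : Fin 4 → Fin 3 → ℤ}
    (h : det3 (v 1 - v 0) (v 2 - v 0) (v 3 - v 0) ≠ 0) :
    volume.real (intSimplex v) = |(det3 (v 1 - v 0) (v 2 - v 0) (v 3 - v 0) : ℝ)| / 6 := by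
  set D := det3 (v 1 - v 0) (v 2 - v 0) (v 3 - v 0) with hD
  have hsum : ∀ M : Fin 2 → Finset (Fin 4),
      mink (fun _ a => intPoint (v a)) (fun _ => 1) M = intPiece v 1 (M 0) + intPiece v 1 (M 1) := by
    intro M
    rw [mink_eq_sum_piece, Fin.sum_univ_two, intPiece, intPiece, Int.cast_one]
  have hd := (isDissection_smul_intSimplex h (fun _ => 1) (by simp)).volumeReal_inter
    MeasurableSet.univ
  simp only [Set.univ_inter, hsum, Fin.sum_univ_four, Matrix.cons_val_zero,
    Matrix.cons_val_one] at hd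
  have hu : intPiece v 1 Finset.univ = intSimplex v := by
    rw [intPiece_univ v one_pos, Int.cast_one, one_smul]
  have e : volume.real (intPiece v 1 Finset.univ + intPiece v 1 Finset.univ) =
      8 * volume.real (intSimplex v) := by
    have h2 := (isBody_intSimplex v).convex.add_smul zero_le_one zero_le_one
    rw [one_smul] at h2
    rw [hu, ← h2, measureReal_def, Measure.addHaar_smul, ENNReal.toReal_mul,
      ENNReal.toReal_ofReal (abs_nonneg _), measureReal_def]
    norm_num
  have hv : ∀ z, volume.real (intPoint z +ᵥ intSimplex v) = volume.real (intSimplex v) := by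
    intro z
    rw [measureReal_def, measure_vadd, measureReal_def]
  have h0 : ({intPoint 0} : Set Space) = 0 := by
    ext
    simp [intPoint]
    rfl
  have c0 : volume.real (intPiece v 1 (Finset.Ici 0) + intPiece v 1 (Finset.Iic 0)) =
      volume.real (intSimplex v) := by
    rw [show (Finset.Ici 0 : Finset (Fin 4)) = Finset.univ by decide,
      show (Finset.Iic 0 : Finset (Fin 4)) = {0} by decide, hu, intPiece_singleton v one_pos,
      add_comm, singleton_add_eq_vadd, hv]
  have c1 : volume.real (intPiece v 1 (Finset.Ici 1) + intPiece v 1 (Finset.Iic 1)) =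
      |(D : ℝ)| / 2 := by
    have hdet : det3 (v 2 - v 1) (v 3 - v 1) (v 1 - v 0) = D := by
      simp [hD, det3]; ring
    have := volumeReal_intPiece_prism v v (a := 1) (b := 2) (c := 3) (d := 0) (e := 1) 0
      (by decide) (by decide) (by decide) (by decide) (hdet ▸ h)
    rw [show (Finset.Ici 1 : Finset (Fin 4)) = {1, 2, 3} by decide,
      show (Finset.Iic 1 : Finset (Fin 4)) = {0, 1} by decide]
    rwa [h0, add_zero, hdet] at this
  have c2 : volume.real (intPiece v 1 (Finset.Ici 2) + intPiece v 1 (Finset.Iic 2)) =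
      |(D : ℝ)| / 2 := by
    have hdet : det3 (v 1 - v 0) (v 2 - v 0) (v 3 - v 2) = D := by
      simp [hD, det3]; ring
    have := volumeReal_intPiece_prism v v (a := 0) (b := 1) (c := 2) (d := 2) (e := 3) 0
      (by decide) (by decide) (by decide) (by decide) (hdet ▸ h)
    rw [show (Finset.Ici 2 : Finset (Fin 4)) = {2, 3} by decide,
      show (Finset.Iic 2 : Finset (Fin 4)) = {0, 1, 2} by decide, add_comm]
    rwa [h0, add_zero, hdet] at this
  have c3 : volume.real (intPiece v 1 (Finset.Ici 3) + intPiece v 1 (Finset.Iic 3)) =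
      volume.real (intSimplex v) := by
    rw [show (Finset.Ici 3 : Finset (Fin 4)) = {3} by decide,
      show (Finset.Iic 3 : Finset (Fin 4)) = Finset.univ by decide, hu,
      intPiece_singleton v one_pos, singleton_add_eq_vadd, hv]
  -- With V the volume of the tetrahedron, the dissection of its double reads 8V = V + |D|/2 + |D|/2
  -- + V.
  rw [e, c0, c1, c2, c3] at hd
  linarith

/-! ### Facet inequalities, special wedges and lattice points -/

/-- The inner normals of the facets of the tetrahedra, facet `j` being opposite to vertex `j`. -/
def facetNormal : Fin 3 → Fin 4 → Fin 3 → ℤ :=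
  ![![![-1, -1, -1], ![1, 1, -1], ![1, -1, 1], ![-1, 1, 1]],
    ![![-5, 1, 1], ![2, 2, -1], ![2, -1, 2], ![1, -2, -2]],
    ![![-2, -2, 1], ![1, 4, 1], ![-1, -1, -4], ![2, -1, 2]]]

def facetOffset : Fin 3 → Fin 4 → ℤ := ![![-2, 0, 0, 0], ![-9, 0, 0, 0], ![-9, 0, 0, 0]]

/-- The height of a vertex over the opposite facet. -/
def facetHeight : Fin 3 → ℤ := ![2, 9, 9]

theorem facetHeight_pos : ∀ i, 0 < facetHeight i := by decide

theorem facet_vertex : ∀ i j a, idot (facetNormal i j) (tetVertex i a) =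
    facetOffset i j + if a = j then facetHeight i else 0 := by
  decide

/-- These identities say that the facet functionals, shifted by the offsets and divided by the
height, are the barycentric coordinates; hence the facet inequalities describe the convex hull. -/
theorem facet_sum : ∀ i, (∀ k, ∑ j, facetNormal i j k = 0) ∧
    ∑ j, facetOffset i j = -facetHeight i ∧
    (∀ k l, ∑ j, facetNormal i j k * tetVertex i j l = if k = l then facetHeight i else 0) ∧
    ∀ l, ∑ j, facetOffset i j * tetVertex i j l = 0 := by
  decide

theorem mem_intSimplex_iff (i : Fin 3) (x : Space) : x ∈ intSimplex (tetVertex i) ↔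
    ∀ j, (facetOffset i j : ℝ) ≤ inner ℝ (intPoint (facetNormal i j)) x := by
  have hpos : (0 : ℝ) < facetHeight i := by exact_mod_cast facetHeight_pos i
  constructor
  · intro hx j
    have hsub : intSimplex (tetVertex i) ⊆
        {x | (facetOffset i j : ℝ) ≤ innerₛₗ ℝ (intPoint (facetNormal i j)) x} := by
      refine convexHull_min ?_ (convex_halfSpace_ge (LinearMap.isLinear _) _)
      rintro _ ⟨a, rfl⟩
      rw [Set.mem_ofPred_eq, innerₛₗ_apply_apply, inner_intPoint, facet_vertex]
      split_ifs
      · push_cast; linarith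
      · simp
    exact hsub hx
  · intro h
    obtain ⟨h1, h2, h3, h4⟩ := facet_sum i
    have h1' : ∀ k, ∑ j, (facetNormal i j k : ℝ) = 0 := fun k => by exact_mod_cast h1 k
    have h2' : ∑ j, (facetOffset i j : ℝ) = -facetHeight i := by exact_mod_cast h2
    have h3' : ∀ k l, ∑ j, (facetNormal i j k : ℝ) * tetVertex i j l =
        if k = l then (facetHeight i : ℝ) else 0 := fun k l => by exact_mod_cast h3 k l
    have h4' : ∀ l, ∑ j, (facetOffset i j : ℝ) * tetVertex i j l = 0 := fun l => by
      exact_mod_cast h4 l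
    rw [← one_smul ℝ (intSimplex _), intSimplex, mem_smul_convexHull_range_iff one_pos]
    refine ⟨fun j => (inner ℝ (intPoint (facetNormal i j)) x - facetOffset i j) / facetHeight i,
      fun j => div_nonneg (sub_nonneg.2 (h j)) hpos.le, ?_, ?_⟩
    · rw [← Finset.sum_div, div_eq_one_iff_eq hpos.ne', Finset.sum_sub_distrib, h2']
      simp only [inner_intPoint_left, Finset.sum_add_distrib, ← Finset.sum_mul, h1']
      ring
    · ext l
      have e : ∀ j, (inner ℝ (intPoint (facetNormal i j)) x - facetOffset i j) / facetHeight i *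
          (tetVertex i j l : ℝ) = (x 0 * (facetNormal i j 0 * tetVertex i j l) +
            x 1 * (facetNormal i j 1 * tetVertex i j l) +
            x 2 * (facetNormal i j 2 * tetVertex i j l) -
            facetOffset i j * tetVertex i j l) / facetHeight i := fun j => by
        rw [inner_intPoint_left]; ring
      simp only [WithLp.ofLp_sum, WithLp.ofLp_smul, Finset.sum_apply, Pi.smul_apply, smul_eq_mul]
      simp only [intPoint_apply]
      rw [Finset.sum_congr rfl fun j _ => e j, ← Finset.sum_div, Finset.sum_sub_distrib,
        Finset.sum_add_distrib, Finset.sum_add_distrib, ← Finset.mul_sum, ← Finset.mul_sum,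
        ← Finset.mul_sum, h3', h3', h3', h4', div_eq_iff hpos.ne']
      fin_cases l <;> simp

theorem intPoint_ne_zero_of_ne {z : Fin 3 → ℤ} (hz : z ≠ 0) : intPoint z ≠ 0 := fun h =>
  hz (intPoint_injective (h.trans (by ext; simp)))

/-- Equality of the two cosines, stated without square roots so that it can be decided over the
integers; `0 < k` fixes the sign. -/
theorem wedgeRatio_intPoint_congr {u v u' v' : Fin 3 → ℤ} {k : ℤ} (hk : 0 < k)
    (hne : u ≠ 0 ∧ v ≠ 0 ∧ u' ≠ 0 ∧ v' ≠ 0) (h : idot u' v' = k * idot u v)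
    (hnorm : idot u' u' * idot v' v' = k ^ 2 * (idot u u * idot v v)) :
    wedgeRatio (intPoint u') (intPoint v') = wedgeRatio (intPoint u) (intPoint v) := by
  have hnn : ∀ z : Fin 3 → ℤ, (0 : ℝ) ≤ idot z z := fun z => by
    rw [← inner_intPoint]
    exact real_inner_self_nonneg
  have hk' : (0 : ℝ) < k := by exact_mod_cast hk
  have h1 : (idot u' v' : ℝ) = k * idot u v := by exact_mod_cast h
  have h2 : (idot u' u' : ℝ) * idot v' v' = k ^ 2 * (idot u u * idot v v) := by
    exact_mod_cast hnorm
  refine wedgeRatio_congr (intPoint_ne_zero_of_ne hne.2.2.1) (intPoint_ne_zero_of_ne hne.2.2.2)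
    (intPoint_ne_zero_of_ne hne.1) (intPoint_ne_zero_of_ne hne.2.1) ?_
  rw [angle_intPoint, angle_intPoint, ← Real.sqrt_mul (hnn u'), ← Real.sqrt_mul (hnn u), h1, h2,
    Real.sqrt_mul (sq_nonneg _), Real.sqrt_sq hk'.le, mul_div_mul_left _ _ hk'.ne']

/-- Reversing one normal preserves a right angle and passes to the complementary wedge in a
half-space, so both are half of one half. -/
theorem wedgeRatio_of_idot_eq_zero {u v : Fin 3 → ℤ} (hu : u ≠ 0) (hv : v ≠ 0)
    (h : idot u v = 0) : wedgeRatio (intPoint u) (intPoint v) = 1 / 4 := by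
  have h1 := wedgeRatio_neg_right (intPoint_ne_zero_of_ne hu) (intPoint_ne_zero_of_ne hv)
  have h2 : wedgeRatio (intPoint u) (intPoint (-v)) = wedgeRatio (intPoint u) (intPoint v) :=
    wedgeRatio_intPoint_congr one_pos ⟨hu, hv, hu, neg_ne_zero.2 hv⟩
      (by simp [idot] at *; linarith) (by simp [idot])
  rw [intPoint_neg] at h2
  linarith

/-- For vectors of equal length `u + v` bisects their angle, so the two wedges in
`wedgeRatio_add_wedgeRatio` agree. Reversing `u + v` passes to the complement in a half-space; in
terms of dihedral angles, the first plus twice the second is π. -/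
theorem wedgeRatio_intPoint_add {u v : Fin 3 → ℤ} (hu : u ≠ 0) (hv : v ≠ 0) (huv : u + v ≠ 0)
    (h : idot u u = idot v v) : wedgeRatio (intPoint u) (intPoint v) +
      2 * wedgeRatio (intPoint u) (intPoint (-(u + v))) = 1 / 2 := by
  have h1 := wedgeRatio_add_wedgeRatio (intPoint_ne_zero_of_ne hu) (intPoint_ne_zero_of_ne hv)
    (by rw [← intPoint_add]; exact intPoint_ne_zero_of_ne huv)
  have h2 : wedgeRatio (intPoint v) (intPoint (u + v)) =
      wedgeRatio (intPoint u) (intPoint (u + v)) :=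
    wedgeRatio_intPoint_congr one_pos ⟨hu, huv, hv, huv⟩
      (by simp [idot] at *; linarith) (by rw [h]; ring)
  have h3 := wedgeRatio_neg_right (intPoint_ne_zero_of_ne hu) (intPoint_ne_zero_of_ne huv)
  rw [← intPoint_add, h2] at h1
  rw [intPoint_neg, h3]
  linarith

/-- Wedges with dihedral angle `π / 4`. -/
theorem wedgeRatio_quarter :
    wedgeRatio (intPoint ![1, 0, 0]) (intPoint ![-1, -1, 0]) = 1 / 8 := by
  have h := wedgeRatio_intPoint_add (u := ![1, 0, 0]) (v := ![0, 1, 0]) (by decide) (by decide)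
    (by decide) (by decide)
  rw [wedgeRatio_of_idot_eq_zero (by decide) (by decide) (by decide),
    show -(![1, 0, 0] + ![0, 1, 0]) = (![-1, -1, 0] : Fin 3 → ℤ) by decide] at h
  linarith

/-- Wedges with dihedral angle `π / 3`. -/
theorem wedgeRatio_third :
    wedgeRatio (intPoint ![1, -1, 0]) (intPoint ![0, 1, -1]) = 1 / 6 := by
  have h := wedgeRatio_intPoint_add (u := ![1, -1, 0]) (v := ![0, 1, -1]) (by decide) (by decide)
    (by decide) (by decide)
  have h' : wedgeRatio (intPoint ![1, -1, 0]) (intPoint (-(![1, -1, 0] + ![0, 1, -1]))) =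
      wedgeRatio (intPoint ![1, -1, 0]) (intPoint ![0, 1, -1]) :=
    wedgeRatio_intPoint_congr one_pos (by decide) (by decide) (by decide)
  linarith

/-- The relation between the dihedral angles `arccos (1 / 3)` and `arccos (1 / √3)`. -/
theorem wedgeRatio_relation :
    wedgeRatio (intPoint ![1, 1, -1]) (intPoint ![1, -1, 1]) +
      2 * wedgeRatio (intPoint ![1, 1, -1]) (intPoint ![-1, 0, 0]) = 1 / 2 := by
  have h := wedgeRatio_intPoint_add (u := ![1, 1, -1]) (v := ![1, -1, 1]) (by decide) (by decide)
    (by decide) (by decide)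
  have h' : wedgeRatio (intPoint ![1, 1, -1]) (intPoint (-(![1, 1, -1] + ![1, -1, 1]))) =
      wedgeRatio (intPoint ![1, 1, -1]) (intPoint ![-1, 0, 0]) :=
    wedgeRatio_intPoint_congr two_pos (by decide) (by decide) (by decide)
  linarith

/-- The cone cut out by the facets `j ∈ A` of the `i`-th tetrahedron. -/
def facetCone (i : Fin 3) (A : Finset (Fin 4)) : Set Space :=
  {y | ∀ j ∈ A, y ∈ halfSpace (intPoint (facetNormal i j))}

/-- The facets of the `i`-th tetrahedron through an integer point. -/
def activeFacets (i : Fin 3) (z : Fin 3 → ℤ) : Finset (Fin 4) :=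
  Finset.univ.filter fun j => idot (facetNormal i j) z = facetOffset i j

/-- Inequalities strict at the point stay strict nearby, so locally the tetrahedron is the cone of
the active facets. -/
theorem solidAngle_intSimplex {i : Fin 3} {z : Fin 3 → ℤ}
    (hz : ∀ j, facetOffset i j ≤ idot (facetNormal i j) z) :
    solidAngle (intSimplex (tetVertex i)) (intPoint z) =
      coneRatio (facetCone i (activeFacets i z)) := by
  refine solidAngle_eq_coneRatio ?_ ?_
  · intro r hr y hy j hj
    change 0 ≤ inner ℝ _ _
    rw [real_inner_smul_right]
    exact mul_nonneg hr.le (hy j hj)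
  · have hev : ∀ᶠ y : Space in 𝓝 (intPoint z), ∀ j, j ∉ activeFacets i z →
        (facetOffset i j : ℝ) < inner ℝ (intPoint (facetNormal i j)) y := by
      refine eventually_all.2 fun j => ?_
      by_cases hj : j ∈ activeFacets i z
      · simp [hj]
      · have hlt : (facetOffset i j : ℝ) < inner ℝ (intPoint (facetNormal i j)) (intPoint z) := by
          rw [inner_intPoint]
          refine Int.cast_lt.2 (lt_of_le_of_ne (hz j) fun h => hj ?_)
          simp [activeFacets, h]
        have hc : Continuous fun y : Space => inner ℝ (intPoint (facetNormal i j)) y := by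
          fun_prop
        exact (hc.continuousAt.eventually (lt_mem_nhds hlt)).mono fun y hy _ => hy
    filter_upwards [hev] with y hy
    have hact : ∀ j ∈ activeFacets i z,
        ((facetOffset i j : ℝ) ≤ inner ℝ (intPoint (facetNormal i j)) y ↔
          y - intPoint z ∈ halfSpace (intPoint (facetNormal i j))) := by
      intro j hj
      have h1 : idot (facetNormal i j) z = facetOffset i j := by simpa [activeFacets] using hj
      rw [halfSpace, Set.mem_ofPred_eq, inner_sub_right, inner_intPoint, h1, sub_nonneg]
    rw [mem_intSimplex_iff]
    constructor
    · exact fun h j hj => (hact j hj).1 (h j)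
    · intro h j
      by_cases hj : j ∈ activeFacets i z
      · exact (hact j hj).2 (h j hj)
      · exact (hy j hj).le

/-- The integer points of the tetrahedra. -/
noncomputable def latticePoints (i : Fin 3) : Finset (Fin 3 → ℤ) :=
  (Finset.Icc ![0, -2, -3] ![5, 2, 2]).filter fun z =>
    ∀ j, facetOffset i j ≤ idot (facetNormal i j) z

/-- The bounding box serves only to make the set finite and computable; the facet inequalities imply
it. -/
theorem mem_latticePoints {i : Fin 3} {z : Fin 3 → ℤ} :
    z ∈ latticePoints i ↔ ∀ j, facetOffset i j ≤ idot (facetNormal i j) z := by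
  rw [latticePoints, Finset.mem_filter, and_iff_right_of_imp]
  intro h
  have h0 := h 0
  have h1 := h 1
  have h2 := h 2
  have h3 := h 3
  rw [Finset.mem_Icc, Pi.le_def, Pi.le_def]
  fin_cases i <;> simp [idot, facetNormal, facetOffset] at h0 h1 h2 h3 <;>
    constructor <;> intro j <;> fin_cases j <;> simp <;> omega

theorem discreteVolume_intSimplex (i : Fin 3) : discreteVolume (intSimplex (tetVertex i)) =
    (((latticePoints i).val.map (activeFacets i)).map fun A => coneRatio (facetCone i A)).sum := by
  rw [(isBody_intSimplex _).discreteVolume_eq, finsum_eq_sum_of_support_subset (s := latticePoints i),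
    Multiset.map_map]
  · refine Finset.sum_congr rfl fun z hz => ?_
    exact solidAngle_intSimplex (mem_latticePoints.1 hz)
  · intro z hz
    rw [Finset.mem_coe, mem_latticePoints]
    by_contra h
    refine hz (solidAngle_eq_zero (isBody_intSimplex _).compact.isClosed fun hmem => h fun j => ?_)
    have := (mem_intSimplex_iff i _).1 hmem j
    rw [inner_intPoint] at this
    exact_mod_cast this

/-- Each lattice point is recorded by the face containing it in its relative interior. In T₂ only
one of the three edges with irrational angle, {0, 3}, has interior lattice points; this is where
lattice length and Euclidean length part. -/
theorem map_activeFacets : (latticePoints 0).val.map (activeFacets 0) =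
      {{0, 1, 2}, {0, 1, 3}, {0, 2, 3}, {1, 2, 3}} ∧
    (latticePoints 1).val.map (activeFacets 1) =
      {∅, ∅, {1}, {2}, {0, 3}, {0, 3}, {0, 1, 2}, {0, 1, 3}, {0, 2, 3}, {1, 2, 3}} ∧
    (latticePoints 2).val.map (activeFacets 2) =
      {∅, ∅, ∅, ∅, {0, 2}, {0, 2}, {1, 3}, {1, 3}, {0, 1, 2}, {0, 1, 3}, {0, 2, 3}, {1, 2, 3}} := by
  decide +kernel

/-! ### The defects of the three tetrahedra and the conclusion -/

theorem facetNormal_ne_zero (i : Fin 3) (j : Fin 4) : facetNormal i j ≠ 0 := by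
  revert i j
  decide

/-- The solid angle at the edge between two facets. -/
noncomputable def edgeRatio (i : Fin 3) (j k : Fin 4) : ℝ :=
  wedgeRatio (intPoint (facetNormal i j)) (intPoint (facetNormal i k))

theorem facetCone_insert (i : Fin 3) (j : Fin 4) (A : Finset (Fin 4)) :
    facetCone i (insert j A) = halfSpace (intPoint (facetNormal i j)) ∩ facetCone i A := by
  ext y
  simp [facetCone]

theorem facetCone_singleton (i : Fin 3) (j : Fin 4) :
    facetCone i {j} = halfSpace (intPoint (facetNormal i j)) := by
  ext y
  simp [facetCone]

theorem coneRatio_facetCone_empty (i : Fin 3) : coneRatio (facetCone i ∅) = 1 := by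
  rw [← coneRatio_univ]
  congr 1
  ext y
  simp [facetCone]

theorem coneRatio_facetCone_singleton (i : Fin 3) (j : Fin 4) :
    coneRatio (facetCone i {j}) = 1 / 2 := by
  rw [facetCone_singleton, coneRatio_halfSpace (intPoint_ne_zero_of_ne (facetNormal_ne_zero i j))]

theorem coneRatio_facetCone_pair (i : Fin 3) (j k : Fin 4) :
    coneRatio (facetCone i {j, k}) = edgeRatio i j k := by
  rw [facetCone_insert, facetCone_singleton]
  rfl

theorem coneRatio_facetCone_triple (i : Fin 3) (j k l : Fin 4) :
    coneRatio (facetCone i {j, k, l}) =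
      (edgeRatio i j k + edgeRatio i j l + edgeRatio i k l - 1 / 2) / 2 := by
  rw [facetCone_insert, facetCone_insert, facetCone_singleton, ← Set.inter_assoc]
  exact coneRatio_three (intPoint_ne_zero_of_ne (facetNormal_ne_zero i j))
    (intPoint_ne_zero_of_ne (facetNormal_ne_zero i k)) (intPoint_ne_zero_of_ne (facetNormal_ne_zero i l))

theorem edgeRatio_eq_of_idot_eq_zero {i : Fin 3} {j k : Fin 4}
    (h : idot (facetNormal i j) (facetNormal i k) = 0) : edgeRatio i j k = 1 / 4 :=
  wedgeRatio_of_idot_eq_zero (facetNormal_ne_zero i j) (facetNormal_ne_zero i k) h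

theorem edgeRatio_congr {i : Fin 3} {j k : Fin 4} {u v : Fin 3 → ℤ} (n : ℤ) (hn : 0 < n)
    (hu : u ≠ 0) (hv : v ≠ 0) (h : idot (facetNormal i j) (facetNormal i k) = n * idot u v)
    (hnorm : idot (facetNormal i j) (facetNormal i j) * idot (facetNormal i k) (facetNormal i k) =
      n ^ 2 * (idot u u * idot v v)) :
    edgeRatio i j k = wedgeRatio (intPoint u) (intPoint v) :=
  wedgeRatio_intPoint_congr hn ⟨hu, hv, facetNormal_ne_zero i j, facetNormal_ne_zero i k⟩ h hnorm

theorem volumeDefect_tetrahedron_zero : volumeDefect (intSimplex (tetVertex 0)) =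
    6 * wedgeRatio (intPoint ![1, 1, -1]) (intPoint ![1, -1, 1]) - 4 / 3 := by
  have e : ∀ j k, j < k →
      edgeRatio 0 j k = wedgeRatio (intPoint ![1, 1, -1]) (intPoint ![1, -1, 1]) :=
    fun j k hjk => edgeRatio_congr 1 one_pos (by decide) (by decide)
      (by revert j k; decide) (by revert j k; decide)
  rw [volumeDefect, discreteVolume_intSimplex, map_activeFacets.1,
    volumeReal_intSimplex (by decide),
    show det3 (tetVertex 0 1 - tetVertex 0 0) (tetVertex 0 2 - tetVertex 0 0)
      (tetVertex 0 3 - tetVertex 0 0) = -2 by decide]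
  simp only [Multiset.insert_eq_cons, Multiset.map_cons, Multiset.sum_cons, Multiset.map_singleton,
    Multiset.sum_singleton, coneRatio_facetCone_triple]
  rw [e 0 1 (by decide), e 0 2 (by decide), e 0 3 (by decide), e 1 2 (by decide),
    e 1 3 (by decide), e 2 3 (by decide)]
  norm_num
  ring

/-- The coefficient 5 comes from two lattice points inside one edge and three vertices, each
counting the irrational wedge once. -/
theorem volumeDefect_tetrahedron_one : volumeDefect (intSimplex (tetVertex 1)) =
    5 * wedgeRatio (intPoint ![1, 1, -1]) (intPoint ![-1, 0, 0]) - 7 / 4 := by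
  have e : ∀ k, 0 < k →
      edgeRatio 1 0 k = wedgeRatio (intPoint ![1, 1, -1]) (intPoint ![-1, 0, 0]) :=
    fun k hk => edgeRatio_congr 9 (by decide) (by decide) (by decide)
      (by revert k; decide) (by revert k; decide)
  have e' : ∀ j k, 0 < j → j < k → edgeRatio 1 j k = 1 / 4 := fun j k hj hk =>
    edgeRatio_eq_of_idot_eq_zero (by revert j k; decide)
  rw [volumeDefect, discreteVolume_intSimplex, map_activeFacets.2.1,
    volumeReal_intSimplex (by decide),
    show det3 (tetVertex 1 1 - tetVertex 1 0) (tetVertex 1 2 - tetVertex 1 0)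
      (tetVertex 1 3 - tetVertex 1 0) = 27 by decide]
  simp only [Multiset.insert_eq_cons, Multiset.map_cons, Multiset.sum_cons, Multiset.map_singleton,
    Multiset.sum_singleton, coneRatio_facetCone_triple, coneRatio_facetCone_pair,
    coneRatio_facetCone_singleton, coneRatio_facetCone_empty]
  rw [e 1 (by decide), e 2 (by decide), e 3 (by decide), e' 1 2 (by decide) (by decide),
    e' 1 3 (by decide) (by decide), e' 2 3 (by decide) (by decide)]
  norm_num
  ring

/-- All wedges have angles π/2, π/3 or π/4, so the defect is rational; the multiple 19 of it
balances the rational part left by the other two tetrahedra. -/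
theorem volumeDefect_tetrahedron_two : volumeDefect (intSimplex (tetVertex 2)) = 2 / 3 := by
  have e01 : edgeRatio 2 0 1 = 1 / 8 := (edgeRatio_congr 9 (by decide) (by decide) (by decide)
    (by decide) (by decide)).trans wedgeRatio_quarter
  have e23 : edgeRatio 2 2 3 = 1 / 8 := (edgeRatio_congr 9 (by decide) (by decide) (by decide)
    (by decide) (by decide)).trans wedgeRatio_quarter
  have e12 : edgeRatio 2 1 2 = 1 / 6 := (edgeRatio_congr 9 (by decide) (by decide) (by decide)
    (by decide) (by decide)).trans wedgeRatio_third
  have e02 : edgeRatio 2 0 2 = 1 / 4 := edgeRatio_eq_of_idot_eq_zero (by decide)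
  have e03 : edgeRatio 2 0 3 = 1 / 4 := edgeRatio_eq_of_idot_eq_zero (by decide)
  have e13 : edgeRatio 2 1 3 = 1 / 4 := edgeRatio_eq_of_idot_eq_zero (by decide)
  rw [volumeDefect, discreteVolume_intSimplex, map_activeFacets.2.2,
    volumeReal_intSimplex (by decide),
    show det3 (tetVertex 2 1 - tetVertex 2 0) (tetVertex 2 2 - tetVertex 2 0)
      (tetVertex 2 3 - tetVertex 2 0) = -27 by decide]
  simp only [Multiset.insert_eq_cons, Multiset.map_cons, Multiset.sum_cons, Multiset.map_singleton,
    Multiset.sum_singleton, coneRatio_facetCone_triple, coneRatio_facetCone_pair,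
    coneRatio_facetCone_empty]
  rw [e01, e02, e03, e12, e13, e23]
  norm_num

theorem volumeDefect_polytopeP : volumeDefect polytopeP = 0 := by
  rw [volumeDefect_polytopeP_eq, volumeDefect_tetrahedron_zero, volumeDefect_tetrahedron_one,
    volumeDefect_tetrahedron_two]
  -- With the two wedge ratios a and b, the sum is 30a + 60b − 20/3 − 21 + 38/3 = 30(a + 2b) − 15.
  linarith [wedgeRatio_relation]

theorem proposition4p1 :
    volumeDefect polytopeP = 0 ∧
    (∀ f : ℝ → ℝ, IsKagan f →
      dehnInvariant f polytopeP = -24 * Real.sqrt 2 * f (Real.arccos (1 / 3))) ∧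
    (∃ f : ℝ → ℝ, IsKagan f ∧ dehnInvariant f polytopeP ≠ 0) := by
  refine ⟨volumeDefect_polytopeP, fun f hf => dehnInvariant_polytopeP hf, ?_⟩
  obtain ⟨f, hf, hne⟩ := exists_kagan
  refine ⟨f, hf, ?_⟩
  rw [dehnInvariant_polytopeP hf]
  exact mul_ne_zero (mul_ne_zero (by norm_num) (by positivity)) hne
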